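/- Let $G$ be a finite group. Write $M^*$ and $M_*$ for the contravariant and covariant parts of a Mackey functor $M$ for $G$, viewed as a bifunctor on finite $G$-sets, with $M(H)=M(G/H)$ for $H\le G$. Let $R$ be a commutative Green functor for $G$ and let $R\text{-Mack}$ be the category of Mackey $R$-modules, with the symmetric monoidal structure $\otimes_R$ given by $$(M\otimes_R N)(X)=\Big(\bigoplus_{\theta:Y\to X}M(Y)\otimes_{\mathbb Z}N(Y)\Big)\Big/\mathcal J ,$$ the sum being over all maps $\theta$ of finite $G$-sets to $X$, where $\mathcal J$ is generated by $M_*(f)(m)\otimes n'-m\otimes N^*(f)(n')$, $M^*(f)(m')\otimes n-m'\otimes N_*(f)(n)$ and $rm\otimes n-m\otimes rn$ for all $f:Y\to Y'$ over $X$ and $m\in M(Y)$, $n\in N(Y)$, $m'\in M(Y')$, $n'\in N(Y')$, $r\in R(Y)$; the tensor unit is $R$. For $H\le G$ let $W_G(H)=N_G(H)/H$, and for a Mackey functor $M$ let $$\overline M(H)=M(H)\Big/\sum_{H'\lneq H}\mathrm{ind}_{H'}^H M(H')$$ be its Brauer quotient, with the conjugation action $c$ of $W_G(H)$. Then $\overline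 R(H)$ is a commutative ring on which $W_G(H)$ acts by ring automorphisms, and for every $M\in R\text{-Mack}$ the pair $(\overline M(H),c)$ is a left module over the skew group ring $\overline R(H)\rtimes_c W_G(H)$. Let $$\mathrm{Br}_H:\ R\text{-Mack}\longrightarrow \overline R(H)\rtimes_c W_G(H)\text{-Mod},\qquad M\mapsto(\overline M(H),c),$$ be the resulting functor. For a commutative ring $S$ with an action of a group $W$ by ring automorphisms, equip $S\rtimes W\text{-Mod}$ with the tensor product $\otimes_S$ with diagonal $W$-action; its unit is $S$. **Theorem.** 1. For each $H\le G$ the functor $\mathrm{Br}_H$ is strong symmetric monoidal, with unit isomorphism the identity of $\overline R(H)$ and with $\overline M(H)\otimes_{\overline R(H)}\overline N(H)\xrightarrow{\ \sim\ }\overline{(M\otimes_R N)}(H)$ sending $[m]\otimes[n]$ to the class of $m\otimes n$ in the summand $\theta=\mathrm{id}_{G/H}$. 2. Choose one subgroup $H$ in each conjugacy class of subgroups of $G$. The functor $$\mathrm{Br}=(\mathrm{Br}_H)_{H}:\ R\text{-Mack}\longrightarrow\prod_{\mathrm{Cl}(H),\,H\le G}\overline R(H)\rtimes_c W_G(H)\text{-Mod}$$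 is strong symmetric monoidal for the product tensor structure on the target. 3. Let $Q\subseteq\mathbb Q$ be a subring containing $|G|^{-1}$, and let $R_Q=Q\otimes_{\mathbb Z}R$ be the Green functor with $R_Q(X)=Q\otimes_{\mathbb Z}R(X)$. For a Mackey $R_Q$-module $M$, let $Q\otimes_{\mathbb Z}\overline R(H)$ act on $\overline M(H)$ through the canonical map $Q\otimes_{\mathbb Z}\overline R(H)\to\overline{R_Q}(H)$, $q\otimes[r]\mapsto[q\otimes r]$. Then the Brauer quotients $M\mapsto(\overline M(H),c)_H$ define an equivalence of tensor categories $$R_Q\text{-Mack}\ \simeq\prod_{\mathrm{Cl}(H),\,H\le G}\big(Q\otimes_{\mathbb Z}\overline R(H)\big)\rtimes_c W_G(H)\text{-Mod},$$ that is, a strong symmetric monoidal functor which is an equivalence of categories. -/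

import Mathlib

open CategoryTheory MonoidalCategory
open scoped TensorProduct

universe u

noncomputable section

/-! ### Finite `G`-sets -/

/-- A finite left `G`-set. -/
structure FinGSet (G : Type u) [Group G] where
  carrier : Type u
  [finite : Finite carrier]
  [action : MulAction G carrier]

namespace FinGSet

variable {G : Type u} [Group G]

instance : CoeSort (FinGSet G) (Type u) := ⟨FinGSet.carrier⟩

instance (X : FinGSet G) : Finite X := X.finite

instance (X : FinGSet G) : MulAction G X := X.action

/-- The disjoint union of two finite `G`-sets. -/
def sum (X Y : FinGSet G) : FinGSet G where
  carrier := X ⊕ Y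

/-- The inclusion of the first summand. -/
def inl (X Y : FinGSet G) : X →[G] X.sum Y where
  toFun := Sum.inl
  map_smul' _ _ := rfl

/-- The inclusion of the second summand. -/
def inr (X Y : FinGSet G) : Y →[G] X.sum Y where
  toFun := Sum.inr
  map_smul' _ _ := rfl

/-- The transitive `G`-set `G/H`. -/
def orbit [Finite G] (H : Subgroup G) : FinGSet G where
  carrier := G ⧸ H

/-- The map `G/K → G/L`, `γK ↦ γgL`, for `g⁻¹Kg ≤ L`. -/
def orbitMap [Finite G] (K L : Subgroup G) (g : G) (h : ∀ k ∈ K, g⁻¹ * k * g ∈ L) :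
    orbit K →[G] orbit L where
  toFun := Quotient.map' (fun γ => γ * g) fun a b hab => by
    rw [QuotientGroup.leftRel_apply] at hab ⊢
    have := h _ hab
    simpa [mul_assoc] using this
  map_smul' a x := by
    induction x using QuotientGroup.induction_on with
    | H γ => exact congrArg (QuotientGroup.mk (s := L)) (mul_assoc a γ g)

/-- The projection `G/K → G/H`, `γK ↦ γH`, for `K ≤ H`. -/
def orbitProj [Finite G] {K H : Subgroup G} (h : K ≤ H) : orbit K →[G] orbit H :=
  orbitMap K H 1 fun k hk => by simpa using h hk

/-- The map `G/H → G/H`, `γH ↦ γgH`, for `g` in the normalizer of `H`. -/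
def orbitConj [Finite G] (H : Subgroup G) (g : Subgroup.normalizer (H : Set G)) :
    orbit H →[G] orbit H :=
  orbitMap H H g fun k hk => by
    have := (Subgroup.mem_normalizer_iff.1 (inv_mem g.2) k).1 hk
    simpa using this

/-- The square
```
P --q--> Y
|p       |g
X --f--> Z
```
of finite `G`-sets is a pullback square. -/
def IsPullbackSq {P X Y Z : FinGSet G} (p : P →[G] X) (q : P →[G] Y) (f : X →[G] Z)
    (g : Y →[G] Z) : Prop :=
  (∀ z, f (p z) = g (q z)) ∧ ∀ x y, f x = g y → ∃! z, p z = x ∧ q z = y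

/-- The standard pullback `X ×_Z Y`. -/
def pullback {X Y Z : FinGSet G} (f : X →[G] Z) (g : Y →[G] Z) : FinGSet G where
  carrier := {z : X × Y // f z.1 = g z.2}
  action :=
    { smul := fun a z => ⟨(a • z.1.1, a • z.1.2), by simp [z.2]⟩
      one_smul := fun z => Subtype.ext (one_smul G z.1)
      mul_smul := fun a b z => Subtype.ext (mul_smul a b z.1) }

/-- First projection of the pullback. -/
def pbFst {X Y Z : FinGSet G} (f : X →[G] Z) (g : Y →[G] Z) : pullback f g →[G] X where
  toFun z := z.1.1
  map_smul' _ _ := rfl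

/-- Second projection of the pullback. -/
def pbSnd {X Y Z : FinGSet G} (f : X →[G] Z) (g : Y →[G] Z) : pullback f g →[G] Y where
  toFun z := z.1.2
  map_smul' _ _ := rfl

theorem pullback_isPullbackSq {X Y Z : FinGSet G} (f : X →[G] Z) (g : Y →[G] Z) :
    IsPullbackSq (pbFst f g) (pbSnd f g) f g :=
  ⟨fun z => z.2, fun x y h => ⟨⟨(x, y), h⟩, ⟨rfl, rfl⟩, by
    rintro ⟨⟨a, b⟩, hz⟩ ⟨rfl, rfl⟩; rfl⟩⟩

theorem IsPullbackSq.comm {P X Y Z : FinGSet G} {p : P →[G] X} {q : P →[G] Y} {f : X →[G] Z}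
    {g : Y →[G] Z} (h : IsPullbackSq p q f g) : f.comp p = g.comp q :=
  MulActionHom.ext h.1

theorem IsPullbackSq.symm {P X Y Z : FinGSet G} {p : P →[G] X} {q : P →[G] Y} {f : X →[G] Z}
    {g : Y →[G] Z} (h : IsPullbackSq p q f g) : IsPullbackSq q p g f :=
  ⟨fun z => (h.1 z).symm, fun x y e => by
    obtain ⟨z, hz, hu⟩ := h.2 y x e.symm
    exact ⟨z, hz.symm, fun w hw => hu w hw.symm⟩⟩

theorem isPullbackSq_id {X Y : FinGSet G} (f : X →[G] Y) :
    IsPullbackSq f (MulActionHom.id G) (MulActionHom.id G) f :=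
  ⟨fun _ => rfl, fun _ y h => ⟨y, ⟨Eq.symm h, rfl⟩, fun _ hw => hw.2⟩⟩

theorem isPullbackSq_inj {X Y : FinGSet G} (f : X →[G] Y) (hf : Function.Injective f) :
    IsPullbackSq (MulActionHom.id G) (MulActionHom.id G) f f :=
  ⟨fun _ => rfl, fun x _ h => ⟨x, ⟨rfl, hf h⟩, fun _ hw => hw.1⟩⟩

/-- Horizontal pasting of pullback squares. -/
theorem IsPullbackSq.paste {P Q X Y Y' Z : FinGSet G} {p : P →[G] X} {q : P →[G] Y}
    {f : X →[G] Z} {g : Y →[G] Z} {p' : Q →[G] P} {q' : Q →[G] Y'} {g' : Y' →[G] Y}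
    (h : IsPullbackSq p q f g) (h' : IsPullbackSq p' q' q g') :
    IsPullbackSq (p.comp p') q' f (g.comp g') := by
  refine ⟨fun z => (h.1 _).trans (congrArg g (h'.1 z)), fun x y e => ?_⟩
  obtain ⟨w, ⟨hw1, hw2⟩, hw⟩ := h.2 x (g' y) e
  obtain ⟨v, ⟨hv1, hv2⟩, hv⟩ := h'.2 w y hw2
  refine ⟨v, ⟨(congrArg p hv1).trans hw1, hv2⟩, fun v' ⟨h1, h2⟩ => hv v' ⟨hw _ ⟨h1, ?_⟩, h2⟩⟩
  exact (h'.1 v').trans (congrArg g' h2)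

end FinGSet

open FinGSet

/-! ### Mackey functors, commutative Green functors and Mackey modules -/

/-- The axioms of a Mackey functor for `G` in terms of finite `G`-sets. Here `res f` is the
contravariant map `M^*(f)` and `ind f` the covariant map `M_*(f)` attached to a map `f` of finite
`G`-sets. In terms of subgroups, `M(H) = M(G/H)`, restriction and induction between `K ≤ H` are the
two maps attached to `orbitProj`, and conjugation by `g` is the contravariant map attached to
`γ ↦ γg`. The values live one universe above `G`, so that the direct sum over all finite `G`-sets
in the definition of the tensor product is again a possible value. -/
structure IsMackey {G : Type u} [Group G] (obj : FinGSet G → Type (u + 1))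
    [∀ X, AddCommGroup (obj X)]
    (res : ∀ ⦃X Y : FinGSet G⦄, (X →[G] Y) → (obj Y →+ obj X))
    (ind : ∀ ⦃X Y : FinGSet G⦄, (X →[G] Y) → (obj X →+ obj Y)) : Prop where
  res_id : ∀ (X : FinGSet G) (m : obj X), res (MulActionHom.id G) m = m
  res_comp : ∀ ⦃X Y Z : FinGSet G⦄ (g : Y →[G] Z) (f : X →[G] Y) (m : obj Z),
    res (g.comp f) m = res f (res g m)
  ind_id : ∀ (X : FinGSet G) (m : obj X), ind (MulActionHom.id G) m = m
  ind_comp : ∀ ⦃X Y Z : FinGSet G⦄ (g : Y →[G] Z) (f : X →[G] Y) (m : obj X),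
    ind (g.comp f) m = ind g (ind f m)
  base_change : ∀ ⦃P X Y Z : FinGSet G⦄ (p : P →[G] X) (q : P →[G] Y) (f : X →[G] Z)
    (g : Y →[G] Z), IsPullbackSq p q f g → ∀ m : obj X, res g (ind f m) = ind q (res p m)
  /-- Disjoint unions are sent to direct sums. -/
  additive : ∀ X Y : FinGSet G,
    Function.Bijective fun m : obj (X.sum Y) => (res (inl X Y) m, res (inr X Y) m)

/-- A commutative Green functor for `G`. -/
structure CommGreenFunctor (G : Type u) [Group G] where
  obj : FinGSet G → Type (u + 1)
  [ring : ∀ X, CommRing (obj X)]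
  res : ∀ ⦃X Y : FinGSet G⦄, (X →[G] Y) → (obj Y →+* obj X)
  ind : ∀ ⦃X Y : FinGSet G⦄, (X →[G] Y) → (obj X →+ obj Y)
  isMackey : IsMackey obj (fun _ _ f => (res f).toAddMonoidHom) ind
  /-- The Frobenius relation. -/
  frobenius : ∀ ⦃X Y : FinGSet G⦄ (f : X →[G] Y) (r : obj Y) (s : obj X),
    ind f (res f r * s) = r * ind f s

attribute [instance] CommGreenFunctor.ring

/-- A Mackey module over a commutative Green functor `R`. -/
structure MackeyModule {G : Type u} [Group G] (R : CommGreenFunctor G) where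
  obj : FinGSet G → Type (u + 1)
  [grp : ∀ X, AddCommGroup (obj X)]
  [mod : ∀ X, Module (R.obj X) (obj X)]
  res : ∀ ⦃X Y : FinGSet G⦄, (X →[G] Y) → (obj Y →+ obj X)
  ind : ∀ ⦃X Y : FinGSet G⦄, (X →[G] Y) → (obj X →+ obj Y)
  isMackey : IsMackey obj res ind
  res_smul : ∀ ⦃X Y : FinGSet G⦄ (f : X →[G] Y) (r : R.obj Y) (m : obj Y),
    res f (r • m) = R.res f r • res f m
  /-- The first Frobenius relation. -/
  ind_res_smul : ∀ ⦃X Y : FinGSet G⦄ (f : X →[G] Y) (r : R.obj Y) (m : obj X),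
    ind f (R.res f r • m) = r • ind f m
  /-- The second Frobenius relation. -/
  ind_smul_res : ∀ ⦃X Y : FinGSet G⦄ (f : X →[G] Y) (r : R.obj X) (m : obj Y),
    ind f (r • res f m) = R.ind f r • m

attribute [instance] MackeyModule.grp MackeyModule.mod

section MackeyLemmas

variable {G : Type u} [Group G] {obj : FinGSet G → Type (u + 1)} [∀ X, AddCommGroup (obj X)]
  {res : ∀ ⦃X Y : FinGSet G⦄, (X →[G] Y) → (obj Y →+ obj X)}
  {ind : ∀ ⦃X Y : FinGSet G⦄, (X →[G] Y) → (obj X →+ obj Y)}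

theorem IsMackey.subsingleton (h : IsMackey obj res ind) (X : FinGSet G) [IsEmpty X] :
    Subsingleton (obj X) := by
  refine ⟨fun a b => ?_⟩
  obtain ⟨m, hm⟩ := (h.additive X X).2 (a, b)
  have e : inl X X = inr X X := MulActionHom.ext fun x => isEmptyElim x
  simp only [e, Prod.mk.injEq] at hm
  exact hm.1.symm.trans hm.2

theorem isMackey_aux_inl
    (res_id : ∀ (X : FinGSet G) (m : obj X), res (MulActionHom.id G) m = m)
    (ind_id : ∀ (X : FinGSet G) (m : obj X), ind (MulActionHom.id G) m = m)
    (base_change : ∀ ⦃P X Y Z : FinGSet G⦄ (p : P →[G] X) (q : P →[G] Y) (f : X →[G] Z)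
      (g : Y →[G] Z), IsPullbackSq p q f g → ∀ m : obj X, res g (ind f m) = ind q (res p m))
    (empty : ∀ X : FinGSet G, IsEmpty X → Subsingleton (obj X)) (X Y : FinGSet G) (a : obj X)
    (b : obj Y) :
    res (inl X Y) (ind (inl X Y) a) = a ∧ res (inr X Y) (ind (inr X Y) b) = b ∧
      res (inr X Y) (ind (inl X Y) a) = 0 ∧ res (inl X Y) (ind (inr X Y) b) = 0 := by
  refine ⟨?_, ?_, ?_, ?_⟩
  · rw [base_change _ _ _ _ (isPullbackSq_inj _ Sum.inl_injective), res_id, ind_id]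
  · rw [base_change _ _ _ _ (isPullbackSq_inj _ Sum.inr_injective), res_id, ind_id]
  · have := empty (pullback (inl X Y) (inr X Y)) ⟨fun z => Sum.inl_ne_inr z.2⟩
    rw [base_change _ _ _ _ (pullback_isPullbackSq _ _), Subsingleton.elim (res _ a) 0, map_zero]
  · have := empty (pullback (inr X Y) (inl X Y)) ⟨fun z => Sum.inr_ne_inl z.2⟩
    rw [base_change _ _ _ _ (pullback_isPullbackSq _ _), Subsingleton.elim (res _ b) 0, map_zero]

theorem IsMackey.sum_eq (h : IsMackey obj res ind) (X Y : FinGSet G) (m : obj (X.sum Y)) :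
    ind (inl X Y) (res (inl X Y) m) + ind (inr X Y) (res (inr X Y) m) = m := by
  apply (h.additive X Y).1
  obtain ⟨h1, h2, h3, h4⟩ := isMackey_aux_inl h.res_id h.ind_id h.base_change
    (fun X hX => h.subsingleton X) X Y (res (inl X Y) m) (res (inr X Y) m)
  simp only [map_add, h1, h2, h3, h4, add_zero, zero_add]

theorem isMackey_of_sum_eq
    (res_id : ∀ (X : FinGSet G) (m : obj X), res (MulActionHom.id G) m = m)
    (res_comp : ∀ ⦃X Y Z : FinGSet G⦄ (g : Y →[G] Z) (f : X →[G] Y) (m : obj Z),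
      res (g.comp f) m = res f (res g m))
    (ind_id : ∀ (X : FinGSet G) (m : obj X), ind (MulActionHom.id G) m = m)
    (ind_comp : ∀ ⦃X Y Z : FinGSet G⦄ (g : Y →[G] Z) (f : X →[G] Y) (m : obj X),
      ind (g.comp f) m = ind g (ind f m))
    (base_change : ∀ ⦃P X Y Z : FinGSet G⦄ (p : P →[G] X) (q : P →[G] Y) (f : X →[G] Z)
      (g : Y →[G] Z), IsPullbackSq p q f g → ∀ m : obj X, res g (ind f m) = ind q (res p m))
    (empty : ∀ X : FinGSet G, IsEmpty X → Subsingleton (obj X))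
    (sum_eq : ∀ (X Y : FinGSet G) (m : obj (X.sum Y)),
      ind (inl X Y) (res (inl X Y) m) + ind (inr X Y) (res (inr X Y) m) = m) :
    IsMackey obj res ind where
  res_id := res_id
  res_comp := res_comp
  ind_id := ind_id
  ind_comp := ind_comp
  base_change := base_change
  additive X Y := by
    refine ⟨fun m m' e => ?_, fun ⟨a, b⟩ => ⟨ind (inl X Y) a + ind (inr X Y) b, ?_⟩⟩
    · simp only [Prod.mk.injEq] at e
      rw [← sum_eq X Y m, ← sum_eq X Y m', e.1, e.2]
    · obtain ⟨h1, h2, h3, h4⟩ := isMackey_aux_inl res_id ind_id base_change empty X Y a b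
      simp only [map_add, h1, h2, h3, h4, add_zero, zero_add]

end MackeyLemmas

namespace CommGreenFunctor

variable {G : Type u} [Group G] (R : CommGreenFunctor G)

theorem frobenius' {X Y : FinGSet G} (f : X →[G] Y) (r : R.obj X) (s : R.obj Y) :
    R.ind f (r * R.res f s) = R.ind f r * s := by
  rw [mul_comm, R.frobenius, mul_comm]

/-- The Green functor `R` as a Mackey module over itself. -/
abbrev self : MackeyModule R where
  obj := R.obj
  res _ _ f := (R.res f).toAddMonoidHom
  ind := R.ind
  isMackey := R.isMackey
  res_smul _ _ f r m := map_mul (R.res f) r m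
  ind_res_smul _ _ f r m := R.frobenius f r m
  ind_smul_res _ _ f r m := R.frobenius' f r m

theorem res_comp {X Y Z : FinGSet G} (g : Y →[G] Z) (f : X →[G] Y) (m : R.obj Z) :
    R.res (g.comp f) m = R.res f (R.res g m) := R.isMackey.res_comp g f m

theorem res_id {X : FinGSet G} (m : R.obj X) : R.res (MulActionHom.id G) m = m :=
  R.isMackey.res_id X m

theorem ind_id {X : FinGSet G} (m : R.obj X) : R.ind (MulActionHom.id G) m = m :=
  R.isMackey.ind_id X m

theorem ind_comp {X Y Z : FinGSet G} (g : Y →[G] Z) (f : X →[G] Y) (m : R.obj X) :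
    R.ind (g.comp f) m = R.ind g (R.ind f m) := R.isMackey.ind_comp g f m

theorem base_change {P X Y Z : FinGSet G} {p : P →[G] X} {q : P →[G] Y} {f : X →[G] Z}
    {g : Y →[G] Z} (h : IsPullbackSq p q f g) (m : R.obj X) :
    R.res g (R.ind f m) = R.ind q (R.res p m) := R.isMackey.base_change p q f g h m

end CommGreenFunctor

namespace MackeyModule

variable {G : Type u} [Group G] {R : CommGreenFunctor G}

section

variable (M : MackeyModule R)

theorem res_comp {X Y Z : FinGSet G} (g : Y →[G] Z) (f : X →[G] Y) (m : M.obj Z) :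
    M.res (g.comp f) m = M.res f (M.res g m) := M.isMackey.res_comp g f m

theorem res_id {X : FinGSet G} (m : M.obj X) : M.res (MulActionHom.id G) m = m :=
  M.isMackey.res_id X m

theorem ind_id {X : FinGSet G} (m : M.obj X) : M.ind (MulActionHom.id G) m = m :=
  M.isMackey.ind_id X m

theorem ind_comp {X Y Z : FinGSet G} (g : Y →[G] Z) (f : X →[G] Y) (m : M.obj X) :
    M.ind (g.comp f) m = M.ind g (M.ind f m) := M.isMackey.ind_comp g f m

theorem base_change {P X Y Z : FinGSet G} {p : P →[G] X} {q : P →[G] Y} {f : X →[G] Z}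
    {g : Y →[G] Z} (h : IsPullbackSq p q f g) (m : M.obj X) :
    M.res g (M.ind f m) = M.ind q (M.res p m) := M.isMackey.base_change p q f g h m

end

/-- A morphism of Mackey `R`-modules. -/
@[ext]
structure Hom (M N : MackeyModule R) where
  app : ∀ X : FinGSet G, M.obj X →ₗ[R.obj X] N.obj X
  app_res : ∀ ⦃X Y : FinGSet G⦄ (f : X →[G] Y) (m : M.obj Y),
    app X (M.res f m) = N.res f (app Y m)
  app_ind : ∀ ⦃X Y : FinGSet G⦄ (f : X →[G] Y) (m : M.obj X),
    app Y (M.ind f m) = N.ind f (app X m)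

/-- The category of Mackey `R`-modules. -/
instance : Category (MackeyModule R) where
  Hom := Hom
  id M :=
    { app := fun _ => LinearMap.id
      app_res := fun _ _ _ _ => rfl
      app_ind := fun _ _ _ _ => rfl }
  comp f g :=
    { app := fun X => (g.app X).comp (f.app X)
      app_res := fun X Y h m => by simp [f.app_res, g.app_res]
      app_ind := fun X Y h m => by simp [f.app_ind, g.app_ind] }

@[ext]
theorem hom_ext {M N : MackeyModule R} {f g : M ⟶ N} (h : ∀ X m, f.app X m = g.app X m) : f = g :=
  Hom.ext (funext fun X => LinearMap.ext (h X))

@[simp] theorem id_app {M : MackeyModule R} (X : FinGSet G) (m : M.obj X) :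
    Hom.app (𝟙 M) X m = m := rfl

@[simp] theorem comp_app {M N P : MackeyModule R} (f : M ⟶ N) (g : N ⟶ P) (X : FinGSet G)
    (m : M.obj X) : (f ≫ g).app X m = g.app X (f.app X m) := rfl

end MackeyModule

/-! ### The tensor product of Mackey modules -/

namespace MackeyModule

section Tensor

variable {G : Type u} [Group G] {R : CommGreenFunctor G} (M N : MackeyModule R)

/-- The index set of the direct sum defining the tensor product at `X`: all finite `G`-sets `Y`
together with a map `θ : Y → X`. -/
structure _root_.FinGSet.Over (X : FinGSet G) where
  left : FinGSet G
  hom : left →[G] X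

instance (X : FinGSet G) : DecidableEq X.Over := Classical.decEq _

/-- The direct sum `⨁_{θ : Y → X} M(Y) ⊗_ℤ N(Y)`. -/
abbrev TensorPre (X : FinGSet G) : Type (u + 1) :=
  DirectSum X.Over fun i => M.obj i.left ⊗[ℤ] N.obj i.left

/-- The element `m ⊗ n` in the summand of index `θ`. -/
def tensorPreOf {X Y : FinGSet G} (θ : Y →[G] X) (m : M.obj Y) (n : N.obj Y) :
    TensorPre M N X :=
  DirectSum.of (fun i : X.Over => M.obj i.left ⊗[ℤ] N.obj i.left) ⟨Y, θ⟩ (m ⊗ₜ n)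

/-- The relations defining `(M ⊗_R N)(X)`; the elements below have to vanish. -/
inductive TensorRel (X : FinGSet G) : TensorPre M N X → Prop
  | ind_left {Y Y' : FinGSet G} (θ' : Y' →[G] X) (f : Y →[G] Y') (m : M.obj Y) (n' : N.obj Y') :
      TensorRel X (tensorPreOf M N θ' (M.ind f m) n' -
        tensorPreOf M N (θ'.comp f) m (N.res f n'))
  | ind_right {Y Y' : FinGSet G} (θ' : Y' →[G] X) (f : Y →[G] Y') (m' : M.obj Y')
      (n : N.obj Y) :
      TensorRel X (tensorPreOf M N (θ'.comp f) (M.res f m') n -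
        tensorPreOf M N θ' m' (N.ind f n))
  | smul {Y : FinGSet G} (θ : Y →[G] X) (r : R.obj Y) (m : M.obj Y) (n : N.obj Y) :
      TensorRel X (tensorPreOf M N θ (r • m) n - tensorPreOf M N θ m (r • n))

/-- The abelian group `(M ⊗_R N)(X)`. -/
def TensorObj (X : FinGSet G) : Type (u + 1) :=
  TensorPre M N X ⧸ AddSubgroup.closure {t | TensorRel M N X t}

instance (X : FinGSet G) : AddCommGroup (TensorObj M N X) :=
  inferInstanceAs (AddCommGroup (TensorPre M N X ⧸ AddSubgroup.closure {t | TensorRel M N X t}))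

variable {M N}

/-- The class `[θ, m ⊗ n]` in `(M ⊗_R N)(X)`. -/
def gen {X Y : FinGSet G} (θ : Y →[G] X) (m : M.obj Y) (n : N.obj Y) : TensorObj M N X :=
  QuotientAddGroup.mk (tensorPreOf M N θ m n)

section gen

variable {X Y Y' : FinGSet G} (θ : Y →[G] X) (θ' : Y' →[G] X)

theorem gen_add_left (m m' : M.obj Y) (n : N.obj Y) :
    gen θ (m + m') n = gen θ m n + gen θ m' n := by
  simp only [gen, tensorPreOf, TensorProduct.add_tmul, map_add]; rfl

theorem gen_add_right (m : M.obj Y) (n n' : N.obj Y) :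
    gen θ m (n + n') = gen θ m n + gen θ m n' := by
  simp only [gen, tensorPreOf, TensorProduct.tmul_add, map_add]; rfl

theorem gen_zero_left (n : N.obj Y) : gen θ (0 : M.obj Y) n = 0 := by
  simp only [gen, tensorPreOf, TensorProduct.zero_tmul, map_zero]; rfl

theorem gen_zero_right (m : M.obj Y) : gen θ m (0 : N.obj Y) = 0 := by
  simp only [gen, tensorPreOf, TensorProduct.tmul_zero, map_zero]; rfl

/-- `gen` as a biadditive map. -/
def genHom : M.obj Y →+ N.obj Y →+ TensorObj M N X :=
  AddMonoidHom.mk' (fun m => AddMonoidHom.mk' (fun n => gen θ m n) (gen_add_right θ m))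
    (fun m m' => AddMonoidHom.ext fun n => gen_add_left θ m m' n)

@[simp] theorem genHom_apply (m : M.obj Y) (n : N.obj Y) : genHom θ m n = gen θ m n := rfl

theorem gen_ind_left (f : Y →[G] Y') (m : M.obj Y) (n' : N.obj Y') :
    gen θ' (M.ind f m) n' = gen (θ'.comp f) m (N.res f n') := by
  refine sub_eq_zero.1 ?_
  exact (QuotientAddGroup.eq_zero_iff _).2 (AddSubgroup.subset_closure (.ind_left θ' f m n'))

theorem gen_ind_right (f : Y →[G] Y') (m' : M.obj Y') (n : N.obj Y) :
    gen θ' m' (N.ind f n) = gen (θ'.comp f) (M.res f m') n := by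
  refine (sub_eq_zero.1 ?_).symm
  exact (QuotientAddGroup.eq_zero_iff _).2 (AddSubgroup.subset_closure (.ind_right θ' f m' n))

theorem gen_smul (r : R.obj Y) (m : M.obj Y) (n : N.obj Y) :
    gen θ (r • m) n = gen θ m (r • n) := by
  refine sub_eq_zero.1 ?_
  exact (QuotientAddGroup.eq_zero_iff _).2 (AddSubgroup.subset_closure (.smul θ r m n))

end gen

theorem tensorObj_induction {X : FinGSet G} {p : TensorObj M N X → Prop} (t : TensorObj M N X)
    (zero : p 0) (add : ∀ a b, p a → p b → p (a + b))
    (gen : ∀ (Y : FinGSet G) (θ : Y →[G] X) (m : M.obj Y) (n : N.obj Y), p (gen θ m n)) :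
    p t := by
  induction t using QuotientAddGroup.induction_on with
  | H t =>
    induction t using DirectSum.induction_on with
    | zero => exact zero
    | of i x =>
      induction x using TensorProduct.induction_on with
      | zero => rw [map_zero]; exact zero
      | tmul m n => exact gen _ i.hom m n
      | add a b ha hb => rw [map_add]; exact add _ _ ha hb
    | add a b ha hb => exact add _ _ ha hb

theorem tensorObj_addHom_ext {A : Type*} [AddCommGroup A] {X : FinGSet G}
    {f g : TensorObj M N X →+ A}
    (h : ∀ (Y : FinGSet G) (θ : Y →[G] X) (m : M.obj Y) (n : N.obj Y),
      f (gen θ m n) = g (gen θ m n)) : f = g := by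
  ext t
  induction t using tensorObj_induction with
  | zero => rw [map_zero, map_zero]
  | add a b ha hb => rw [map_add, map_add, ha, hb]
  | gen Y θ m n => exact h Y θ m n

/-- The universal property of `(M ⊗_R N)(X)`. -/
def tensorLift {A : Type*} [AddCommGroup A] {X : FinGSet G}
    (φ : ∀ ⦃Y : FinGSet G⦄, (Y →[G] X) → (M.obj Y →+ N.obj Y →+ A))
    (h₁ : ∀ ⦃Y Y' : FinGSet G⦄ (θ' : Y' →[G] X) (f : Y →[G] Y') (m : M.obj Y) (n' : N.obj Y'),
      φ θ' (M.ind f m) n' = φ (θ'.comp f) m (N.res f n'))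
    (h₂ : ∀ ⦃Y Y' : FinGSet G⦄ (θ' : Y' →[G] X) (f : Y →[G] Y') (m' : M.obj Y') (n : N.obj Y),
      φ θ' m' (N.ind f n) = φ (θ'.comp f) (M.res f m') n)
    (h₃ : ∀ ⦃Y : FinGSet G⦄ (θ : Y →[G] X) (r : R.obj Y) (m : M.obj Y) (n : N.obj Y),
      φ θ (r • m) n = φ θ m (r • n)) :
    TensorObj M N X →+ A :=
  QuotientAddGroup.lift (AddSubgroup.closure {t | TensorRel M N X t})
    (DirectSum.toAddMonoid fun i : X.Over =>
      TensorProduct.liftAddHom (R := ℤ) (φ i.hom) (fun r m n => by simp))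
    (by
      rw [AddSubgroup.closure_le]
      rintro t (⟨θ', f, m, n'⟩ | ⟨θ', f, m', n⟩ | ⟨θ, r, m, n⟩)
      · simp [tensorPreOf, h₁]
      · simp [tensorPreOf, h₂]
      · simp [tensorPreOf, h₃])

@[simp] theorem tensorLift_gen {A : Type*} [AddCommGroup A] {X : FinGSet G}
    (φ : ∀ ⦃Y : FinGSet G⦄, (Y →[G] X) → (M.obj Y →+ N.obj Y →+ A)) (h₁ h₂ h₃)
    {Y : FinGSet G} (θ : Y →[G] X) (m : M.obj Y) (n : N.obj Y) :
    tensorLift φ h₁ h₂ h₃ (gen θ m n) = φ θ m n := by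
  exact DirectSum.toAddMonoid_of (β := fun i : X.Over => M.obj i.left ⊗[ℤ] N.obj i.left)
    (fun i => TensorProduct.liftAddHom (R := ℤ) (φ i.hom) (fun r m n => by simp)) ⟨Y, θ⟩
    (m ⊗ₜ n)

theorem ind_res_of_bijective (M : MackeyModule R) {X Y : FinGSet G} (e : X →[G] Y)
    (he : Function.Bijective e) (m : M.obj Y) : M.ind e (M.res e m) = m := by
  have h : IsPullbackSq e e (MulActionHom.id G) (MulActionHom.id G) :=
    ⟨fun _ => rfl, fun x y hxy => by
      obtain ⟨z, hz⟩ := he.2 x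
      exact ⟨z, ⟨hz, hz.trans hxy⟩, fun w hw => he.1 (hw.1.trans hz.symm)⟩⟩
  rw [← M.base_change h, M.ind_id, M.res_id]

/-- Classes of generators only depend on `Y → X` up to isomorphism. -/
theorem gen_iso {X Y Y' : FinGSet G} (θ' : Y' →[G] X) (e : Y →[G] Y')
    (he : Function.Bijective e) (m : M.obj Y') (n : N.obj Y') :
    gen (θ'.comp e) (M.res e m) (N.res e n) = gen θ' m n := by
  rw [← gen_ind_left, ind_res_of_bijective M e he]

/-- The restriction maps of `M ⊗_R N`: `[θ, m ⊗ n]` goes to `[q, M^*(p)(m) ⊗ N^*(p)(n)]`, where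
`p` and `q` are the projections of the pullback of `θ` along `f`. -/
def tensorRes {X X' : FinGSet G} (f : X' →[G] X) : TensorObj M N X →+ TensorObj M N X' :=
  tensorLift
    (fun _ θ => ((genHom (pbSnd θ f)).comp (M.res (pbFst θ f))).compl₂ (N.res (pbFst θ f)))
    (fun Y Y' θ' g m n' => by
      let k : pullback (θ'.comp g) f →[G] pullback θ' f :=
        { toFun := fun z => ⟨(g z.1.1, z.1.2), z.2⟩
          map_smul' := fun a z => Subtype.ext (Prod.ext (map_smul g a z.1.1) rfl) }
      have hk : IsPullbackSq (pbFst (θ'.comp g) f) k g (pbFst θ' f) :=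
        ⟨fun _ => rfl, fun y z h => ⟨⟨(y, z.1.2), (congrArg θ' h).trans z.2⟩,
          ⟨rfl, Subtype.ext (Prod.ext h rfl)⟩, fun w hw => Subtype.ext
            (Prod.ext hw.1 (congrArg (fun v => v.1.2) hw.2))⟩⟩
      change gen _ (M.res (pbFst θ' f) (M.ind g m)) (N.res (pbFst θ' f) n') =
        gen _ (M.res _ m) (N.res _ (N.res g n'))
      rw [M.base_change hk, gen_ind_left, ← N.res_comp, ← N.res_comp, hk.comm]
      rfl)
    (fun Y Y' θ' g m' n => by
      let k : pullback (θ'.comp g) f →[G] pullback θ' f :=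
        { toFun := fun z => ⟨(g z.1.1, z.1.2), z.2⟩
          map_smul' := fun a z => Subtype.ext (Prod.ext (map_smul g a z.1.1) rfl) }
      have hk : IsPullbackSq (pbFst (θ'.comp g) f) k g (pbFst θ' f) :=
        ⟨fun _ => rfl, fun y z h => ⟨⟨(y, z.1.2), (congrArg θ' h).trans z.2⟩,
          ⟨rfl, Subtype.ext (Prod.ext h rfl)⟩, fun w hw => Subtype.ext
            (Prod.ext hw.1 (congrArg (fun v => v.1.2) hw.2))⟩⟩
      change gen _ (M.res (pbFst θ' f) m') (N.res (pbFst θ' f) (N.ind g n)) =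
        gen _ (M.res _ (M.res g m')) (N.res _ n)
      rw [N.base_change hk, gen_ind_right, ← M.res_comp, ← M.res_comp, hk.comm]
      rfl)
    (fun Y θ r m n => by
      change gen _ (M.res _ (r • m)) (N.res _ n) = gen _ (M.res _ m) (N.res _ (r • n))
      rw [M.res_smul, N.res_smul, gen_smul])

/-- The restriction of a generator may be computed by any pullback square. -/
theorem tensorRes_gen {P X X' Y : FinGSet G} {p : P →[G] Y} {q : P →[G] X'} {θ : Y →[G] X}
    {f : X' →[G] X} (h : IsPullbackSq p q θ f) (m : M.obj Y) (n : N.obj Y) :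
    tensorRes f (gen θ m n) = gen q (M.res p m) (N.res p n) := by
  let e : P →[G] pullback θ f :=
    { toFun := fun z => ⟨(p z, q z), h.1 z⟩
      map_smul' := fun a z => Subtype.ext (Prod.ext (map_smul p a z) (map_smul q a z)) }
  have he : Function.Bijective e := by
    refine ⟨fun z w hzw => ?_, fun z => ?_⟩
    · have h1 : p z = p w := congrArg (fun v => v.1.1) hzw
      have h2 : q z = q w := congrArg (fun v => v.1.2) hzw
      exact (h.2 (p w) (q w) (h.1 w)).unique ⟨h1, h2⟩ ⟨rfl, rfl⟩
    · obtain ⟨w, hw, -⟩ := h.2 z.1.1 z.1.2 z.2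
      exact ⟨w, Subtype.ext (Prod.ext hw.1 hw.2)⟩
  have := gen_iso (pbSnd θ f) e he (M.res (pbFst θ f) m) (N.res (pbFst θ f) n)
  rw [← M.res_comp, ← N.res_comp] at this
  refine Eq.trans ?_ this.symm
  rw [tensorRes, tensorLift_gen]
  rfl

/-- The induction maps of `M ⊗_R N`: `[θ, m ⊗ n]` goes to `[f ∘ θ, m ⊗ n]`. -/
def tensorInd {X X' : FinGSet G} (f : X →[G] X') : TensorObj M N X →+ TensorObj M N X' :=
  tensorLift (fun _ θ => genHom (f.comp θ))
    (fun _ _ θ' g m n' => gen_ind_left (f.comp θ') g m n')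
    (fun _ _ θ' g m' n => gen_ind_right (f.comp θ') g m' n)
    (fun _ θ r m n => gen_smul (f.comp θ) r m n)

theorem tensorInd_gen {X X' Y : FinGSet G} (f : X →[G] X') (θ : Y →[G] X) (m : M.obj Y)
    (n : N.obj Y) : tensorInd f (gen θ m n) = gen (f.comp θ) m n :=
  tensorLift_gen _ _ _ _ θ m n

/-- The action of `r ∈ R(X)` on `(M ⊗_R N)(X)`: `r • [θ, m ⊗ n] = [θ, R^*(θ)(r) m ⊗ n]`. -/
def tensorSMul {X : FinGSet G} (r : R.obj X) : TensorObj M N X →+ TensorObj M N X :=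
  tensorLift (fun _ θ => (genHom θ).comp (DistribSMul.toAddMonoidHom _ (R.res θ r)))
    (fun _ _ θ' g m n' => by
      change gen _ (R.res θ' r • M.ind g m) n' = gen _ (R.res (θ'.comp g) r • m) (N.res g n')
      rw [← M.ind_res_smul, gen_ind_left, R.res_comp])
    (fun _ _ θ' g m' n => by
      change gen _ (R.res θ' r • m') (N.ind g n) = gen _ (R.res (θ'.comp g) r • M.res g m') n
      rw [gen_ind_right, M.res_smul, R.res_comp])
    (fun _ θ s m n => by
      change gen _ (R.res θ r • s • m) n = gen _ (R.res θ r • m) (s • n)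
      rw [← gen_smul, smul_comm])

theorem tensorSMul_gen {X Y : FinGSet G} (r : R.obj X) (θ : Y →[G] X) (m : M.obj Y)
    (n : N.obj Y) : tensorSMul r (gen θ m n) = gen θ (R.res θ r • m) n :=
  tensorLift_gen _ _ _ _ θ m n

instance (X : FinGSet G) : Module (R.obj X) (TensorObj M N X) where
  smul r t := tensorSMul r t
  one_smul t := by
    change tensorSMul 1 t = t
    induction t using tensorObj_induction with
    | zero => rw [map_zero]
    | add a b ha hb => rw [map_add, ha, hb]
    | gen Y θ m n => rw [tensorSMul_gen, map_one, one_smul]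
  mul_smul r s t := by
    change tensorSMul (r * s) t = tensorSMul r (tensorSMul s t)
    induction t using tensorObj_induction with
    | zero => simp only [map_zero]
    | add a b ha hb => simp only [map_add, ha, hb]
    | gen Y θ m n => simp only [tensorSMul_gen, map_mul, mul_smul]
  smul_zero r := map_zero (tensorSMul r)
  smul_add r := map_add (tensorSMul r)
  add_smul r s t := by
    change tensorSMul (r + s) t = tensorSMul r t + tensorSMul s t
    induction t using tensorObj_induction with
    | zero => simp only [map_zero, add_zero]
    | add a b ha hb => simp only [map_add, ha, hb]; abel
    | gen Y θ m n => simp only [tensorSMul_gen, map_add, add_smul, gen_add_left]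
  zero_smul t := by
    change tensorSMul 0 t = 0
    induction t using tensorObj_induction with
    | zero => simp only [map_zero]
    | add a b ha hb => simp only [map_add, ha, hb, add_zero]
    | gen Y θ m n => simp only [tensorSMul_gen, map_zero, zero_smul, gen_zero_left]

theorem smul_gen {X Y : FinGSet G} (r : R.obj X) (θ : Y →[G] X) (m : M.obj Y)
    (n : N.obj Y) : r • gen θ m n = gen θ (R.res θ r • m) n :=
  tensorSMul_gen r θ m n

theorem tensorObj_isMackey : IsMackey (TensorObj M N) (fun _ _ f => tensorRes f)
    (fun _ _ f => tensorInd f) := by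
  refine isMackey_of_sum_eq ?_ ?_ ?_ ?_ ?_ ?_ ?_
  · intro X t
    induction t using tensorObj_induction with
    | zero => rw [map_zero]
    | add a b ha hb => rw [map_add, ha, hb]
    | gen Y θ m n =>
      have h : IsPullbackSq (MulActionHom.id G) θ θ (MulActionHom.id G) :=
        ⟨fun _ => rfl, fun x y h => ⟨x, ⟨rfl, h⟩, fun _ hw => hw.1⟩⟩
      rw [tensorRes_gen h, M.res_id, N.res_id]
  · intro X Y Z g f t
    induction t using tensorObj_induction with
    | zero => simp only [map_zero]
    | add a b ha hb => simp only [map_add, ha, hb]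
    | gen W θ m n =>
      have h1 := pullback_isPullbackSq θ g
      have h2 := pullback_isPullbackSq (pbSnd θ g) f
      rw [tensorRes_gen h1, tensorRes_gen h2, tensorRes_gen (h1.paste h2), M.res_comp, N.res_comp]
  · intro X t
    induction t using tensorObj_induction with
    | zero => rw [map_zero]
    | add a b ha hb => rw [map_add, ha, hb]
    | gen Y θ m n => rw [tensorInd_gen]; rfl
  · intro X Y Z g f t
    induction t using tensorObj_induction with
    | zero => simp only [map_zero]
    | add a b ha hb => simp only [map_add, ha, hb]
    | gen W θ m n => simp only [tensorInd_gen]; rfl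
  · intro P X Y Z p q f g h t
    induction t using tensorObj_induction with
    | zero => simp only [map_zero]
    | add a b ha hb => simp only [map_add, ha, hb]
    | gen W θ m n =>
      have h1 := pullback_isPullbackSq θ p
      rw [tensorInd_gen, tensorRes_gen h1, tensorInd_gen, tensorRes_gen (h.symm.paste h1.symm).symm]
  · intro X hX
    refine ⟨fun a b => ?_⟩
    have key : ∀ t : TensorObj M N X, t = 0 := fun t => by
      induction t using tensorObj_induction with
      | zero => rfl
      | add a b ha hb => rw [ha, hb, add_zero]
      | gen Y θ m n =>
        have : IsEmpty Y := ⟨fun y => hX.elim (θ y)⟩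
        have := M.isMackey.subsingleton Y
        rw [Subsingleton.elim m 0, gen_zero_left]
    rw [key a, key b]
  · intro X Y t
    induction t using tensorObj_induction with
    | zero => simp only [map_zero, add_zero]
    | add a b ha hb =>
      simp only [map_add]
      rw [add_add_add_comm, ha, hb]
    | gen Z θ m n =>
      let A := pullback θ (inl X Y)
      let B := pullback θ (inr X Y)
      let i : A →[G] Z := pbFst θ (inl X Y)
      let j : B →[G] Z := pbFst θ (inr X Y)
      let e : A.sum B →[G] Z :=
        { toFun := Sum.elim i j
          map_smul' := fun a z => by
            rcases z with z | z
            · exact map_smul i a z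
            · exact map_smul j a z }
      have he : Function.Bijective e := by
        constructor
        · rintro (⟨⟨z, x⟩, hx⟩ | ⟨⟨z, y⟩, hy⟩) (⟨⟨z', x'⟩, hx'⟩ | ⟨⟨z', y'⟩, hy'⟩) h <;>
            obtain rfl : z = z' := h
          · obtain rfl : x = x' := Sum.inl_injective (hx.symm.trans hx')
            rfl
          · exact (Sum.inl_ne_inr (hx.symm.trans hy')).elim
          · exact (Sum.inr_ne_inl (hy.symm.trans hx')).elim
          · obtain rfl : y = y' := Sum.inr_injective (hy.symm.trans hy')
            rfl
        · intro z
          rcases hz : θ z with x | y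
          · exact ⟨Sum.inl ⟨(z, x), hz⟩, rfl⟩
          · exact ⟨Sum.inr ⟨(z, y), hz⟩, rfl⟩
      have hi : e.comp (inl A B) = i := rfl
      have hj : e.comp (inr A B) = j := rfl
      have hm := M.isMackey.sum_eq A B (M.res e m)
      rw [tensorRes_gen (pullback_isPullbackSq θ (inl X Y)),
        tensorRes_gen (pullback_isPullbackSq θ (inr X Y)), tensorInd_gen, tensorInd_gen,
        ← (pullback_isPullbackSq θ (inl X Y)).comm, ← (pullback_isPullbackSq θ (inr X Y)).comm,
        ← gen_ind_left, ← gen_ind_left, ← gen_add_left]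
      congr 1
      conv_rhs => rw [← ind_res_of_bijective M e he m, ← hm, map_add, ← M.res_comp, ← M.res_comp,
        ← M.ind_comp, ← M.ind_comp, hi, hj]

variable (M N)

/-- The tensor product `M ⊗_R N` of Mackey `R`-modules. -/
def tensor : MackeyModule R where
  obj := TensorObj M N
  res _ _ f := tensorRes f
  ind _ _ f := tensorInd f
  isMackey := tensorObj_isMackey
  res_smul X Y f r t := by
    induction t using tensorObj_induction with
    | zero => simp only [map_zero, smul_zero]
    | add a b ha hb => simp only [map_add, smul_add, ha, hb]
    | gen Z θ m n =>
      have h := pullback_isPullbackSq θ f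
      rw [smul_gen, tensorRes_gen h, tensorRes_gen h, smul_gen, M.res_smul, ← R.res_comp,
        ← R.res_comp, h.comm]
  ind_res_smul X Y f r t := by
    induction t using tensorObj_induction with
    | zero => simp only [map_zero, smul_zero]
    | add a b ha hb => simp only [map_add, smul_add, ha, hb]
    | gen Z θ m n => rw [smul_gen, tensorInd_gen, tensorInd_gen, smul_gen, ← R.res_comp]
  ind_smul_res X Y f r t := by
    induction t using tensorObj_induction with
    | zero => simp only [map_zero, smul_zero]
    | add a b ha hb => simp only [map_add, smul_add, ha, hb]
    | gen Z θ m n =>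
      have h := pullback_isPullbackSq θ f
      rw [tensorRes_gen h, smul_gen, smul_gen, tensorInd_gen, ← h.comm, ← gen_ind_left,
        M.ind_smul_res, R.base_change h.symm]

end Tensor

end MackeyModule

namespace MackeyModule

section Monoidal

variable {G : Type u} [Group G] {R : CommGreenFunctor G} {M N P Q : MackeyModule R}

/-- The class of `m ⊗ n` at `θ = id_X`. -/
def pure {X : FinGSet G} (m : M.obj X) (n : N.obj X) : (tensor M N).obj X :=
  gen (MulActionHom.id G) m n

theorem tensor_induction {X : FinGSet G} {p : (tensor M N).obj X → Prop}
    (t : (tensor M N).obj X) (zero : p 0) (add : ∀ a b, p a → p b → p (a + b))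
    (ind : ∀ (Y : FinGSet G) (θ : Y →[G] X) (m : M.obj Y) (n : N.obj Y),
      p ((tensor M N).ind θ (pure m n))) : p t :=
  tensorObj_induction t zero add fun Y θ m n => by
    have := ind Y θ m n
    erw [tensorInd_gen] at this
    exact this

theorem pure_add_left {X : FinGSet G} (m m' : M.obj X) (n : N.obj X) :
    pure (m + m') n = pure m n + pure m' n := gen_add_left _ m m' n

theorem pure_add_right {X : FinGSet G} (m : M.obj X) (n n' : N.obj X) :
    pure m (n + n') = pure m n + pure m n' := gen_add_right _ m n n'

theorem pure_zero_left {X : FinGSet G} (n : N.obj X) : pure (0 : M.obj X) n = 0 :=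
  gen_zero_left _ n

theorem pure_zero_right {X : FinGSet G} (m : M.obj X) : pure m (0 : N.obj X) = 0 :=
  gen_zero_right _ m

theorem smul_pure {X : FinGSet G} (r : R.obj X) (m : M.obj X) (n : N.obj X) :
    r • pure m n = pure (r • m) n := by
  refine (smul_gen r _ m n).trans ?_
  rw [R.res_id]; rfl

theorem pure_smul {X : FinGSet G} (r : R.obj X) (m : M.obj X) (n : N.obj X) :
    pure m (r • n) = r • pure m n := by
  rw [smul_pure]; exact (gen_smul _ r m n).symm

theorem res_pure {X Y : FinGSet G} (f : X →[G] Y) (m : M.obj Y) (n : N.obj Y) :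
    (tensor M N).res f (pure m n) = pure (M.res f m) (N.res f n) :=
  tensorRes_gen (θ := MulActionHom.id G) (p := f) (q := MulActionHom.id G)
    ⟨fun _ => rfl, fun _ y h => ⟨y, ⟨Eq.symm h, rfl⟩, fun _ hw => hw.2⟩⟩ m n

theorem pure_ind_left {X Y : FinGSet G} (f : X →[G] Y) (m : M.obj X) (n : N.obj Y) :
    pure (M.ind f m) n = (tensor M N).ind f (pure m (N.res f n)) :=
  (gen_ind_left _ f m n).trans (tensorInd_gen f (MulActionHom.id G) m (N.res f n)).symm

theorem pure_ind_right {X Y : FinGSet G} (f : X →[G] Y) (m : M.obj Y) (n : N.obj X) :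
    pure m (N.ind f n) = (tensor M N).ind f (pure (M.res f m) n) :=
  (gen_ind_right _ f m n).trans (tensorInd_gen f (MulActionHom.id G) (M.res f m) n).symm

theorem tensor_hom_ext {f g : tensor M N ⟶ P}
    (h : ∀ X (m : M.obj X) (n : N.obj X), f.app X (pure m n) = g.app X (pure m n)) : f = g := by
  ext X t
  induction t using tensor_induction with
  | zero => rw [map_zero, map_zero]
  | add a b ha hb => rw [map_add, map_add, ha, hb]
  | ind Y θ m n => rw [f.app_ind, g.app_ind, h]

theorem tensor_hom_ext₃ {f g : tensor (tensor M N) P ⟶ Q}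
    (h : ∀ X (m : M.obj X) (n : N.obj X) (p : P.obj X),
      f.app X (pure (pure m n) p) = g.app X (pure (pure m n) p)) : f = g := by
  refine tensor_hom_ext fun X t p => ?_
  induction t using tensor_induction with
  | zero => rw [pure_zero_left, map_zero, map_zero]
  | add a b ha hb => rw [pure_add_left, map_add, map_add, ha, hb]
  | ind Y θ m n => rw [pure_ind_left, f.app_ind, g.app_ind, h]

theorem tensor_hom_ext₄ {K : MackeyModule R} {f g : tensor (tensor (tensor M N) P) Q ⟶ K}
    (h : ∀ X (m : M.obj X) (n : N.obj X) (p : P.obj X) (q : Q.obj X),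
      f.app X (pure (pure (pure m n) p) q) = g.app X (pure (pure (pure m n) p) q)) : f = g := by
  refine tensor_hom_ext₃ fun X t p q => ?_
  induction t using tensor_induction with
  | zero => simp only [pure_zero_left, map_zero]
  | add a b ha hb => simp only [pure_add_left, map_add, ha, hb]
  | ind Y θ m n => rw [pure_ind_left, pure_ind_left, f.app_ind, g.app_ind, h]

theorem tensor_hom_ext₃' {f g : tensor M (tensor N P) ⟶ Q}
    (h : ∀ X (m : M.obj X) (n : N.obj X) (p : P.obj X),
      f.app X (pure m (pure n p)) = g.app X (pure m (pure n p))) : f = g := by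
  refine tensor_hom_ext fun X m t => ?_
  induction t using tensor_induction with
  | zero => rw [pure_zero_right, map_zero, map_zero]
  | add a b ha hb => rw [pure_add_right, map_add, map_add, ha, hb]
  | ind Y θ m n => rw [pure_ind_right, f.app_ind, g.app_ind, h]

variable (M N P) in
/-- A pairing `M × N → P` of Mackey `R`-modules. -/
structure Pairing where
  app : ∀ X : FinGSet G, M.obj X →+ N.obj X →+ P.obj X
  smul_left : ∀ {X : FinGSet G} (r : R.obj X) (m : M.obj X) (n : N.obj X),
    app X (r • m) n = r • app X m n
  smul_right : ∀ {X : FinGSet G} (r : R.obj X) (m : M.obj X) (n : N.obj X),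
    app X m (r • n) = r • app X m n
  res : ∀ {X Y : FinGSet G} (f : X →[G] Y) (m : M.obj Y) (n : N.obj Y),
    P.res f (app Y m n) = app X (M.res f m) (N.res f n)
  ind_left : ∀ {X Y : FinGSet G} (f : X →[G] Y) (m : M.obj X) (n : N.obj Y),
    app Y (M.ind f m) n = P.ind f (app X m (N.res f n))
  ind_right : ∀ {X Y : FinGSet G} (f : X →[G] Y) (m : M.obj Y) (n : N.obj X),
    app Y m (N.ind f n) = P.ind f (app X (M.res f m) n)

/-- The component at `X` of the morphism induced by a pairing. -/
def Pairing.descApp (φ : Pairing M N P) (X : FinGSet G) : (tensor M N).obj X →+ P.obj X :=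
  tensorLift
    (fun Y θ => AddMonoidHom.mk' (fun m => (P.ind θ).comp (φ.app Y m))
      (fun m m' => by ext; simp))
    (fun Y Y' θ' f m n' => by
      change P.ind θ' (φ.app Y' (M.ind f m) n') = P.ind (θ'.comp f) (φ.app Y m (N.res f n'))
      rw [φ.ind_left, P.ind_comp])
    (fun Y Y' θ' f m n' => by
      change P.ind θ' (φ.app Y' m (N.ind f n')) = P.ind (θ'.comp f) (φ.app Y (M.res f m) n')
      rw [φ.ind_right, P.ind_comp])
    (fun Y θ r m n => by
      change P.ind θ (φ.app Y (r • m) n) = P.ind θ (φ.app Y m (r • n))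
      rw [φ.smul_left, φ.smul_right])

theorem ind_pure {X Y : FinGSet G} (θ : Y →[G] X) (m : M.obj Y) (n : N.obj Y) :
    (tensor M N).ind θ (pure m n) = gen θ m n := tensorInd_gen θ (MulActionHom.id G) m n

theorem Pairing.descApp_ind (φ : Pairing M N P) {X Y : FinGSet G} (θ : Y →[G] X) (m : M.obj Y)
    (n : N.obj Y) : φ.descApp X ((tensor M N).ind θ (pure m n)) = P.ind θ (φ.app Y m n) := by
  rw [ind_pure]
  exact tensorLift_gen _ _ _ _ θ m n

/-- The morphism `M ⊗_R N ⟶ P` induced by a pairing. -/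
def Pairing.desc (φ : Pairing M N P) : tensor M N ⟶ P where
  app X :=
    { φ.descApp X with
      map_smul' := fun r t => by
        change φ.descApp X (r • t) = r • φ.descApp X t
        induction t using tensor_induction with
        | zero => simp
        | add a b ha hb => simp only [smul_add, map_add, ha, hb]
        | ind Y θ m n =>
          rw [← ind_res_smul, smul_pure, φ.descApp_ind, φ.descApp_ind, φ.smul_left,
            P.ind_res_smul] }
  app_res X Y f t := by
    change φ.descApp X ((tensor M N).res f t) = P.res f (φ.descApp Y t)
    induction t using tensor_induction with
    | zero => simp
    | add a b ha hb => simp only [map_add, ha, hb]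
    | ind Z θ m n =>
      have h := pullback_isPullbackSq θ f
      rw [base_change _ h, res_pure, φ.descApp_ind, φ.descApp_ind, P.base_change h, φ.res]
  app_ind X Y f t := by
    change φ.descApp Y ((tensor M N).ind f t) = P.ind f (φ.descApp X t)
    induction t using tensor_induction with
    | zero => simp
    | add a b ha hb => simp only [map_add, ha, hb]
    | ind Z θ m n => rw [← ind_comp, φ.descApp_ind, φ.descApp_ind, P.ind_comp]

@[simp] theorem Pairing.desc_pure (φ : Pairing M N P) {X : FinGSet G} (m : M.obj X)
    (n : N.obj X) : φ.desc.app X (pure m n) = φ.app X m n := by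
  have h := φ.descApp_ind (MulActionHom.id G) m n
  rw [ind_id, P.ind_id] at h
  exact h

/-- The biadditive map `(m, n) ↦ [id, m ⊗ n]`. -/
def pureHom (M N : MackeyModule R) (X : FinGSet G) :
    M.obj X →+ N.obj X →+ (tensor M N).obj X := genHom (MulActionHom.id G)

@[simp] theorem pureHom_apply {X : FinGSet G} (m : M.obj X) (n : N.obj X) :
    pureHom M N X m n = pure m n := rfl

/-- The tensor product of two morphisms, `m ⊗ n ↦ f(m) ⊗ g(n)`. -/
def tensorMap {M' N' : MackeyModule R} (f : M ⟶ M') (g : N ⟶ N') : tensor M N ⟶ tensor M' N' :=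
  Pairing.desc
    { app := fun X =>
        ((pureHom M' N' X).comp (f.app X).toAddMonoidHom).compl₂ (g.app X).toAddMonoidHom
      smul_left := fun {X} r m n => by
        change pure (f.app X (r • m)) (g.app X n) = r • pure (f.app X m) (g.app X n)
        rw [map_smul, smul_pure]
      smul_right := fun {X} r m n => by
        change pure (f.app X m) (g.app X (r • n)) = r • pure (f.app X m) (g.app X n)
        rw [map_smul, pure_smul]
      res := fun {X Y} h m n => by
        change (tensor M' N').res h (pure (f.app Y m) (g.app Y n)) =
          pure (f.app X (M.res h m)) (g.app X (N.res h n))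
        rw [res_pure, f.app_res, g.app_res]
      ind_left := fun {X Y} h m n => by
        change pure (f.app Y (M.ind h m)) (g.app Y n) =
          (tensor M' N').ind h (pure (f.app X m) (g.app X (N.res h n)))
        rw [f.app_ind, pure_ind_left, g.app_res]
      ind_right := fun {X Y} h m n => by
        change pure (f.app Y m) (g.app Y (N.ind h n)) =
          (tensor M' N').ind h (pure (f.app X (M.res h m)) (g.app X n))
        rw [g.app_ind, pure_ind_right, f.app_res] }

@[simp] theorem tensorMap_pure {M' N' : MackeyModule R} (f : M ⟶ M') (g : N ⟶ N')
    {X : FinGSet G} (m : M.obj X) (n : N.obj X) :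
    (tensorMap f g).app X (pure m n) = pure (f.app X m) (g.app X n) :=
  Pairing.desc_pure _ m n

/-- The symmetry, `m ⊗ n ↦ n ⊗ m`. -/
def swap (M N : MackeyModule R) : tensor M N ⟶ tensor N M :=
  Pairing.desc
    { app := fun X => (pureHom N M X).flip
      smul_left := fun r m n => pure_smul r n m
      smul_right := fun r m n => (smul_pure r n m).symm
      res := fun h m n => res_pure h n m
      ind_left := fun h m n => pure_ind_right h n m
      ind_right := fun h m n => pure_ind_left h n m }

@[simp] theorem swap_pure {X : FinGSet G} (m : M.obj X) (n : N.obj X) :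
    (swap M N).app X (pure m n) = pure n m :=
  Pairing.desc_pure _ m n

/-- The symmetry isomorphism. -/
def braid (M N : MackeyModule R) : tensor M N ≅ tensor N M where
  hom := swap M N
  inv := swap N M
  hom_inv_id := tensor_hom_ext fun X m n => by simp
  inv_hom_id := tensor_hom_ext fun X m n => by simp

/-- The left unit isomorphism, `r ⊗ m ↦ r • m`. -/
def lunit (M : MackeyModule R) : tensor R.self M ≅ M where
  hom := Pairing.desc
    { app := fun X => (smulAddHom (R.obj X) (M.obj X) :)
      smul_left := fun r s m => mul_smul r s m
      smul_right := fun r s m => smul_comm s r m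
      res := fun f r m => M.res_smul f r m
      ind_left := fun f r m => (M.ind_smul_res f r m).symm
      ind_right := fun f r m => (M.ind_res_smul f r m).symm }
  inv :=
    { app := fun X =>
        { toFun := fun m => pure (1 : R.obj X) m
          map_add' := fun m m' => pure_add_right _ m m'
          map_smul' := fun r m => pure_smul r _ m }
      app_res := fun X Y f m => by
        change pure (1 : R.obj X) _ = (tensor R.self M).res f (pure (1 : R.obj Y) m)
        rw [res_pure]
        exact congrArg (fun s : R.obj X => pure (M := R.self) s (M.res f m)) (map_one (R.res f)).symm
      app_ind := fun X Y f m => by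
        change pure (1 : R.obj Y) _ = (tensor R.self M).ind f (pure (1 : R.obj X) m)
        rw [pure_ind_right]
        exact congrArg (fun s : R.obj X => (tensor R.self M).ind f (pure (M := R.self) s m))
          (map_one (R.res f)) }
  hom_inv_id := tensor_hom_ext fun X r m => by
    rw [comp_app, Pairing.desc_pure]
    change pure (M := R.self) (1 : R.obj X) ((r : R.obj X) • m) = _
    rw [pure_smul, smul_pure]
    exact congrArg (fun s : R.obj X => pure (M := R.self) s m) (mul_one (r : R.obj X))
  inv_hom_id := by
    ext X m
    rw [comp_app]
    erw [Pairing.desc_pure]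
    exact one_smul (R.obj X) m

@[simp] theorem lunit_pure {X : FinGSet G} (r : R.obj X) (m : M.obj X) :
    (lunit M).hom.app X (pure (M := R.self) r m) = r • m :=
  Pairing.desc_pure _ (M := R.self) r m

/-- The right unit isomorphism, `m ⊗ r ↦ r • m`. -/
def runit (M : MackeyModule R) : tensor M R.self ≅ M := braid M R.self ≪≫ lunit M

@[simp] theorem runit_pure {X : FinGSet G} (r : R.obj X) (m : M.obj X) :
    (runit M).hom.app X (pure (N := R.self) m r) = r • m := by
  change (lunit M).hom.app X ((swap M R.self).app X (pure (N := R.self) m r)) = _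
  rw [swap_pure, lunit_pure]

variable (M N P) in
/-- The component at `X` of the pairing defining the associator,
`([θ, m ⊗ n], p) ↦ [θ, m ⊗ (n ⊗ P^*(θ)(p))]`. -/
def assocApp (X : FinGSet G) :
    (tensor M N).obj X →+ P.obj X →+ (tensor M (tensor N P)).obj X :=
  tensorLift
    (fun Y θ => AddMonoidHom.mk' (fun m => AddMonoidHom.mk' (fun n => AddMonoidHom.mk'
        (fun p => (tensor M (tensor N P)).ind θ (pure m (pure n (P.res θ p))))
        (fun p p' => by simp only [map_add, pure_add_right]))
        (fun n n' => by ext p; simp [pure_add_left, pure_add_right]))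
        (fun m m' => by ext n p; simp [pure_add_left]))
    (fun Y Y' θ' f m n' => by
      ext p
      change (tensor M (tensor N P)).ind θ' (pure (M.ind f m) (pure n' (P.res θ' p))) =
        (tensor M (tensor N P)).ind (θ'.comp f)
          (pure m (pure (N.res f n') (P.res (θ'.comp f) p)))
      rw [pure_ind_left, res_pure, ind_comp, P.res_comp])
    (fun Y Y' θ' f m' n => by
      ext p
      change (tensor M (tensor N P)).ind θ' (pure m' (pure (N.ind f n) (P.res θ' p))) =
        (tensor M (tensor N P)).ind (θ'.comp f)
          (pure (M.res f m') (pure n (P.res (θ'.comp f) p)))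
      rw [pure_ind_left, pure_ind_right, ind_comp, P.res_comp])
    (fun Y θ r m n => by
      ext p
      change (tensor M (tensor N P)).ind θ (pure (r • m) (pure n (P.res θ p))) =
        (tensor M (tensor N P)).ind θ (pure m (pure (r • n) (P.res θ p)))
      rw [← smul_pure, ← smul_pure, pure_smul])

theorem assocApp_ind {X Y : FinGSet G} (θ : Y →[G] X) (m : M.obj Y) (n : N.obj Y)
    (p : P.obj X) : assocApp M N P X ((tensor M N).ind θ (pure m n)) p =
      (tensor M (tensor N P)).ind θ (pure m (pure n (P.res θ p))) := by
  rw [ind_pure]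
  exact DFunLike.congr_fun (tensorLift_gen _ _ _ _ θ m n) p

variable (M N P) in
/-- The associator, `(m ⊗ n) ⊗ p ↦ m ⊗ (n ⊗ p)`. -/
def assocHom : tensor (tensor M N) P ⟶ tensor M (tensor N P) :=
  Pairing.desc
    { app := assocApp M N P
      smul_left := fun {X} r t p => by
        induction t using tensor_induction with
        | zero => simp
        | add a b ha hb => simp only [smul_add, map_add, AddMonoidHom.add_apply, ha, hb]
        | ind Y θ m n =>
          rw [← ind_res_smul, smul_pure, assocApp_ind, assocApp_ind, ← smul_pure, ind_res_smul]
      smul_right := fun {X} r t p => by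
        induction t using tensor_induction with
        | zero => simp
        | add a b ha hb => simp only [smul_add, map_add, AddMonoidHom.add_apply, ha, hb]
        | ind Y θ m n =>
          rw [assocApp_ind, assocApp_ind, P.res_smul, pure_smul, pure_smul, ind_res_smul]
      res := fun {X Y} f t p => by
        induction t using tensor_induction with
        | zero => simp
        | add a b ha hb => simp only [map_add, AddMonoidHom.add_apply, ha, hb]
        | ind Z θ m n =>
          have h := pullback_isPullbackSq θ f
          rw [base_change _ h, res_pure, assocApp_ind, assocApp_ind, base_change _ h, res_pure,
            res_pure, ← P.res_comp, ← P.res_comp, h.comm]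
      ind_left := fun {X Y} f t p => by
        induction t using tensor_induction with
        | zero => simp
        | add a b ha hb => simp only [map_add, AddMonoidHom.add_apply, ha, hb]
        | ind Z θ m n => rw [← ind_comp, assocApp_ind, assocApp_ind, ind_comp, P.res_comp]
      ind_right := fun {X Y} f t p => by
        induction t using tensor_induction with
        | zero => simp
        | add a b ha hb => simp only [map_add, AddMonoidHom.add_apply, ha, hb]
        | ind Z θ m n =>
          have h := pullback_isPullbackSq θ f
          rw [base_change _ h, res_pure, assocApp_ind, assocApp_ind, P.base_change h.symm,
            pure_ind_right, pure_ind_right, ← ind_comp, ← ind_comp, h.comm] }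

@[simp] theorem assocHom_pure {X : FinGSet G} (m : M.obj X) (n : N.obj X) (p : P.obj X) :
    (assocHom M N P).app X (pure (pure m n) p) = pure m (pure n p) := by
  refine (Pairing.desc_pure _ _ p).trans ?_
  have h := assocApp_ind (MulActionHom.id G) m n p
  rw [ind_id, ind_id, P.res_id] at h
  exact h

variable (M N P) in
/-- The inverse of the associator, `m ⊗ (n ⊗ p) ↦ (m ⊗ n) ⊗ p`. -/
def assocInv : tensor M (tensor N P) ⟶ tensor (tensor M N) P :=
  swap _ _ ≫ tensorMap (swap _ _) (𝟙 _) ≫ assocHom P N M ≫ swap _ _ ≫ tensorMap (swap _ _) (𝟙 _)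

@[simp] theorem assocInv_pure {X : FinGSet G} (m : M.obj X) (n : N.obj X) (p : P.obj X) :
    (assocInv M N P).app X (pure m (pure n p)) = pure (pure m n) p := by
  simp [assocInv]

variable (M N P) in
/-- The associativity isomorphism. -/
def assoc : tensor (tensor M N) P ≅ tensor M (tensor N P) where
  hom := assocHom M N P
  inv := assocInv M N P
  hom_inv_id := tensor_hom_ext₃ fun X m n p => by simp
  inv_hom_id := tensor_hom_ext₃' fun X m n p => by simp

variable (M N P Q) in
theorem pentagon_aux : tensorMap (assocHom M N P) (𝟙 Q) ≫ assocHom M (tensor N P) Q ≫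
    tensorMap (𝟙 M) (assocHom N P Q) = assocHom (tensor M N) P Q ≫ assocHom M N (tensor P Q) :=
  tensor_hom_ext₄ fun X m n p q => by
    simp only [comp_app, tensorMap_pure, assocHom_pure, id_app]

variable (M N) in
theorem triangle_aux : assocHom M R.self N ≫ tensorMap (𝟙 M) (lunit N).hom =
    tensorMap (runit M).hom (𝟙 N) :=
  tensor_hom_ext₃ fun X m r n => by
    simp only [comp_app, tensorMap_pure, assocHom_pure, id_app]
    erw [lunit_pure, runit_pure]
    exact (pure_smul _ _ _).trans (smul_pure _ _ _)

theorem swap_nat {M' N' : MackeyModule R} (f : M ⟶ M') (g : N ⟶ N') :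
    tensorMap f g ≫ swap M' N' = swap M N ≫ tensorMap g f :=
  tensor_hom_ext fun X m n => by
    simp only [comp_app, tensorMap_pure, swap_pure]

theorem swap_swap : swap M N ≫ swap N M = 𝟙 (tensor M N) :=
  tensor_hom_ext fun X m n => by
    simp only [comp_app, swap_pure, id_app]

variable (M N P) in
theorem hexagon_aux : assocHom M N P ≫ swap M (tensor N P) ≫ assocHom N P M =
    tensorMap (swap M N) (𝟙 P) ≫ assocHom N M P ≫ tensorMap (𝟙 N) (swap M P) :=
  tensor_hom_ext₃ fun X m n p => by
    simp only [comp_app, tensorMap_pure, assocHom_pure, id_app, swap_pure]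

variable (M N P) in
theorem hexagon_aux' : assocInv M N P ≫ swap (tensor M N) P ≫ assocInv P M N =
    tensorMap (𝟙 M) (swap N P) ≫ assocInv M P N ≫ tensorMap (swap M P) (𝟙 N) :=
  tensor_hom_ext₃' fun X m n p => by
    simp only [comp_app, tensorMap_pure, assocInv_pure, id_app, swap_pure]

/-- The symmetric monoidal structure of the category of Mackey `R`-modules. -/
instance : MonoidalCategory (MackeyModule R) where
  tensorObj M N := tensor M N
  whiskerLeft M _ _ f := tensorMap (𝟙 M) f
  whiskerRight f N := tensorMap f (𝟙 N)
  tensorHom f g := tensorMap f g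
  tensorUnit := R.self
  associator M N P := assoc M N P
  leftUnitor M := lunit M
  rightUnitor M := runit M
  tensorHom_def f g := tensor_hom_ext fun X m n => by simp
  id_tensorHom_id M N := tensor_hom_ext fun X m n => by simp
  tensorHom_comp_tensorHom f g f' g' := tensor_hom_ext fun X m n => by simp
  whiskerLeft_id M N := tensor_hom_ext fun X m n => by simp
  id_whiskerRight M N := tensor_hom_ext fun X m n => by simp
  associator_naturality f g h := tensor_hom_ext₃ fun X m n p => by simp [assoc]
  leftUnitor_naturality f := tensor_hom_ext fun X r m => by
    simp only [comp_app, tensorMap_pure]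
    erw [lunit_pure, lunit_pure]
    exact ((f.app X).map_smul _ _).symm
  rightUnitor_naturality f := tensor_hom_ext fun X m r => by
    simp only [comp_app, tensorMap_pure]
    erw [runit_pure, runit_pure]
    exact ((f.app X).map_smul _ _).symm
  pentagon M N P Q := pentagon_aux M N P Q
  triangle M N := triangle_aux M N

instance : SymmetricCategory (MackeyModule R) where
  braiding M N := braid M N
  braiding_naturality_right M _ _ f := swap_nat (𝟙 M) f
  braiding_naturality_left f N := swap_nat f (𝟙 N)
  hexagon_forward M N P := hexagon_aux M N P
  hexagon_reverse M N P := hexagon_aux' M N P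
  symmetry _ _ := swap_swap

end Monoidal

end MackeyModule

/-! ### Modules over skew group rings -/

section SkewMod

universe v w

/-- A left module over the skew group ring `S ⋊ W`, for a group `W` acting on a commutative ring `S`
by ring automorphisms, presented as an `S`-module with a compatible additive action of `W`
(see `SkewMod.equivalence` for the comparison with modules over the ring `S ⋊ W` itself). -/
structure SkewMod (S : Type v) [CommRing S] (W : Type w) [Group W] [MulSemiringAction W S] where
  carrier : Type v
  [grp : AddCommGroup carrier]
  [mod : Module S carrier]
  [act : DistribMulAction W carrier]
  act_smul : ∀ (w : W) (s : S) (x : carrier), w • s • x = (w • s) • w • x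

namespace SkewMod

variable {S : Type v} [CommRing S] {W : Type w} [Group W] [MulSemiringAction W S]

instance : CoeSort (SkewMod S W) (Type v) := ⟨SkewMod.carrier⟩

attribute [instance] SkewMod.grp SkewMod.mod SkewMod.act

/-- A morphism is an `S`-linear map commuting with the actions of `W`. -/
@[ext]
structure Hom (V V' : SkewMod S W) where
  lin : V →ₗ[S] V'
  map_act : ∀ (w : W) (x : V), lin (w • x) = w • lin x

instance : Category (SkewMod S W) where
  Hom := Hom
  id V := ⟨LinearMap.id, fun _ _ => rfl⟩
  comp f g := ⟨g.lin.comp f.lin, fun w x => by simp [f.map_act, g.map_act]⟩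

@[ext]
theorem hom_ext {V V' : SkewMod S W} {f g : V ⟶ V'} (h : ∀ x, f.lin x = g.lin x) : f = g :=
  Hom.ext (LinearMap.ext h)

@[simp] theorem id_lin (V : SkewMod S W) : Hom.lin (𝟙 V) = LinearMap.id := rfl

@[simp] theorem comp_lin {V V' V'' : SkewMod S W} (f : V ⟶ V') (g : V' ⟶ V'') :
    (f ≫ g).lin = g.lin.comp f.lin := rfl

/-- Build an isomorphism from an equivariant linear equivalence. -/
def isoMk {V V' : SkewMod S W} (e : V ≃ₗ[S] V') (h : ∀ (w : W) (x : V), e (w • x) = w • e x) :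
    V ≅ V' where
  hom := ⟨e, h⟩
  inv := ⟨e.symm, fun w x => by
    change e.symm (w • x) = w • e.symm x
    rw [LinearEquiv.symm_apply_eq, h, LinearEquiv.apply_symm_apply]⟩
  hom_inv_id := by ext x; exact e.symm_apply_apply x
  inv_hom_id := by ext x; exact e.apply_symm_apply x

/-- The forgetful functor to `S`-modules. -/
def forgetMod : SkewMod S W ⥤ ModuleCat.{v} S where
  obj V := ModuleCat.of S V
  map f := ModuleCat.ofHom f.lin

instance : (forgetMod (S := S) (W := W)).Faithful where
  map_injective {V V'} f g h := by
    ext x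
    exact LinearMap.congr_fun (congrArg ModuleCat.Hom.hom h) x

/-- The additive map `x ⊗ y ↦ w • x ⊗ w • y`. -/
def diag (V V' : SkewMod S W) (w : W) : V ⊗[S] V' →+ V ⊗[S] V' :=
  TensorProduct.liftAddHom
    (AddMonoidHom.mk' (fun x => AddMonoidHom.mk' (fun y => (w • x) ⊗ₜ[S] (w • y))
      (fun y y' => by rw [smul_add, TensorProduct.tmul_add]))
      (fun x x' => by ext y; simp [TensorProduct.add_tmul]))
    (fun s x y => by
      change (w • s • x) ⊗ₜ[S] (w • y) = (w • x) ⊗ₜ[S] (w • s • y)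
      rw [V.act_smul, V'.act_smul, TensorProduct.smul_tmul])

@[simp] theorem diag_tmul (V V' : SkewMod S W) (w : W) (x : V) (y : V') :
    diag V V' w (x ⊗ₜ y) = (w • x) ⊗ₜ (w • y) := rfl

/-- The tensor product over `S` with the diagonal action. -/
def tensor (V V' : SkewMod S W) : SkewMod S W where
  carrier := V ⊗[S] V'
  act :=
    { smul := fun w t => diag V V' w t
      one_smul := fun t => by
        change diag V V' 1 t = t
        induction t using TensorProduct.induction_on with
        | zero => rw [map_zero]
        | tmul x y => rw [diag_tmul, one_smul, one_smul]
        | add a b ha hb => rw [map_add, ha, hb]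
      mul_smul := fun w w' t => by
        change diag V V' (w * w') t = diag V V' w (diag V V' w' t)
        induction t using TensorProduct.induction_on with
        | zero => simp only [map_zero]
        | tmul x y => simp only [diag_tmul, mul_smul]
        | add a b ha hb => simp only [map_add, ha, hb]
      smul_zero := fun w => map_zero (diag V V' w)
      smul_add := fun w => map_add (diag V V' w) }
  act_smul w s t := by
    change diag V V' w (s • t) = (w • s) • diag V V' w t
    induction t using TensorProduct.induction_on with
    | zero => simp only [smul_zero, map_zero]
    | tmul x y =>
      rw [TensorProduct.smul_tmul', diag_tmul, diag_tmul, V.act_smul, TensorProduct.smul_tmul']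
    | add a b ha hb => simp only [smul_add, map_add, ha, hb]

theorem act_tmul (V V' : SkewMod S W) (w : W) (x : V) (y : V') :
    (w • (show V.tensor V' from x ⊗ₜ[S] y)) = (show V.tensor V' from (w • x) ⊗ₜ[S] (w • y)) := rfl

/-- Equivariance of a linear map out of a tensor product can be checked on pure tensors. -/
theorem equivariant_of_tmul {V V' U : SkewMod S W} (f : V ⊗[S] V' →ₗ[S] U)
    (h : ∀ (w : W) (x : V) (y : V'), f ((w • x) ⊗ₜ (w • y)) = w • f (x ⊗ₜ y)) (w : W)
    (t : V.tensor V') : f (w • t) = w • f t := by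
  change f (diag V V' w t) = w • f t
  induction t using TensorProduct.induction_on with
  | zero => simp only [map_zero, smul_zero]
  | tmul x y => exact h w x y
  | add a b ha hb =>
    rw [map_add, map_add, ha, hb, ← smul_add]
    exact congrArg (w • ·) (map_add f a b).symm

/-- The unit object: `S` with its given action of `W`. -/
abbrev unit : SkewMod S W where
  carrier := S
  act_smul w s x := smul_mul' w s x

/-- The tensor product of morphisms. -/
def tensorMap {V V' U U' : SkewMod S W} (f : V ⟶ V') (g : U ⟶ U') :
    V.tensor U ⟶ V'.tensor U' where
  lin := TensorProduct.map f.lin g.lin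
  map_act := equivariant_of_tmul (U := V'.tensor U') (TensorProduct.map f.lin g.lin)
    fun w x y => by
      change (f.lin (w • x)) ⊗ₜ[S] (g.lin (w • y)) = (w • f.lin x) ⊗ₜ[S] (w • g.lin y)
      rw [f.map_act, g.map_act]

instance : MonoidalCategoryStruct (SkewMod S W) where
  tensorObj := tensor
  whiskerLeft V _ _ f := tensorMap (𝟙 V) f
  whiskerRight f V := tensorMap f (𝟙 V)
  tensorHom f g := tensorMap f g
  tensorUnit := unit
  associator V V' V'' := isoMk (V := (V.tensor V').tensor V'') (V' := V.tensor (V'.tensor V''))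
    (TensorProduct.assoc S V V' V'')
    (equivariant_of_tmul (V := V.tensor V') (V' := V'') (U := V.tensor (V'.tensor V''))
      (TensorProduct.assoc S V V' V'').toLinearMap fun w t z => by
        change TensorProduct.assoc S V V' V'' ((diag V V' w t) ⊗ₜ (w • z)) =
          diag V (V'.tensor V'') w (TensorProduct.assoc S V V' V'' (t ⊗ₜ z))
        induction t using TensorProduct.induction_on with
        | zero =>
          simp only [map_zero, TensorProduct.zero_tmul]
          exact (map_zero (diag V (V'.tensor V'') w)).symm
        | tmul x y => rfl
        | add a b ha hb =>
          simp only [map_add, TensorProduct.add_tmul, ha, hb]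
          exact (map_add (diag V (V'.tensor V'') w) _ _).symm)
  leftUnitor V := isoMk (V := (unit : SkewMod S W).tensor V) (TensorProduct.lid S V)
    (equivariant_of_tmul (V := unit) (V' := V) (TensorProduct.lid S V).toLinearMap
      fun w (s : S) x => by
        change ((w • s) • w • x : V) = w • s • x
        rw [V.act_smul])
  rightUnitor V := isoMk (V := V.tensor (unit : SkewMod S W)) (TensorProduct.rid S V)
    (equivariant_of_tmul (V := V) (V' := unit) (TensorProduct.rid S V).toLinearMap
      fun w x (s : S) => by
        change ((w • s) • w • x : V) = w • s • x
        rw [V.act_smul])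

/-- The forgetful functor to `S`-modules preserves all the monoidal data. -/
def inducingData : Monoidal.InducingFunctorData (forgetMod (S := S) (W := W)) where
  μIso _ _ := Iso.refl _
  εIso := Iso.refl _
  whiskerLeft_eq _ _ _ _ := by ext1; apply TensorProduct.ext'; intro x y; rfl
  whiskerRight_eq _ _ := by ext1; apply TensorProduct.ext'; intro x y; rfl
  tensorHom_eq _ _ := by ext1; apply TensorProduct.ext'; intro x y; rfl
  associator_eq _ _ _ := by ext1; apply TensorProduct.ext_threefold; intro x y z; rfl
  leftUnitor_eq _ := by ext1; apply TensorProduct.ext'; intro x y; rfl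
  rightUnitor_eq _ := by ext1; apply TensorProduct.ext'; intro x y; rfl

/-- The monoidal structure `(V, φ) ⊗ (V', φ') = (V ⊗_S V', φ ⊗ φ')`. -/
instance : MonoidalCategory (SkewMod S W) := Monoidal.induced forgetMod inducingData

instance : (forgetMod (S := S) (W := W)).Monoidal :=
  Monoidal.fromInducedMonoidal forgetMod inducingData

/-- The symmetry `x ⊗ y ↦ y ⊗ x`. -/
def braid (V V' : SkewMod S W) : V ⊗ V' ≅ V' ⊗ V :=
  isoMk (V := V.tensor V') (V' := V'.tensor V) (TensorProduct.comm S V V')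
    (equivariant_of_tmul (U := V'.tensor V) (TensorProduct.comm S V V').toLinearMap
      fun _ _ _ => rfl)

instance : BraidedCategory (SkewMod S W) :=
  BraidedCategory.ofFaithful forgetMod braid fun V V' => by
    ext1; apply TensorProduct.ext'; intro x y; rfl

instance : SymmetricCategory (SkewMod S W) where
  symmetry V V' := by
    apply hom_ext
    exact fun t => (TensorProduct.comm S V V').symm_apply_apply t

/-- Restriction of scalars along a `W`-equivariant ring homomorphism. -/
def restrictScalars {S' : Type v} [CommRing S'] [MulSemiringAction W S'] (φ : S' →+* S)
    (h : ∀ (w : W) (s : S'), φ (w • s) = w • φ s) : SkewMod S W ⥤ SkewMod S' W where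
  obj V :=
    { carrier := V
      mod := Module.compHom V φ
      act_smul := fun w s x => by
        change w • φ s • x = φ (w • s) • w • x
        rw [h, V.act_smul] }
  map {V V'} f :=
    { lin :=
        letI := Module.compHom V φ
        letI := Module.compHom V' φ
        { toFun := f.lin
          map_add' := map_add f.lin
          map_smul' := fun s x => map_smul f.lin (φ s) x }
      map_act := f.map_act }

/-! Comparison with modules over the skew group ring. -/

/-- The ring homomorphism from the skew group ring to the endomorphisms of `V`. -/
def actionHom (V : SkewMod S W) : SkewMonoidAlgebra S W →+* AddMonoid.End V :=
  SkewMonoidAlgebra.liftNCRingHom (Module.toAddMonoidEnd S V) (DistribMulAction.toAddMonoidEnd W V)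
    (fun {s w} => by ext x; exact (V.act_smul w s x).symm)

theorem actionHom_single (V : SkewMod S W) (w : W) (s : S) (x : V) :
    V.actionHom (SkewMonoidAlgebra.single w s) x = s • w • x := by
  have : V.actionHom (SkewMonoidAlgebra.single w s) =
      Module.toAddMonoidEnd S V s * DistribMulAction.toAddMonoidEnd W V w :=
    SkewMonoidAlgebra.liftNC_single _ _ _ _
  rw [this]; rfl

/-- The functor to modules over the skew group ring, `(s w) • x = s • (w • x)`. -/
def toModuleCat : SkewMod S W ⥤ ModuleCat.{v} (SkewMonoidAlgebra S W) where
  obj V := letI := Module.compHom V V.actionHom; ModuleCat.of (SkewMonoidAlgebra S W) V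
  map {V V'} f :=
    letI := Module.compHom V V.actionHom
    letI := Module.compHom V' V'.actionHom
    ModuleCat.ofHom
      { toFun := f.lin
        map_add' := map_add f.lin
        map_smul' := fun a x => by
          change f.lin (V.actionHom a x) = V'.actionHom a (f.lin x)
          induction a using SkewMonoidAlgebra.induction_on with
          | zero => simp
          | single w s => rw [actionHom_single, actionHom_single, map_smul, f.map_act]
          | add a b ha hb =>
            have h1 : V.actionHom (a + b) x = V.actionHom a x + V.actionHom b x := by
              rw [map_add]; rfl
            have h2 : V'.actionHom (a + b) (f.lin x) =
                V'.actionHom a (f.lin x) + V'.actionHom b (f.lin x) := by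
              rw [map_add]; rfl
            rw [h1, h2, map_add, ha, hb] }

instance : (toModuleCat (S := S) (W := W)).Faithful where
  map_injective {V V'} f g h := by
    ext x
    exact DFunLike.congr_fun (congrArg ModuleCat.Hom.hom h) x

theorem toModuleCat_single (V : SkewMod S W) (w : W) (s : S) (x : V) :
    ((SkewMonoidAlgebra.single w s • (show toModuleCat.obj V from x) : toModuleCat.obj V) : V) =
      s • w • x := actionHom_single V w s x

instance : (toModuleCat (S := S) (W := W)).Full where
  map_surjective {V V'} f := by
    have key : ∀ (w : W) (s : S) (x : V), 
        (show V' from f.hom (show V from s • w • x)) = s • w • (show V' from f.hom x) := by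
      intro w s x
      have := f.hom.map_smul (SkewMonoidAlgebra.single w s) x
      erw [toModuleCat_single, toModuleCat_single] at this
      exact this
    refine ⟨⟨⟨⟨f.hom, map_add f.hom⟩, fun s x => ?_⟩, fun w x => ?_⟩, rfl⟩
    · have := key 1 s x
      rw [one_smul, one_smul] at this
      exact this
    · have := key w 1 x
      rw [one_smul, one_smul] at this
      exact this

/-- The `S`-module with `W`-action underlying a module over the skew group ring. -/
def ofModule (N : ModuleCat.{v} (SkewMonoidAlgebra S W)) : SkewMod S W where
  carrier := N
  mod := Module.compHom N (SkewMonoidAlgebra.singleOneRingHom (k := S) (G := W))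
  act := DistribMulAction.compHom N (SkewMonoidAlgebra.of S W)
  act_smul w s x := by
    change (SkewMonoidAlgebra.single w (1 : S)) • SkewMonoidAlgebra.single (1 : W) s • x =
      SkewMonoidAlgebra.single (1 : W) (w • s) • SkewMonoidAlgebra.single w (1 : S) • x
    simp only [smul_smul, SkewMonoidAlgebra.single_mul_single, one_smul, mul_one, one_mul]

instance : (toModuleCat (S := S) (W := W)).EssSurj where
  mem_essImage N := by
    have key : ∀ (w : W) (s : S) (y : N), SkewMonoidAlgebra.single (1 : W) s •
        SkewMonoidAlgebra.single w (1 : S) • y = SkewMonoidAlgebra.single w s • y := fun w s y => by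
      rw [smul_smul, SkewMonoidAlgebra.single_mul_single, one_smul, mul_one, one_mul]
    let : Module (SkewMonoidAlgebra S W) (ofModule N) :=
      Module.compHom (ofModule N) (ofModule N).actionHom
    refine ⟨ofModule N, ⟨LinearEquiv.toModuleIso (X₁ := (ofModule N).carrier) (X₂ := N)
      { AddEquiv.refl N with
        map_smul' := fun a x => ?_ }⟩⟩
    change (ofModule N).actionHom a x = a • (show N from x)
    induction a using SkewMonoidAlgebra.induction_on with
    | zero => rw [map_zero, zero_smul]; rfl
    | single w s =>
      rw [actionHom_single]
      exact key w s x
    | add a b ha hb =>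
      have h1 : (ofModule N).actionHom (a + b) x =
          (ofModule N).actionHom a x + (ofModule N).actionHom b x := by
        rw [map_add]; rfl
      rw [h1, ha, hb, add_smul]
      rfl

instance : (toModuleCat (S := S) (W := W)).IsEquivalence where

/-- The category `SkewMod S W` is equivalent to the category of left modules over the skew group
ring `S ⋊ W`. -/
def equivalence : SkewMod S W ≌ ModuleCat.{v} (SkewMonoidAlgebra S W) :=
  toModuleCat.asEquivalence

end SkewMod

end SkewMod

/-! ### Brauer quotients -/

section Brauer

variable {G : Type u} [Group G]

theorem FinGSet.conj_lt {H K : Subgroup G} (hK : K < H) (g : Subgroup.normalizer (H : Set G)) :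
    K.map (MulAut.conj (g : G)).toMonoidHom < H := by
  have hH : H.map (MulAut.conj (g : G)).toMonoidHom = H := by
    ext x
    constructor
    · rintro ⟨y, hy, rfl⟩
      exact (Subgroup.mem_normalizer_iff.1 g.2 y).1 hy
    · intro hx
      refine ⟨(g : G)⁻¹ * x * g, ?_, by simp [mul_assoc]⟩
      have := (Subgroup.mem_normalizer_iff.1 (inv_mem g.2) x).1 hx
      simpa using this
  conv_rhs => rw [← hH]
  exact (Subgroup.map_lt_map_iff_of_injective (MulAut.conj (g : G)).injective).2 hK

variable [Finite G]

/-- The Weyl group `W_G(H) = N_G(H)/H`. -/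
abbrev Weyl (H : Subgroup G) : Type u :=
  Subgroup.normalizer (H : Set G) ⧸ H.subgroupOf (Subgroup.normalizer (H : Set G))

theorem FinGSet.orbitConj_one (H : Subgroup G) : orbitConj H 1 = MulActionHom.id G := by
  ext x
  induction x using QuotientGroup.induction_on with
  | H γ => exact congrArg (QuotientGroup.mk (s := H)) (mul_one γ)

theorem FinGSet.orbitConj_mul (H : Subgroup G) (a b : Subgroup.normalizer (H : Set G)) :
    orbitConj H (a * b) = (orbitConj H b).comp (orbitConj H a) := by
  ext x
  induction x using QuotientGroup.induction_on with
  | H γ => exact congrArg (QuotientGroup.mk (s := H)) (mul_assoc γ (a : G) (b : G)).symm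

theorem FinGSet.orbitConj_of_mem (H : Subgroup G) (a : Subgroup.normalizer (H : Set G))
    (ha : (a : G) ∈ H) : orbitConj H a = MulActionHom.id G := by
  ext x
  induction x using QuotientGroup.induction_on with
  | H γ =>
    refine QuotientGroup.eq.2 ?_
    simpa using ha

theorem FinGSet.orbitConj_isPullbackSq {H K : Subgroup G} (hK : K < H)
    (g : Subgroup.normalizer (H : Set G)) :
    IsPullbackSq
      (orbitMap (K.map (MulAut.conj (g : G)).toMonoidHom) K g (by
        rintro _ ⟨k, hk, rfl⟩
        simpa [mul_assoc] using hk))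
      (orbitProj (conj_lt hK g).le) (orbitProj hK.le) (orbitConj H g) := by
  refine ⟨fun z => ?_, fun x y hxy => ?_⟩
  · induction z using QuotientGroup.induction_on with
    | H γ =>
      refine congrArg (QuotientGroup.mk (s := H)) ?_
      simp
  · induction x using QuotientGroup.induction_on with
    | H a =>
      induction y using QuotientGroup.induction_on with
      | H b =>
        refine ⟨QuotientGroup.mk (a * (g : G)⁻¹), ⟨?_, ?_⟩, ?_⟩
        · exact congrArg (QuotientGroup.mk (s := K)) (inv_mul_cancel_right a (g : G))
        · have h1 : (a * 1)⁻¹ * (b * g) ∈ H := QuotientGroup.eq.1 hxy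
          refine QuotientGroup.eq.2 ?_
          have h2 := (Subgroup.mem_normalizer_iff.1 g.2 _).1 h1
          simpa [mul_assoc] using h2
        · intro w hw
          induction w using QuotientGroup.induction_on with
          | H c =>
            have h1 : (c * g)⁻¹ * a ∈ K := QuotientGroup.eq.1 hw.1
            refine QuotientGroup.eq.2 ⟨_, h1, ?_⟩
            simp [mul_assoc]

variable {R : CommGreenFunctor G}

namespace MackeyModule

/-- Restriction as a semilinear map. -/
def resSL (M : MackeyModule R) {X Y : FinGSet G} (f : X →[G] Y) :
    M.obj Y →ₛₗ[R.res f] M.obj X where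
  toFun := M.res f
  map_add' := map_add (M.res f)
  map_smul' := M.res_smul f

/-- The image of an induction map, as an `R(Y)`-submodule. -/
def indRange (M : MackeyModule R) {X Y : FinGSet G} (f : X →[G] Y) :
    Submodule (R.obj Y) (M.obj Y) where
  carrier := Set.range (M.ind f)
  add_mem' := by
    rintro _ _ ⟨a, rfl⟩ ⟨b, rfl⟩
    exact ⟨a + b, map_add _ a b⟩
  zero_mem' := ⟨0, map_zero _⟩
  smul_mem' := by
    rintro r _ ⟨a, rfl⟩
    exact ⟨_, M.ind_res_smul f r a⟩

variable (M : MackeyModule R) (H : Subgroup G)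

/-- The sum of the images of all inductions from proper subgroups of `H`. -/
def brauerSub : Submodule (R.obj (orbit H)) (M.obj (orbit H)) :=
  ⨆ (K : Subgroup G) (h : K < H), M.indRange (orbitProj h.le)

/-- The Brauer quotient of `M` at `H`. -/
def BrauerQuot : Type (u + 1) := M.obj (orbit H) ⧸ M.brauerSub H

instance : AddCommGroup (M.BrauerQuot H) :=
  inferInstanceAs (AddCommGroup (M.obj (orbit H) ⧸ M.brauerSub H))

instance : Module (R.obj (orbit H)) (M.BrauerQuot H) :=
  inferInstanceAs (Module (R.obj (orbit H)) (M.obj (orbit H) ⧸ M.brauerSub H))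

variable {M} in
/-- The class in the Brauer quotient. -/
def br {H : Subgroup G} (m : M.obj (orbit H)) : M.BrauerQuot H := Submodule.Quotient.mk m

end MackeyModule

open MackeyModule

/-- The ideal of elements of `R(H)` that are sums of elements induced from proper subgroups. -/
def CommGreenFunctor.brauerIdeal (R : CommGreenFunctor G) (H : Subgroup G) :
    Ideal (R.obj (orbit H)) := R.self.brauerSub H

/-- The Brauer quotient ring of `R` at `H`. -/
def CommGreenFunctor.BrauerRing (R : CommGreenFunctor G) (H : Subgroup G) : Type (u + 1) :=
  R.obj (orbit H) ⧸ R.brauerIdeal H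

instance (H : Subgroup G) : CommRing (R.BrauerRing H) :=
  inferInstanceAs (CommRing (R.obj (orbit H) ⧸ R.brauerIdeal H))

/-- The class in the Brauer quotient ring. -/
def CommGreenFunctor.brRing (R : CommGreenFunctor G) {H : Subgroup G} : R.obj (orbit H) →+* R.BrauerRing H :=
  Ideal.Quotient.mk (R.brauerIdeal H)

namespace MackeyModule

variable (M : MackeyModule R) (H : Subgroup G)

theorem smul_mem_brauerSub (r : R.obj (orbit H)) (hr : r ∈ R.brauerIdeal H)
    (m : M.obj (orbit H)) : r • m ∈ M.brauerSub H := by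
  have : R.brauerIdeal H ≤
      (M.brauerSub H).comap (LinearMap.toSpanSingleton (R.obj (orbit H)) _ m) := by
    refine iSup₂_le fun K hK => ?_
    rintro _ ⟨s, rfl⟩
    change R.ind (orbitProj hK.le) s • m ∈ M.brauerSub H
    rw [← M.ind_smul_res]
    exact (le_iSup₂ (f := fun K (h : K < H) => M.indRange (orbitProj h.le)) K hK) ⟨_, rfl⟩
  exact this hr

theorem isTorsionBySet_brauerQuot :
    Module.IsTorsionBySet (R.obj (orbit H)) (M.BrauerQuot H) (R.brauerIdeal H) := by
  intro x r
  obtain ⟨m, rfl⟩ := Submodule.Quotient.mk_surjective _ x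
  exact (Submodule.Quotient.mk_eq_zero _).2 (M.smul_mem_brauerSub H r r.2 m)

instance : Module (R.BrauerRing H) (M.BrauerQuot H) :=
  (M.isTorsionBySet_brauerQuot H).module

theorem brRing_smul_br (r : R.obj (orbit H)) (m : M.obj (orbit H)) :
    R.brRing r • (br m : M.BrauerQuot H) = br (r • m) := rfl

theorem brauerSub_le_comap (g : Subgroup.normalizer (H : Set G)) :
    M.brauerSub H ≤ (M.brauerSub H).comap (M.resSL (orbitConj H g)) := by
  refine iSup₂_le fun K hK => ?_
  rintro _ ⟨s, rfl⟩
  change M.res (orbitConj H g) (M.ind (orbitProj hK.le) s) ∈ M.brauerSub H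
  rw [M.base_change (orbitConj_isPullbackSq hK g)]
  exact (le_iSup₂ (f := fun K (h : K < H) => M.indRange (orbitProj h.le)) _ (conj_lt hK g))
    ⟨_, rfl⟩

/-- The conjugation map `c_g` on the Brauer quotient. -/
def brauerConj (g : Subgroup.normalizer (H : Set G)) :
    M.BrauerQuot H →ₛₗ[R.res (orbitConj H g)] M.BrauerQuot H :=
  Submodule.mapQ (M.brauerSub H) (M.brauerSub H) (M.resSL (orbitConj H g))
    (M.brauerSub_le_comap H g)

/-- The conjugation action of the normalizer on the Brauer quotient. -/
def normalizerHom : Subgroup.normalizer (H : Set G) →* AddMonoid.End (M.BrauerQuot H) where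
  toFun g := (M.brauerConj H g).toAddMonoidHom
  map_one' := by
    ext x
    obtain ⟨m, rfl⟩ := Submodule.Quotient.mk_surjective _ x
    change br (M.res (orbitConj H 1) m) = br m
    rw [orbitConj_one, M.res_id]
  map_mul' a b := by
    ext x
    obtain ⟨m, rfl⟩ := Submodule.Quotient.mk_surjective _ x
    change br (M.res (orbitConj H (a * b)) m) = br (M.res _ (M.res _ m))
    rw [orbitConj_mul, M.res_comp]

/-- The conjugation action of the Weyl group on the Brauer quotient. -/
def weylHom : Weyl H →* AddMonoid.End (M.BrauerQuot H) :=
  QuotientGroup.lift _ (M.normalizerHom H) (by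
    intro g hg
    ext x
    obtain ⟨m, rfl⟩ := Submodule.Quotient.mk_surjective _ x
    change br (M.res (orbitConj H g) m) = br m
    rw [orbitConj_of_mem H g hg, M.res_id])

instance : DistribMulAction (Weyl H) (M.BrauerQuot H) :=
  DistribMulAction.compHom (M.BrauerQuot H) (M.weylHom H)

theorem weyl_smul_br (g : Subgroup.normalizer (H : Set G)) (m : M.obj (orbit H)) :
    (QuotientGroup.mk g : Weyl H) • (br m : M.BrauerQuot H) = br (M.res (orbitConj H g) m) := rfl

end MackeyModule

namespace CommGreenFunctor

variable (R) (H : Subgroup G)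

/-- The conjugation action of the normalizer on the Brauer quotient ring. -/
def normalizerRingHom : Subgroup.normalizer (H : Set G) →* (R.BrauerRing H →+* R.BrauerRing H) where
  toFun g := Ideal.quotientMap (R.brauerIdeal H) (R.res (orbitConj H g))
    (R.self.brauerSub_le_comap H g)
  map_one' := by
    ext x
    obtain ⟨m, rfl⟩ := Ideal.Quotient.mk_surjective x
    change R.brRing (R.res (orbitConj H 1) m) = R.brRing m
    rw [orbitConj_one, R.res_id]
  map_mul' a b := by
    ext x
    obtain ⟨m, rfl⟩ := Ideal.Quotient.mk_surjective x
    change R.brRing (R.res (orbitConj H (a * b)) m) = R.brRing (R.res _ (R.res _ m))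
    rw [orbitConj_mul, R.res_comp]

/-- The conjugation action of the Weyl group on the Brauer quotient ring. -/
def weylRingHom : Weyl H →* (R.BrauerRing H →+* R.BrauerRing H) :=
  QuotientGroup.lift _ (R.normalizerRingHom H) (by
    intro g hg
    ext x
    obtain ⟨m, rfl⟩ := Ideal.Quotient.mk_surjective x
    change R.brRing (R.res (orbitConj H g) m) = R.brRing m
    rw [orbitConj_of_mem H g hg, R.res_id])

instance : MulSemiringAction (Weyl H) (R.BrauerRing H) :=
  MulSemiringAction.compHom (R.BrauerRing H) (R.weylRingHom H)

theorem weyl_smul_brRing (g : Subgroup.normalizer (H : Set G)) (r : R.obj (orbit H)) :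
    (QuotientGroup.mk g : Weyl H) • R.brRing r = R.brRing (R.res (orbitConj H g) r) := rfl

variable {R} in
/-- The map induced on Brauer quotients by a morphism of Mackey `R`-modules. -/
def brauerMap {M N : MackeyModule R} (f : M ⟶ N) :
    M.BrauerQuot H →ₗ[R.BrauerRing H] N.BrauerQuot H :=
  let F : M.BrauerQuot H →ₗ[R.obj (orbit H)] N.BrauerQuot H :=
    Submodule.mapQ (M.brauerSub H) (N.brauerSub H) (f.app (orbit H)) (by
      refine iSup₂_le fun K hK => ?_
      rintro _ ⟨s, rfl⟩
      change f.app _ (M.ind (orbitProj hK.le) s) ∈ N.brauerSub H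
      rw [f.app_ind]
      exact (le_iSup₂ (f := fun K (h : K < H) => N.indRange (orbitProj h.le)) K hK) ⟨_, rfl⟩)
  { toFun := F
    map_add' := map_add F
    map_smul' := fun s x => by
      obtain ⟨r, rfl⟩ := Ideal.Quotient.mk_surjective s
      exact map_smul F r x }

variable {R H} in
theorem brauerMap_br {M N : MackeyModule R} (f : M ⟶ N) (m : M.obj (orbit H)) :
    brauerMap H f (br m) = br (f.app (orbit H) m) := rfl

theorem br_surjective {M : MackeyModule R} (x : M.BrauerQuot H) : ∃ m, br m = x :=
  Submodule.Quotient.mk_surjective _ x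

/-- The Brauer quotient functor `Br_H` from Mackey `R`-modules to modules over the skew group ring
of the conjugation action of `W_G(H)` on the Brauer quotient ring of `R` at `H`. -/
def brauer : MackeyModule R ⥤ SkewMod (R.BrauerRing H) (Weyl H) where
  obj M :=
    { carrier := M.BrauerQuot H
      act_smul := fun w s x => by
        induction w using QuotientGroup.induction_on with
        | H g =>
          obtain ⟨r, rfl⟩ := Ideal.Quotient.mk_surjective s
          obtain ⟨m, rfl⟩ := br_surjective R H x
          exact congrArg br (M.res_smul (orbitConj H g) r m) }
  map {M N} f :=
    { lin := brauerMap H f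
      map_act := fun w x => by
        induction w using QuotientGroup.induction_on with
        | H g =>
          obtain ⟨m, rfl⟩ := br_surjective R H x
          exact congrArg br (f.app_res (orbitConj H g) m) }
  map_id M := by
    apply SkewMod.hom_ext
    intro x
    obtain ⟨m, rfl⟩ := br_surjective R H x
    exact brauerMap_br (𝟙 M) m
  map_comp {M N P} f g := by
    apply SkewMod.hom_ext
    intro x
    obtain ⟨m, rfl⟩ := br_surjective R H x
    exact brauerMap_br (f ≫ g) m

end CommGreenFunctor

end Brauer

/-! ### Product tensor structure -/

section Pi

universe v₁ u₁ w₁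

variable {I : Type w₁} (C : I → Type u₁) [∀ i, Category.{v₁} (C i)] [∀ i, MonoidalCategory (C i)]

/-- The componentwise monoidal structure on a product of monoidal categories. -/
instance piMonoidal : MonoidalCategory (∀ i, C i) where
  tensorObj X Y := fun i => X i ⊗ Y i
  whiskerLeft X _ _ f := fun i => X i ◁ f i
  whiskerRight f Y := fun i => f i ▷ Y i
  tensorHom f g := fun i => f i ⊗ₘ g i
  tensorUnit := fun i => 𝟙_ (C i)
  associator X Y Z := Pi.isoMk fun i => α_ (X i) (Y i) (Z i)
  leftUnitor X := Pi.isoMk fun i => λ_ (X i)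
  rightUnitor X := Pi.isoMk fun i => ρ_ (X i)
  tensorHom_def _ _ := funext fun _ => MonoidalCategory.tensorHom_def _ _
  id_tensorHom_id _ _ := funext fun _ => MonoidalCategory.id_tensorHom_id _ _
  tensorHom_comp_tensorHom _ _ _ _ :=
    funext fun _ => MonoidalCategory.tensorHom_comp_tensorHom _ _ _ _
  whiskerLeft_id _ _ := funext fun _ => MonoidalCategory.whiskerLeft_id _ _
  id_whiskerRight _ _ := funext fun _ => MonoidalCategory.id_whiskerRight _ _
  associator_naturality _ _ _ := funext fun _ => MonoidalCategory.associator_naturality _ _ _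
  leftUnitor_naturality _ := funext fun _ => MonoidalCategory.leftUnitor_naturality _
  rightUnitor_naturality _ := funext fun _ => MonoidalCategory.rightUnitor_naturality _
  pentagon _ _ _ _ := funext fun _ => MonoidalCategory.pentagon _ _ _ _
  triangle _ _ := funext fun _ => MonoidalCategory.triangle _ _

/-- The componentwise symmetry on a product of symmetric monoidal categories. -/
instance piSymmetric [∀ i, SymmetricCategory (C i)] : SymmetricCategory (∀ i, C i) where
  braiding X Y := Pi.isoMk fun i => β_ (X i) (Y i)
  braiding_naturality_right _ _ _ _ :=
    funext fun _ => BraidedCategory.braiding_naturality_right _ _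
  braiding_naturality_left _ _ := funext fun _ => BraidedCategory.braiding_naturality_left _ _
  hexagon_forward _ _ _ := funext fun _ => BraidedCategory.hexagon_forward _ _ _
  hexagon_reverse _ _ _ := funext fun _ => BraidedCategory.hexagon_reverse _ _ _
  symmetry _ _ := funext fun _ => SymmetricCategory.symmetry _ _

end Pi

/-! ### Linearization of Green functors -/

section Linearization

/-- The ring `Q ⊗_ℤ S`, for a subring `Q` of the rational numbers. -/
def ScalarExt (Q : Subring ℚ) (S : Type*) [CommRing S] : Type _ := Q ⊗[ℤ] S

namespace ScalarExt

variable (Q : Subring ℚ) {S S' : Type*} [CommRing S] [CommRing S']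

instance : CommRing (ScalarExt Q S) := inferInstanceAs (CommRing (Q ⊗[ℤ] S))

variable {Q} in
/-- The element `q ⊗ s`. -/
def mk (q : Q) (s : S) : ScalarExt Q S := q ⊗ₜ[ℤ] s

theorem mk_mul_mk (q q' : Q) (s s' : S) : mk q s * mk q' s' = mk (q * q') (s * s') :=
  Algebra.TensorProduct.tmul_mul_tmul q q' s s'

theorem induction {p : ScalarExt Q S → Prop} (t : ScalarExt Q S) (zero : p 0)
    (add : ∀ a b, p a → p b → p (a + b)) (tmul : ∀ q s, p (mk q s)) : p t :=
  TensorProduct.induction_on t zero tmul add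

/-- The additive map `q ⊗ s ↦ q ⊗ f(s)`. -/
def mapAdd (f : S →+ S') : ScalarExt Q S →+ ScalarExt Q S' :=
  (LinearMap.lTensor Q f.toIntLinearMap).toAddMonoidHom

@[simp] theorem mapAdd_mk (f : S →+ S') (q : Q) (s : S) : mapAdd Q f (mk q s) = mk q (f s) := rfl

/-- The ring homomorphism `q ⊗ s ↦ q ⊗ f(s)`. -/
def mapRing (f : S →+* S') : ScalarExt Q S →+* ScalarExt Q S' :=
  (Algebra.TensorProduct.map (AlgHom.id ℤ Q) f.toIntAlgHom).toRingHom

@[simp] theorem mapRing_mk (f : S →+* S') (q : Q) (s : S) :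
    mapRing Q f (mk q s) = mk q (f s) := rfl

/-- The ring homomorphism `q ↦ q ⊗ 1`. -/
def inclLeft (S : Type*) [CommRing S] : Q →+* ScalarExt Q S :=
  Algebra.TensorProduct.includeLeftRingHom

/-- The ring homomorphism `s ↦ 1 ⊗ s`. -/
def inclRight (S : Type*) [CommRing S] : S →+* ScalarExt Q S :=
  (Algebra.TensorProduct.includeRight : S →ₐ[ℤ] Q ⊗[ℤ] S).toRingHom

variable {Q} in
/-- The ring homomorphism `q ⊗ s ↦ f(q) g(s)`. -/
def lift (f : Q →+* S') (g : S →+* S') : ScalarExt Q S →+* S' :=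
  (Algebra.TensorProduct.productMap f.toIntAlgHom g.toIntAlgHom).toRingHom

variable {Q} in
theorem lift_mk (f : Q →+* S') (g : S →+* S') (q : Q) (s : S) : lift f g (mk q s) = f q * g s :=
  Algebra.TensorProduct.productMap_apply_tmul (A := Q) f.toIntAlgHom g.toIntAlgHom q s

variable {W : Type*} [Group W] [MulSemiringAction W S]

/-- The action `w • (q ⊗ s) = q ⊗ (w • s)`. -/
instance : MulSemiringAction W (ScalarExt Q S) :=
  MulSemiringAction.compHom (ScalarExt Q S)
    ({ toFun := fun w => mapRing Q (MulSemiringAction.toRingHom W S w)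
       map_one' := by
        ext t
        induction t using ScalarExt.induction with
        | zero => simp
        | add a b ha hb => rw [map_add, map_add, ha, hb]
        | tmul q s => exact congrArg (mk q) (one_smul W s)
       map_mul' := fun w w' => by
        ext t
        induction t using ScalarExt.induction with
        | zero => simp
        | add a b ha hb => rw [map_add, map_add, ha, hb]
        | tmul q s => exact congrArg (mk q) (mul_smul w w' s) } :
      W →* (ScalarExt Q S →+* ScalarExt Q S))

theorem smul_mk (w : W) (q : Q) (s : S) : w • mk q s = mk q (w • s) := rfl

end ScalarExt

namespace CommGreenFunctor

variable {G : Type u} [Group G]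

/-- The `Q`-linearization `R_Q` of `R`, with `R_Q(X) = Q ⊗_ℤ R(X)`. -/
def linearization (R : CommGreenFunctor G) (Q : Subring ℚ) : CommGreenFunctor G where
  obj X := ScalarExt Q (R.obj X)
  res _ _ f := ScalarExt.mapRing Q (R.res f)
  ind _ _ f := ScalarExt.mapAdd Q (R.ind f)
  isMackey := by
    refine isMackey_of_sum_eq ?_ ?_ ?_ ?_ ?_ ?_ ?_
    · intro X t
      induction t using ScalarExt.induction with
      | zero => simp
      | add a b ha hb => rw [map_add, ha, hb]
      | tmul q s => exact congrArg (ScalarExt.mk q) (R.res_id s)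
    · intro X Y Z g f t
      induction t using ScalarExt.induction with
      | zero => simp
      | add a b ha hb => simp only [map_add, ha, hb]
      | tmul q s => exact congrArg (ScalarExt.mk q) (R.res_comp g f s)
    · intro X t
      induction t using ScalarExt.induction with
      | zero => simp
      | add a b ha hb => rw [map_add, ha, hb]
      | tmul q s => exact congrArg (ScalarExt.mk q) (R.ind_id s)
    · intro X Y Z g f t
      induction t using ScalarExt.induction with
      | zero => simp
      | add a b ha hb => simp only [map_add, ha, hb]
      | tmul q s => exact congrArg (ScalarExt.mk q) (R.ind_comp g f s)
    · intro P X Y Z p q f g h t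
      induction t using ScalarExt.induction with
      | zero => simp
      | add a b ha hb => simp only [map_add, ha, hb]
      | tmul q s => exact congrArg (ScalarExt.mk q) (R.base_change h s)
    · intro X hX
      have := R.isMackey.subsingleton X
      have key : ∀ t : ScalarExt Q (R.obj X), t = 0 := fun t => by
        induction t using ScalarExt.induction with
        | zero => rfl
        | add a b ha hb => rw [ha, hb, add_zero]
        | tmul q s =>
          rw [Subsingleton.elim s 0]
          exact TensorProduct.tmul_zero _ q
      exact ⟨fun a b => (key a).trans (key b).symm⟩
    · intro X Y t
      induction t using ScalarExt.induction with
      | zero => simp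
      | add a b ha hb =>
        simp only [map_add]
        rw [add_add_add_comm, ha, hb]
      | tmul q s =>
        refine (TensorProduct.tmul_add q _ _).symm.trans ?_
        exact congrArg (ScalarExt.mk q) (R.isMackey.sum_eq X Y s)
  frobenius X Y f r s := by
    induction r using ScalarExt.induction with
    | zero => simp
    | add a b ha hb => simp only [map_add, add_mul, ha, hb]
    | tmul q r =>
      induction s using ScalarExt.induction with
      | zero => simp
      | add a b ha hb => simp only [map_add, mul_add, ha, hb]
      | tmul q' s =>
        rw [ScalarExt.mapRing_mk, ScalarExt.mk_mul_mk, ScalarExt.mapAdd_mk, ScalarExt.mapAdd_mk,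
          ScalarExt.mk_mul_mk, R.frobenius]

variable [Finite G] (R : CommGreenFunctor G) (Q : Subring ℚ) (H : Subgroup G)

theorem brauerIdeal_le_comap :
    R.brauerIdeal H ≤ ((R.linearization Q).brauerIdeal H).comap
      (ScalarExt.inclRight Q (R.obj (orbit H))) := by
  refine iSup₂_le fun K hK => ?_
  rintro _ ⟨s, rfl⟩
  refine (le_iSup₂ (f := fun K (h : K < H) =>
    (R.linearization Q).self.indRange (orbitProj h.le)) K hK) ⟨ScalarExt.mk 1 s, rfl⟩

/-- The canonical ring homomorphism from `Q ⊗_ℤ S`, where `S` is the Brauer quotient ring of `R`,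
to the Brauer quotient ring of `R_Q`; it sends `q ⊗ [r]` to `[q ⊗ r]`. -/
def compareRing : ScalarExt Q (R.BrauerRing H) →+* (R.linearization Q).BrauerRing H :=
  ScalarExt.lift
    ((R.linearization Q).brRing.comp (ScalarExt.inclLeft Q (R.obj (orbit H))))
    (Ideal.quotientMap _ (ScalarExt.inclRight Q (R.obj (orbit H))) (R.brauerIdeal_le_comap Q H))

theorem compareRing_mk (q : Q) (r : R.obj (orbit H)) :
    R.compareRing Q H (ScalarExt.mk q (R.brRing r)) =
      (R.linearization Q).brRing (ScalarExt.mk q r : ScalarExt Q (R.obj (orbit H))) := by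
  refine (ScalarExt.lift_mk _ _ q _).trans ?_
  refine (map_mul (R.linearization Q).brRing
    (ScalarExt.mk q 1 : ScalarExt Q (R.obj (orbit H)))
    (ScalarExt.mk 1 r : ScalarExt Q (R.obj (orbit H)))).symm.trans ?_
  refine congrArg (R.linearization Q).brRing ((ScalarExt.mk_mul_mk _ _ _ _ _).trans ?_)
  rw [mul_one, one_mul]

theorem compareRing_smul (w : Weyl H) (t : ScalarExt Q (R.BrauerRing H)) :
    R.compareRing Q H (w • t) = w • R.compareRing Q H t := by
  induction t using ScalarExt.induction with
  | zero => simp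
  | add a b ha hb => rw [smul_add, map_add, map_add, smul_add, ha, hb]
  | tmul q s =>
    induction w using QuotientGroup.induction_on with
    | H g =>
      obtain ⟨r, rfl⟩ := Ideal.Quotient.mk_surjective s
      refine (R.compareRing_mk Q H q (R.res (orbitConj H g) r)).trans ?_
      refine Eq.trans ?_
        (congrArg ((QuotientGroup.mk g : Weyl H) • ·) (R.compareRing_mk Q H q r)).symm
      rfl

/-- The Brauer quotient functor on Mackey `R_Q`-modules, with the Brauer quotient viewed as a
module over the skew group ring with coefficients in `Q ⊗_ℤ S`, where `S` is the Brauer quotient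
ring of `R`. -/
def brauerQ : MackeyModule (R.linearization Q) ⥤
    SkewMod (ScalarExt Q (R.BrauerRing H)) (Weyl H) :=
  (R.linearization Q).brauer H ⋙
    SkewMod.restrictScalars (R.compareRing Q H) (R.compareRing_smul Q H)

/-- The functor with components `Br_H`, for `H` in a family `T` of subgroups. -/
def brauerProd (T : Set (Subgroup G)) :
    MackeyModule R ⥤ ∀ H : T, SkewMod (R.BrauerRing H.1) (Weyl H.1) :=
  Functor.pi' fun H : T => R.brauer H.1

/-- The version of `brauerProd` on Mackey `R_Q`-modules. -/
def brauerProdQ (T : Set (Subgroup G)) : MackeyModule (R.linearization Q) ⥤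
    ∀ H : T, SkewMod (ScalarExt Q (R.BrauerRing H.1)) (Weyl H.1) :=
  Functor.pi' fun H : T => R.brauerQ Q H.1

end CommGreenFunctor

end Linearization

/-- The set `T` contains exactly one member of each conjugacy class of subgroups of `G`. -/
def IsConjReps {G : Type u} [Group G] (T : Set (Subgroup G)) : Prop :=
  ∀ H : Subgroup G, ∃! K : Subgroup G, K ∈ T ∧
    ∃ g : G, K = H.map (MulAut.conj g).toMonoidHom

end

noncomputable section

open FinGSet MackeyModule

/-! ### Equivariant maps between finite `G`-sets -/

namespace FinGSet

variable {G : Type u} [Group G]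

/-! Everything rests on the marks of an element `m` of `M(X)`: the classes of `x^* m` in the Brauer
quotients at `H`, for all maps `x : G/H → X`. The mark formula `br_res_ind` says that induction acts
on marks by summing over lifts: the mark of `f_* m` at `y` is the sum of the marks of `m` at all `t`
with `f ∘ t = y`. Base change reduces this to induction along a map `q : P → G/H`. Split `P` into
orbits. An orbit mapped bijectively to `G/H` is the image of a section of `q` and contributes the
restriction along that section; every other orbit contributes an element induced from a proper
subgroup, which vanishes in the Brauer quotient (`ind_sub_sum_sections_mem`, `br_ind`).

For the monoidal structure, the inverse of `[m] ⊗ [n] ↦ [m ⊗ n]` is written down explicitly: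
`splitTensor` sends the class of `m ⊗ n` at `θ` to the sum of `[s^* m] ⊗ [s^* n]` over the sections
`s` of `θ`. The mark formula gives the first two defining relations. If `θ` factors through `G/K`
with `K < H`, it has no section, so the map descends to the Brauer quotient. The two composites are
identities because the identity has only one section and because of `br_ind`. Coherence is then
checked on pure tensors.

When `|G|` is invertible, the marks identify `M(X)` with the group of all families equivariant under
the Weyl groups. The tool is the operator `corr p = 1 - n⁻¹ p_* p^*` for `p : G/L → G/K`, where `n`
counts the endomorphisms of `G/L` over `G/K` and divides `|G|`. It moves elements induced from `L`
to subgroups strictly below `L`, and it kills the restriction to `L` of elements that already vanish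
below `L`. Running through the proper subgroups of `K` with it shows that a sum of properly induced
elements with vanishing proper restrictions is zero (`eq_zero_of_mem_brauerSub`), and that each
Brauer class has a primitive representative, one that restricts to zero along all non-bijective maps
(`exists_primitive_lift`). The first fact makes marks injective (`eq_zero_of_br_eq_zero`); the
second realizes every equivariant family by averaging inductions of primitive representatives
(`exists_br_res_eq`).

Consequently the functor of Brauer quotients is faithful and full. It is essentially surjective
because equivariant families with values in given modules form a Mackey module `markModule V` whose
Brauer quotients give back `V`. Finally `compareRing` is an isomorphism, so restricting scalars
along it keeps both the tensor structure and the equivalence. -/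

instance (X Y : FinGSet G) : Finite (X →[G] Y) :=
  Finite.of_injective (fun f : X →[G] Y => (f : X → Y)) DFunLike.coe_injective

instance (X Y : FinGSet G) : Fintype (X →[G] Y) := Fintype.ofFinite _

instance (X Y : FinGSet G) : DecidableEq (X →[G] Y) := Classical.decEq _

theorem comp_assoc {W X Y Z : FinGSet G} (h : Y →[G] Z) (g : X →[G] Y) (f : W →[G] X) :
    (h.comp g).comp f = h.comp (g.comp f) := rfl

theorem exists_inverse {X Y : FinGSet G} (f : X →[G] Y) (hf : Function.Bijective f) :
    ∃ v : Y →[G] X, f.comp v = MulActionHom.id G ∧ v.comp f = MulActionHom.id G ∧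
      Function.Bijective v := by
  let e := Equiv.ofBijective f hf
  refine ⟨⟨e.symm, fun a y => ?_⟩, ?_, ?_, e.symm.bijective⟩
  · rw [Equiv.symm_apply_eq]
    exact (((map_smul f a (e.symm y))).trans (congrArg (a • ·) (e.apply_symm_apply y))).symm
  · exact MulActionHom.ext e.apply_symm_apply
  · exact MulActionHom.ext e.symm_apply_apply

/-- An equivariant map with image in that of an injective map factors through it. -/
theorem exists_lift {W X Y : FinGSet G} (f : X →[G] Y) (hf : Function.Injective f)
    (x : W →[G] Y) (h : ∀ z, ∃ a, f a = x z) : ∃ x' : W →[G] X, f.comp x' = x := by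
  choose k hk using h
  refine ⟨⟨k, fun a z => hf ?_⟩, MulActionHom.ext hk⟩
  rw [hk]
  exact (map_smul x a z).trans ((map_smul f a (k z)).trans (congrArg (a • ·) (hk z))).symm

theorem comp_left_cancel {W X Y : FinGSet G} {f : X →[G] Y} (hf : Function.Injective f)
    {a b : W →[G] X} (h : f.comp a = f.comp b) : a = b :=
  MulActionHom.ext fun z => hf (DFunLike.congr_fun h z)

theorem comp_right_cancel {W X Y : FinGSet G} {f : W →[G] X} (hf : Function.Surjective f)
    {a b : X →[G] Y} (h : a.comp f = b.comp f) : a = b :=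
  MulActionHom.ext fun z => by
    obtain ⟨w, rfl⟩ := hf z
    exact DFunLike.congr_fun h w

/-- The universal property of a pullback square for equivariant maps. -/
theorem IsPullbackSq.existsUnique_lift {P X Y Z W : FinGSet G} {p : P →[G] X} {q : P →[G] Y}
    {f : X →[G] Z} {g : Y →[G] Z} (h : IsPullbackSq p q f g) (a : W →[G] X) (b : W →[G] Y)
    (hab : f.comp a = g.comp b) : ∃! c : W →[G] P, p.comp c = a ∧ q.comp c = b := by
  have hw (w : W) : f (a w) = g (b w) := DFunLike.congr_fun hab w
  choose c hc hu using fun w => h.2 (a w) (b w) (hw w)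
  refine ⟨⟨c, fun γ w => ?_⟩, ⟨MulActionHom.ext fun w => (hc w).1,
    MulActionHom.ext fun w => (hc w).2⟩, fun c' hc' => MulActionHom.ext fun w => hu w (c' w)
      ⟨DFunLike.congr_fun hc'.1 w, DFunLike.congr_fun hc'.2 w⟩⟩
  -- The pointwise lift is equivariant by uniqueness: `γ • c w` has the two projections required of
  -- `c (γ • w)`.
  refine (hu (γ • w) (γ • c w) ⟨?_, ?_⟩).symm
  · exact (map_smul p γ _).trans ((congrArg (γ • ·) (hc w).1).trans (map_smul a γ w).symm)
  · exact (map_smul q γ _).trans ((congrArg (γ • ·) (hc w).2).trans (map_smul b γ w).symm)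

/-! ### Transitive `G`-sets, their maps and the Weyl group -/

variable [Finite G]

/-- The base point of `G/H`. -/
def base (H : Subgroup G) : orbit H := QuotientGroup.mk 1

theorem exists_smul_base {H : Subgroup G} (z : orbit H) : ∃ γ : G, γ • base H = z := by
  induction z using QuotientGroup.induction_on with
  | H γ => exact ⟨γ, congrArg (QuotientGroup.mk (s := H)) (mul_one γ)⟩

theorem smul_base_eq {H : Subgroup G} {a b : G} : a • base H = b • base H ↔ a⁻¹ * b ∈ H := by
  have h (γ : G) : γ • base H = (QuotientGroup.mk γ : G ⧸ H) :=
    congrArg (QuotientGroup.mk (s := H)) (mul_one γ)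
  rw [h, h]
  exact QuotientGroup.eq

theorem smul_base_of_mem {H : Subgroup G} {a : G} (ha : a ∈ H) : a • base H = base H := by
  have : a • base H = (1 : G) • base H := smul_base_eq.2 (by simpa using ha)
  rwa [one_smul] at this

theorem orbit_hom_ext {H : Subgroup G} {X : FinGSet G} {f g : orbit H →[G] X}
    (h : f (base H) = g (base H)) : f = g := MulActionHom.ext fun z => by
  obtain ⟨γ, rfl⟩ := exists_smul_base z
  rw [map_smul, map_smul, h]

/-- The map `G/H → X`, `γH ↦ γx`, for a point `x` fixed by `H`. -/
def point {X : FinGSet G} (H : Subgroup G) (x : X) (h : ∀ k ∈ H, k • x = x) : orbit H →[G] X where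
  toFun := Quotient.lift (fun γ : G => γ • x) fun a b hab => by
    have := h _ (QuotientGroup.leftRel_apply.1 hab)
    change a • x = b • x
    rw [← this, smul_smul, mul_inv_cancel_left, this]
  map_smul' a z := by
    induction z using QuotientGroup.induction_on with
    | H γ => exact mul_smul a γ x

theorem point_base {X : FinGSet G} (H : Subgroup G) (x : X) (h : ∀ k ∈ H, k • x = x) :
    point H x h (base H) = x := one_smul G x

theorem orbitMap_base (K L : Subgroup G) (g : G) (h : ∀ k ∈ K, g⁻¹ * k * g ∈ L) :
    orbitMap K L g h (base K) = g • base L :=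
  congrArg (QuotientGroup.mk (s := L)) ((one_mul g).trans (mul_one g).symm)

theorem orbitProj_base {K H : Subgroup G} (h : K ≤ H) : orbitProj h (base K) = base H :=
  (orbitMap_base _ _ _ _).trans (one_smul G _)

theorem orbitConj_base (H : Subgroup G) (g : Subgroup.normalizer (H : Set G)) :
    orbitConj H g (base H) = (g : G) • base H := orbitMap_base _ _ _ _

theorem surjective_of_orbit {X : FinGSet G} [Nonempty X] {H : Subgroup G} (f : X →[G] orbit H) :
    Function.Surjective f := fun z => by
  obtain ⟨x⟩ := ‹Nonempty X›
  obtain ⟨a, ha⟩ := exists_smul_base (f x)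
  obtain ⟨b, rfl⟩ := exists_smul_base z
  exact ⟨(b * a⁻¹) • x, by rw [map_smul, ← ha, smul_smul, inv_mul_cancel_right]⟩

instance (H : Subgroup G) : Nonempty (orbit H) := ⟨base H⟩

theorem bijective_endo {H : Subgroup G} (t : orbit H →[G] orbit H) : Function.Bijective t :=
  Finite.surjective_iff_bijective.1 (surjective_of_orbit t)

/-- The base point of `G/J` is fixed by `J`, hence so is its image `aL`, whose stabilizer is
`aLa⁻¹`. -/
theorem conj_mem_of_hom {J L : Subgroup G} (u : orbit J →[G] orbit L) {a : G}
    (ha : a • base L = u (base J)) : ∀ k ∈ J, a⁻¹ * k * a ∈ L := fun k hk => by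
  rw [mul_assoc, ← smul_base_eq, mul_smul, ha, ← map_smul u, smul_base_of_mem hk]

/-- A map `G/J → G/L` is an isomorphism followed by a projection. -/
theorem exists_factorization {J L : Subgroup G} (u : orbit J →[G] orbit L) :
    ∃ (L' : Subgroup G) (h : L' ≤ L) (v : orbit J →[G] orbit L'),
      Function.Bijective v ∧ (orbitProj h).comp v = u := by
  obtain ⟨a, ha⟩ := exists_smul_base (u (base J))
  have hJ := conj_mem_of_hom u ha
  -- `L'` is the conjugate `a⁻¹Ja`, chosen so that right translation by `a` is a bijection from
  -- `G/J` to `G/L'`.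
  obtain ⟨L', hL'⟩ : ∃ L' : Subgroup G, ∀ k, a⁻¹ * k * a ∈ L' ↔ k ∈ J :=
    ⟨J.map (MulAut.conj a⁻¹).toMonoidHom, fun k => by simp [Subgroup.mem_map, mul_assoc]⟩
  have hle : L' ≤ L := fun l hl => by
    have := hJ (a * l * a⁻¹) ((hL' _).1 (by simpa [mul_assoc] using hl))
    simpa [mul_assoc] using this
  have hv := orbitMap_base J L' a fun k hk => (hL' k).2 hk
  refine ⟨L', hle, orbitMap J L' a fun k hk => (hL' k).2 hk, ⟨?_, surjective_of_orbit _⟩,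
    orbit_hom_ext ?_⟩
  · intro x y hxy
    obtain ⟨b, rfl⟩ := exists_smul_base x
    obtain ⟨c, rfl⟩ := exists_smul_base y
    rw [map_smul, map_smul, hv, smul_smul, smul_smul, smul_base_eq] at hxy
    rw [smul_base_eq, ← hL']
    simpa [mul_assoc] using hxy
  · refine (congrArg (orbitProj hle) hv).trans ?_
    rw [map_smul, orbitProj_base, ha]

theorem orbitProj_self (H : Subgroup G) : orbitProj (le_refl H) = MulActionHom.id G :=
  orbit_hom_ext (orbitProj_base _)

theorem orbitProj_comp {J K L : Subgroup G} (h : J ≤ K) (h' : K ≤ L) :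
    (orbitProj h').comp (orbitProj h) = orbitProj (h.trans h') :=
  orbit_hom_ext (by
    change orbitProj h' (orbitProj h (base J)) = _
    rw [orbitProj_base, orbitProj_base, orbitProj_base])

/-- This translates between the two descriptions of proper contributions, by proper subgroups of `L`
and by non-bijective maps to `G/L`: if the subgroup found by `exists_factorization` were `L` itself,
`u` would be a bijection. -/
theorem exists_factorization_lt {J L : Subgroup G} (u : orbit J →[G] orbit L)
    (hu : ¬ Function.Bijective u) :
    ∃ (L' : Subgroup G) (h : L' < L) (v : orbit J →[G] orbit L'),
      Function.Bijective v ∧ (orbitProj h.le).comp v = u := by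
  obtain ⟨L', h, v, hv, e⟩ := exists_factorization u
  refine ⟨L', lt_of_le_of_ne h ?_, v, hv, e⟩
  rintro rfl
  rw [orbitProj_self] at e
  exact hu (e ▸ hv)

theorem not_bijective_orbitProj {K H : Subgroup G} (h : K < H) :
    ¬ Function.Bijective (orbitProj h.le) := fun hb => by
  refine h.not_ge fun a ha => ?_
  have h1 : orbitProj h.le (a • base K) = orbitProj h.le ((1 : G) • base K) := by
    rw [map_smul, map_smul, orbitProj_base, one_smul, smul_base_of_mem ha]
  have := smul_base_eq.1 (hb.1 h1)
  simpa using this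

/-- By transitivity a section would be surjective, and the projection would then be injective. This
makes sums over sections vanish on everything induced from a proper subgroup. -/
theorem orbitProj_comp_ne_id {K H : Subgroup G} (h : K < H) (s : orbit H →[G] orbit K) :
    (orbitProj h.le).comp s ≠ MulActionHom.id G := fun e => by
  refine not_bijective_orbitProj h ⟨fun a b hab => ?_, surjective_of_orbit _⟩
  obtain ⟨a, rfl⟩ := surjective_of_orbit s a
  obtain ⟨b, rfl⟩ := surjective_of_orbit s b
  have hab' : (orbitProj h.le).comp s a = (orbitProj h.le).comp s b := hab
  rw [e] at hab'
  exact congrArg s hab'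

theorem exists_orbitConj {H : Subgroup G} (t : orbit H →[G] orbit H) :
    ∃ g : Subgroup.normalizer (H : Set G), orbitConj H g = t := by
  obtain ⟨a, ha⟩ := exists_smul_base (t (base H))
  obtain ⟨v, hv, hv', -⟩ := exists_inverse t (bijective_endo t)
  have h1 := conj_mem_of_hom t ha
  -- The inverse `v` sends the base point to `a⁻¹H`. Together `t` and `v` give both inclusions
  -- between `H` and its conjugate, so `a` normalizes `H`.
  have h2 := conj_mem_of_hom v (a := a⁻¹) (by
    have h3 : v (t (base H)) = base H := DFunLike.congr_fun hv' (base H)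
    rw [← ha, map_smul] at h3
    rw [inv_smul_eq_iff, h3])
  refine ⟨⟨a, Subgroup.mem_normalizer_iff.2 fun k => ⟨fun hk => ?_, fun hk => ?_⟩⟩,
    orbit_hom_ext ((orbitConj_base _ _).trans ha)⟩
  · simpa using h2 k hk
  · have := h1 _ hk
    simpa [mul_assoc] using this

/-- The Weyl group of `H` is in bijection with the endomorphisms of `G/H`. -/
def weylEquiv (H : Subgroup G) : Weyl H ≃ (orbit H →[G] orbit H) :=
  Equiv.ofBijective
    (Quotient.lift (orbitConj H) fun a b hab => orbit_hom_ext (by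
      have h : a⁻¹ * b ∈ H.subgroupOf (Subgroup.normalizer (H : Set G)) :=
        QuotientGroup.leftRel_apply.1 hab
      rw [orbitConj_base, orbitConj_base, smul_base_eq]
      exact h))
    ⟨fun a b => by
      induction a using QuotientGroup.induction_on with
      | H a =>
        induction b using QuotientGroup.induction_on with
        | H b =>
          intro hab
          refine QuotientGroup.eq.2 ?_
          have h : orbitConj H a (base H) = orbitConj H b (base H) :=
            congrArg (fun t : orbit H →[G] orbit H => t (base H)) hab
          rw [orbitConj_base, orbitConj_base, smul_base_eq] at h
          exact h,
    fun t => by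
      obtain ⟨g, rfl⟩ := exists_orbitConj t
      exact ⟨QuotientGroup.mk g, rfl⟩⟩

theorem weylEquiv_mk {H : Subgroup G} (g : Subgroup.normalizer (H : Set G)) :
    weylEquiv H (QuotientGroup.mk g) = orbitConj H g := rfl

theorem weylEquiv_one (H : Subgroup G) : weylEquiv H 1 = MulActionHom.id G := orbitConj_one H

/-- Endomorphisms of `G/H` are right translations, so the order of composition is reversed.
Contravariance of restriction reverses it again, which yields the left action on Brauer quotients.
-/
theorem weylEquiv_mul {H : Subgroup G} (a b : Weyl H) :
    weylEquiv H (a * b) = (weylEquiv H b).comp (weylEquiv H a) := by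
  induction a using QuotientGroup.induction_on with
  | H a =>
    induction b using QuotientGroup.induction_on with
    | H b => exact orbitConj_mul H a b

/-- The number of endomorphisms of `G/H` over `X` divides the order of `G`. -/
theorem card_endo_over_dvd {H : Subgroup G} {X : FinGSet G} (x : orbit H →[G] X) :
    (Finset.univ.filter fun t : orbit H →[G] orbit H => x.comp t = x).card ∣ Nat.card G := by
  -- The endomorphisms over `X` form a subgroup of the Weyl group, so Lagrange's theorem applies.
  -- The divisibility is what makes these counts invertible together with `|G|`.
  let S : Subgroup (Weyl H) :=
    { carrier := {w | x.comp (weylEquiv H w) = x}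
      one_mem' := by
        change x.comp (weylEquiv H 1) = x
        rw [weylEquiv_one]; rfl
      mul_mem' := fun {a b} ha hb => by
        change x.comp (weylEquiv H (a * b)) = x
        rw [weylEquiv_mul, ← comp_assoc, hb, ha]
      inv_mem' := fun {a} ha => by
        change x.comp (weylEquiv H a⁻¹) = x
        conv_lhs => rw [← show x.comp (weylEquiv H a) = x from ha, comp_assoc, ← weylEquiv_mul,
          inv_mul_cancel, weylEquiv_one]
        rfl }
  have h : (Finset.univ.filter fun t : orbit H →[G] orbit H => x.comp t = x).card = Nat.card S := by
    rw [← Fintype.card_subtype, ← Nat.card_eq_fintype_card]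
    exact (Nat.card_congr ((weylEquiv H).subtypeEquiv fun w => Iff.rfl)).symm
  rw [h]
  refine (Subgroup.card_subgroup_dvd_card S).trans ((Subgroup.card_quotient_dvd_card _).trans ?_)
  exact Subgroup.card_subgroup_dvd_card _

theorem card_endo_dvd (H : Subgroup G) :
    (Finset.univ : Finset (orbit H →[G] orbit H)).card ∣ Nat.card G := by
  rw [Finset.card_univ, ← Nat.card_eq_fintype_card, ← Nat.card_congr (weylEquiv H)]
  exact (Subgroup.card_quotient_dvd_card _).trans (Subgroup.card_subgroup_dvd_card _)

/-- A finite `G`-set is a disjoint union of orbits. -/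
theorem exists_orbit_decomposition (P : FinGSet G) :
    ∃ (ι : Type u) (_ : Fintype ι) (L : ι → Subgroup G) (u : ∀ i, orbit (L i) →[G] P),
      (∀ i, Function.Injective (u i)) ∧ (∀ i j a b, u i a = u j b → i = j) ∧
        ∀ p, ∃ i a, u i a = p := by
  let y (i : MulAction.orbitRel.Quotient G P) : P := Quotient.out i
  let L (i : MulAction.orbitRel.Quotient G P) : Subgroup G := MulAction.stabilizer G (y i)
  let u (i : MulAction.orbitRel.Quotient G P) : orbit (L i) →[G] P :=
    point (L i) (y i) fun _ hk => hk
  have hu (i) (a : G) : u i (a • base (L i)) = a • y i := by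
    rw [map_smul]
    exact congrArg (a • ·) (point_base (L i) (y i) fun _ hk => hk)
  refine ⟨MulAction.orbitRel.Quotient G P, Fintype.ofFinite _, L, u, ?_, ?_, ?_⟩
  · intro i a b hab
    obtain ⟨a, rfl⟩ := exists_smul_base a
    obtain ⟨b, rfl⟩ := exists_smul_base b
    rw [hu, hu] at hab
    rw [smul_base_eq, MulAction.mem_stabilizer_iff, mul_smul, ← hab, inv_smul_smul]
  · intro i j a b hab
    obtain ⟨a, rfl⟩ := exists_smul_base a
    obtain ⟨b, rfl⟩ := exists_smul_base b
    rw [hu, hu] at hab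
    rw [← Quotient.out_eq i, ← Quotient.out_eq j]
    refine Quotient.sound (s := MulAction.orbitRel G P) ⟨a⁻¹ * b, ?_⟩
    change (a⁻¹ * b) • y j = y i
    rw [mul_smul, ← hab, inv_smul_smul]
  · intro p
    obtain ⟨g, hg⟩ : p ∈ MulAction.orbit G (y (Quotient.mk _ p)) :=
      (MulAction.orbitRel G P).symm (Quotient.mk_out (s := MulAction.orbitRel G P) p)
    exact ⟨Quotient.mk _ p, g • base _, (hu _ g).trans hg⟩

/-- The complement of the orbit of a point. -/
def orbitCompl {P : FinGSet G} (y : P) : FinGSet G where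
  carrier := {p : P // p ∉ MulAction.orbit G y}
  action :=
    { smul := fun a p => ⟨a • p.1, fun h => p.2 (by
        obtain ⟨b, hb⟩ := h
        exact ⟨a⁻¹ * b, by
          change (a⁻¹ * b) • y = p.1
          rw [mul_smul, inv_smul_eq_iff]
          exact hb⟩)⟩
      one_smul := fun p => Subtype.ext (one_smul G p.1)
      mul_smul := fun a b p => Subtype.ext (mul_smul a b p.1) }

end FinGSet

/-! ### Decomposition of inductions to orbits -/

namespace MackeyModule

variable {G : Type u} [Group G] {R : CommGreenFunctor G} (M : MackeyModule R)

theorem res_injective_of_bijective {X Y : FinGSet G} (e : X →[G] Y) (he : Function.Bijective e) :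
    Function.Injective (M.res e) := fun a b h => by
  rw [← ind_res_of_bijective M e he a, h, ind_res_of_bijective M e he]

/-- Restriction along a section of a bijection is induction along the bijection. -/
theorem ind_eq_res {X Y : FinGSet G} (e : X →[G] Y) (v : Y →[G] X)
    (h : e.comp v = MulActionHom.id G)
    (hv : Function.Bijective v) (m : M.obj X) : M.ind e m = M.res v m := by
  conv_lhs => rw [← ind_res_of_bijective M v hv m]
  rw [← M.ind_comp, h, M.ind_id]

theorem res_ind_of_injective {X Y : FinGSet G} (f : X →[G] Y) (hf : Function.Injective f)
    (m : M.obj X) : M.res f (M.ind f m) = m := by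
  rw [M.base_change (isPullbackSq_inj f hf), M.res_id, M.ind_id]

theorem res_ind_of_disjoint {X X' Y : FinGSet G} (f : X →[G] Y) (g : X' →[G] Y)
    (h : ∀ a b, f a ≠ g b) (m : M.obj X) : M.res g (M.ind f m) = 0 := by
  have : IsEmpty (pullback f g) := ⟨fun z => h _ _ z.2⟩
  have := M.isMackey.subsingleton (pullback f g)
  rw [M.base_change (pullback_isPullbackSq f g), Subsingleton.elim (M.res _ m) 0, map_zero]

variable [Finite G]

/-- An element is determined by its restrictions to orbits. -/
theorem eq_zero_of_res_orbit {P : FinGSet G} (z : M.obj P)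
    (h : ∀ (L : Subgroup G) (u : orbit L →[G] P), M.res u z = 0) : z = 0 := by
  -- Induction on the cardinality: `P` is the disjoint union of the orbit of a point `y` and a
  -- smaller `G`-set, and additivity detects `z` on the two pieces.
  induction hn : Nat.card P using Nat.strong_induction_on generalizing P with
  | _ n ih =>
    subst hn
    rcases isEmpty_or_nonempty P with hP | ⟨⟨y⟩⟩
    · exact (M.isMackey.subsingleton P).elim _ _
    let A := orbit (MulAction.stabilizer G y)
    let u : A →[G] P := point _ y fun _ hk => hk
    have hu (a : G) : u (a • base _) = a • y := by
      rw [map_smul]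
      exact congrArg (a • ·) (point_base (MulAction.stabilizer G y) y fun _ hk => hk)
    let j : orbitCompl y →[G] P := ⟨Subtype.val, fun _ _ => rfl⟩
    let e : A.sum (orbitCompl y) →[G] P :=
      { toFun := Sum.elim u j
        map_smul' := fun a z => by
          rcases z with z | z
          · exact map_smul u a z
          · exact map_smul j a z }
    have hmem (a : A) : u a ∈ MulAction.orbit G y := by
      obtain ⟨a, rfl⟩ := exists_smul_base a
      exact ⟨a, (hu a).symm⟩
    have he : Function.Bijective e := by
      constructor
      · rintro (a | a) (b | b) hab
        · replace hab : u a = u b := hab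
          obtain ⟨a, rfl⟩ := exists_smul_base a
          obtain ⟨b, rfl⟩ := exists_smul_base b
          rw [hu, hu] at hab
          refine congrArg Sum.inl ?_
          rw [smul_base_eq, MulAction.mem_stabilizer_iff, mul_smul, ← hab, inv_smul_smul]
        · exact (b.2 ((show u a = b.1 from hab) ▸ hmem a)).elim
        · exact (a.2 ((show a.1 = u b from hab) ▸ hmem b)).elim
        · exact congrArg Sum.inr (Subtype.ext hab)
      · intro p
        by_cases hp : p ∈ MulAction.orbit G y
        · obtain ⟨a, ha⟩ := hp
          exact ⟨Sum.inl (a • base (MulAction.stabilizer G y)), (hu a).trans ha⟩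
        · exact ⟨Sum.inr ⟨p, hp⟩, rfl⟩
    apply M.res_injective_of_bijective e he
    apply (M.isMackey.additive A (orbitCompl y)).1
    refine Prod.ext ?_ ?_
    · simp only [map_zero, ← M.res_comp]
      exact h _ u
    · simp only [map_zero, ← M.res_comp]
      change M.res j z = 0
      refine ih (Nat.card (orbitCompl y)) ?_ _ (fun L v => ?_) rfl
      · have h1 : Function.Injective j := Subtype.val_injective
        refine lt_of_le_of_ne (Nat.card_le_card_of_injective j h1) fun hc => ?_
        obtain ⟨p, hp⟩ := (Function.Injective.bijective_of_nat_card_le h1 hc.ge).2 y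
        refine p.2 ?_
        rw [show p.1 = y from hp]
        exact MulAction.mem_orbit_self y
      · rw [← M.res_comp]
        exact h L _

/-- It suffices to compare restrictions to orbits. A map from an orbit to `P` lands in the image of
a single `u j`; there the summand `j` restricts to `z` by injectivity, and the other summands
restrict to zero by disjointness. -/
theorem sum_ind_res {P : FinGSet G} {ι : Type u} [Fintype ι] {L : ι → Subgroup G}
    (u : ∀ i, orbit (L i) →[G] P) (h₁ : ∀ i, Function.Injective (u i))
    (h₂ : ∀ i j a b, u i a = u j b → i = j) (h₃ : ∀ p, ∃ i a, u i a = p) (z : M.obj P) :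
    ∑ i, M.ind (u i) (M.res (u i) z) = z := by
  refine sub_eq_zero.1 (M.eq_zero_of_res_orbit _ fun K w => ?_)
  obtain ⟨j, a, ha⟩ := h₃ (w (base K))
  obtain ⟨v, rfl⟩ : ∃ v : orbit K →[G] orbit (L j), (u j).comp v = w := by
    refine exists_lift (u j) (h₁ j) w fun y => ?_
    obtain ⟨γ, rfl⟩ := exists_smul_base y
    exact ⟨γ • a, by rw [map_smul, map_smul, ha]⟩
  rw [M.res_comp, map_sub, map_sum, Finset.sum_eq_single j, M.res_ind_of_injective _ (h₁ j),
    sub_self, map_zero]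
  · exact fun i _ hij => M.res_ind_of_disjoint _ _ (fun a b hab => hij (h₂ _ _ _ _ hab)) _
  · simp

/-- Modulo the contributions of the orbits that do not map isomorphically to `G/H`, induction along
`q : P → G/H` is the sum of the restrictions along all sections of `q`. -/
theorem ind_sub_sum_sections_mem {P : FinGSet G} {H : Subgroup G} (q : P →[G] orbit H)
    (z : M.obj P) (B : AddSubgroup (M.obj (orbit H)))
    (hB : ∀ (L : Subgroup G) (u : orbit L →[G] P), ¬ Function.Bijective (q.comp u) →
      M.ind (q.comp u) (M.res u z) ∈ B) :
    M.ind q z - ∑ t : orbit H →[G] P with q.comp t = MulActionHom.id G, M.res t z ∈ B := by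
  classical
  obtain ⟨ι, _, L, u, h₁, h₂, h₃⟩ := exists_orbit_decomposition P
  -- The orbits mapped bijectively to `G/H` correspond to the sections of `q`, the orbit `u i`
  -- giving the section `u i ∘ (q ∘ u i)⁻¹`. Induction along a bijection is restriction along its
  -- inverse, so the terms agree.
  have key : ∑ i with Function.Bijective (q.comp (u i)), M.ind (q.comp (u i)) (M.res (u i) z) =
      ∑ t : orbit H →[G] P with q.comp t = MulActionHom.id G, M.res t z := by
    have hv (i) (hi : Function.Bijective (q.comp (u i))) := exists_inverse (q.comp (u i)) hi
    choose v hv hv' hvb using hv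
    refine Finset.sum_bij (fun i hi => (u i).comp (v i (Finset.mem_filter.1 hi).2)) ?_ ?_ ?_ ?_
    · exact fun i hi => Finset.mem_filter.2 ⟨Finset.mem_univ _, hv i _⟩
    · exact fun i hi j hj hij => h₂ _ _ _ _ (DFunLike.congr_fun hij (base H))
    · intro t ht
      replace ht := (Finset.mem_filter.1 ht).2
      obtain ⟨j, a, ha⟩ := h₃ (t (base H))
      obtain ⟨w, rfl⟩ : ∃ w : orbit H →[G] orbit (L j), (u j).comp w = t := by
        refine exists_lift (u j) (h₁ j) t fun y => ?_
        obtain ⟨γ, rfl⟩ := exists_smul_base y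
        exact ⟨γ • a, by rw [map_smul, map_smul, ha]⟩
      have hw : Function.Surjective w := surjective_of_orbit w
      -- The section `t` factors as `u j ∘ w` with `w` surjective, and `q ∘ u j ∘ w` is the
      -- identity; hence `q ∘ u j` is injective.
      have hj : Function.Bijective (q.comp (u j)) := by
        refine ⟨fun a b hab => ?_, surjective_of_orbit _⟩
        obtain ⟨a, rfl⟩ := hw a
        obtain ⟨b, rfl⟩ := hw b
        have hab' : q.comp ((u j).comp w) a = q.comp ((u j).comp w) b := hab
        rw [ht] at hab'
        exact congrArg w hab'
      refine ⟨j, Finset.mem_filter.2 ⟨Finset.mem_univ _, hj⟩, ?_⟩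
      rw [comp_left_cancel hj.1 ((hv j hj).trans ht.symm)]
    · intro i hi
      rw [M.res_comp]
      exact M.ind_eq_res _ _ (hv i _) (hvb i _) _
  have hz : M.ind q z = ∑ i, M.ind (q.comp (u i)) (M.res (u i) z) := by
    conv_lhs => rw [← M.sum_ind_res u h₁ h₂ h₃ z, map_sum]
    simp only [← M.ind_comp]
  rw [← key, hz, ← Finset.sum_filter_add_sum_filter_not Finset.univ
    (fun i => Function.Bijective (q.comp (u i))), add_sub_cancel_left]
  exact B.sum_mem fun i hi => hB _ _ (Finset.mem_filter.1 hi).2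

/-- The base change formula to an orbit: modulo the contributions of proper suborbits, the
restriction along `y` of an element induced along `f` is a sum over the lifts of `y`. -/
theorem res_ind_sub_sum_lifts_mem {X Y : FinGSet G} {H : Subgroup G} (f : X →[G] Y)
    (y : orbit H →[G] Y) (m : M.obj X) (B : AddSubgroup (M.obj (orbit H)))
    (hB : ∀ (L : Subgroup G) (u : orbit L →[G] X) (v : orbit L →[G] orbit H),
      f.comp u = y.comp v → ¬ Function.Bijective v → M.ind v (M.res u m) ∈ B) :
    M.res y (M.ind f m) - ∑ t : orbit H →[G] X with f.comp t = y, M.res t m ∈ B := by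
  have h := pullback_isPullbackSq f y
  -- By the universal property of the pullback, lifts of `y` through `f` are the same as sections of
  -- the projection from the pullback to `G/H`.
  have key : ∑ t : orbit H →[G] X with f.comp t = y, M.res t m =
      ∑ t : orbit H →[G] pullback f y with (pbSnd f y).comp t = MulActionHom.id G,
        M.res t (M.res (pbFst f y) m) := by
    refine (Finset.sum_bij (fun t _ => (pbFst f y).comp t) ?_ ?_ ?_ ?_).symm
    · intro t ht
      rw [Finset.mem_filter] at ht ⊢
      refine ⟨Finset.mem_univ _, ?_⟩
      rw [← comp_assoc, h.comm, comp_assoc, ht.2]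
      rfl
    · intro t ht t' ht' e
      exact (h.existsUnique_lift ((pbFst f y).comp t) ((pbSnd f y).comp t)
        (by rw [← comp_assoc, ← comp_assoc, h.comm])).unique ⟨rfl, rfl⟩
        ⟨e.symm, (Finset.mem_filter.1 ht').2.trans (Finset.mem_filter.1 ht).2.symm⟩
    · intro s hs
      obtain ⟨t, ⟨ht, ht'⟩, -⟩ := h.existsUnique_lift s (MulActionHom.id G)
        (Finset.mem_filter.1 hs).2
      exact ⟨t, Finset.mem_filter.2 ⟨Finset.mem_univ _, ht'⟩, ht⟩
    · intro t _
      rw [M.res_comp]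
  rw [M.base_change h, key]
  refine M.ind_sub_sum_sections_mem _ _ B fun L u hu => ?_
  rw [← M.res_comp]
  refine hB L _ _ ?_ hu
  rw [← comp_assoc, ← comp_assoc, h.comm]

/-- `brauerSub` is defined by the projections from proper subgroups only, but every non-bijective
map between orbits factors through one of these. -/
theorem ind_mem_brauerSub {L H : Subgroup G} (u : orbit L →[G] orbit H)
    (hu : ¬ Function.Bijective u) (m : M.obj (orbit L)) : M.ind u m ∈ M.brauerSub H := by
  obtain ⟨K, hK, v, -, rfl⟩ := exists_factorization_lt u hu
  rw [M.ind_comp]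
  exact (le_iSup₂ (f := fun K (h : K < H) => M.indRange (orbitProj h.le)) K hK) ⟨_, rfl⟩

/-! ### Classes in the Brauer quotient and the mark formula -/

variable {M}

theorem br_eq_zero {H : Subgroup G} {m : M.obj (orbit H)} :
    (br m : M.BrauerQuot H) = 0 ↔ m ∈ M.brauerSub H :=
  Submodule.Quotient.mk_eq_zero _

theorem br_eq {H : Subgroup G} {m m' : M.obj (orbit H)} :
    (br m : M.BrauerQuot H) = br m' ↔ m - m' ∈ M.brauerSub H :=
  Submodule.Quotient.eq _

variable (M) in
/-- The class in the Brauer quotient as an additive map. -/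
def brHom (H : Subgroup G) : M.obj (orbit H) →+ M.BrauerQuot H :=
  (Submodule.mkQ (M.brauerSub H)).toAddMonoidHom

theorem br_add {H : Subgroup G} (m m' : M.obj (orbit H)) :
    (br (m + m') : M.BrauerQuot H) = br m + br m' := rfl

theorem br_zero {H : Subgroup G} : (br (0 : M.obj (orbit H)) : M.BrauerQuot H) = 0 := rfl

theorem br_sum {H : Subgroup G} {ι : Type*} (s : Finset ι) (f : ι → M.obj (orbit H)) :
    (br (∑ i ∈ s, f i) : M.BrauerQuot H) = ∑ i ∈ s, br (f i) := map_sum (M.brHom H) f s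

/-- In the Brauer quotient, induction along `q : P → G/H` is the sum over the sections of `q`. -/
theorem br_ind {P : FinGSet G} {H : Subgroup G} (q : P →[G] orbit H) (z : M.obj P) :
    (br (M.ind q z) : M.BrauerQuot H) =
      ∑ t : orbit H →[G] P with q.comp t = MulActionHom.id G, br (M.res t z) := by
  rw [← br_sum, br_eq]
  exact M.ind_sub_sum_sections_mem q z (M.brauerSub H).toAddSubgroup
    fun L u hu => M.ind_mem_brauerSub _ hu _

/-- The mark formula for an induced element. -/
theorem br_res_ind {X Y : FinGSet G} {H : Subgroup G} (f : X →[G] Y) (y : orbit H →[G] Y)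
    (m : M.obj X) : (br (M.res y (M.ind f m)) : M.BrauerQuot H) =
      ∑ t : orbit H →[G] X with f.comp t = y, br (M.res t m) := by
  rw [← br_sum, br_eq]
  exact M.res_ind_sub_sum_lifts_mem f y m (M.brauerSub H).toAddSubgroup
    fun L u v _ hv => M.ind_mem_brauerSub v hv _

theorem brauerSub_induction {H : Subgroup G} {p : M.obj (orbit H) → Prop} {m : M.obj (orbit H)}
    (hm : m ∈ M.brauerSub H) (zero : p 0) (add : ∀ a b, p a → p b → p (a + b))
    (ind : ∀ (K : Subgroup G) (hK : K < H) (z : M.obj (orbit K)),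
      p (M.ind (orbitProj hK.le) z)) : p m := by
  induction hm using Submodule.iSup_induction' with
  | zero => exact zero
  | add x y _ _ hx hy => exact add _ _ hx hy
  | mem K x hx =>
    induction hx using Submodule.iSup_induction' with
    | zero => exact zero
    | add x y _ _ hx hy => exact add _ _ hx hy
    | mem hK x hx =>
      obtain ⟨t, rfl⟩ := hx
      exact ind K hK t

end MackeyModule

/-! ### The Brauer quotient functors are braided monoidal -/

namespace SkewMod

variable {S : Type*} [CommRing S] {W : Type*} [Group W] [MulSemiringAction W S]

theorem tensor_hom_ext {V V' U : SkewMod S W} {f g : V ⊗ V' ⟶ U}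
    (h : ∀ (x : V) (y : V'), f.lin (x ⊗ₜ[S] y) = g.lin (x ⊗ₜ[S] y)) : f = g :=
  Hom.ext (TensorProduct.ext' (M := V) (N := V') h)

theorem tensor_hom_ext₃ {V V' V'' U : SkewMod S W} {f g : (V ⊗ V') ⊗ V'' ⟶ U}
    (h : ∀ (x : V) (y : V') (z : V''),
      f.lin ((x ⊗ₜ[S] y) ⊗ₜ[S] z) = g.lin ((x ⊗ₜ[S] y) ⊗ₜ[S] z)) : f = g :=
  Hom.ext (TensorProduct.ext_threefold (M := V) (N := V') (P := V'') h)

end SkewMod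

section BrauerMonoidal

variable {G : Type u} [Group G] [Finite G] {R : CommGreenFunctor G} (M N : MackeyModule R)
  (H : Subgroup G)

/-! ### The tensor isomorphism and its inverse by sections -/

namespace MackeyModule

/-- The biadditive map `(x, y) ↦ x ⊗ y`. -/
def brTmul : M.BrauerQuot H →+ N.BrauerQuot H →+ M.BrauerQuot H ⊗[R.BrauerRing H] N.BrauerQuot H :=
  AddMonoidHom.mk' (fun x => AddMonoidHom.mk' (fun y => x ⊗ₜ y) (TensorProduct.tmul_add x))
    (fun x₁ x₂ => AddMonoidHom.ext fun y => TensorProduct.add_tmul x₁ x₂ y)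

/-- The map `(m, n) ↦ ∑ [s^* m] ⊗ [s^* n]`, the sum being over the sections `s` of `θ`. -/
def sectionPairing {Y : FinGSet G} (θ : Y →[G] orbit H) :
    M.obj Y →+ N.obj Y →+ M.BrauerQuot H ⊗[R.BrauerRing H] N.BrauerQuot H :=
  ∑ s : orbit H →[G] Y with θ.comp s = MulActionHom.id G,
    ((M.brTmul N H).comp ((M.brHom H).comp (M.res s))).compl₂ ((N.brHom H).comp (N.res s))

variable {M N H}

theorem sectionPairing_apply {Y : FinGSet G} (θ : Y →[G] orbit H) (m : M.obj Y) (n : N.obj Y) :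
    sectionPairing M N H θ m n = ∑ s : orbit H →[G] Y with θ.comp s = MulActionHom.id G,
      (br (M.res s m) : M.BrauerQuot H) ⊗ₜ[R.BrauerRing H] (br (N.res s n) : N.BrauerQuot H) := by
  rw [sectionPairing, AddMonoidHom.finsetSum_apply, AddMonoidHom.finsetSum_apply]
  rfl

/-- A section `t` of `θ ∘ f` amounts to a section `s = f ∘ t` of `θ` together with a lift of `s`
through `f`. This is the reindexing that matches the mark formula with the relations of the tensor
product. -/
theorem sum_sections_comp {A : Type*} [AddCommMonoid A] {Y Y' : FinGSet G}
    (θ : Y' →[G] orbit H) (f : Y →[G] Y') (F : (orbit H →[G] Y) → A) :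
    ∑ s : orbit H →[G] Y' with θ.comp s = MulActionHom.id G,
        ∑ t : orbit H →[G] Y with f.comp t = s, F t =
      ∑ t : orbit H →[G] Y with (θ.comp f).comp t = MulActionHom.id G, F t := by
  rw [← Finset.sum_fiberwise_of_maps_to
    (s := Finset.univ.filter fun t : orbit H →[G] Y => (θ.comp f).comp t = MulActionHom.id G)
    (t := Finset.univ.filter fun s : orbit H →[G] Y' => θ.comp s = MulActionHom.id G)
    (g := fun t => f.comp t)]
  · refine Finset.sum_congr rfl fun s hs => Finset.sum_congr ?_ fun _ _ => rfl
    ext t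
    simp only [Finset.mem_filter, Finset.mem_univ, true_and]
    refine ⟨fun h => ⟨?_, h⟩, fun h => h.2⟩
    rw [comp_assoc, h]
    exact (Finset.mem_filter.1 hs).2
  · exact fun t ht => Finset.mem_filter.2 ⟨Finset.mem_univ _, (Finset.mem_filter.1 ht).2⟩

variable (M N H) in
/-- The map `[θ, m ⊗ n] ↦ ∑ [s^* m] ⊗ [s^* n]`, the sum being over the sections `s` of `θ`. -/
def splitTensor : (tensor M N).obj (orbit H) →+
    M.BrauerQuot H ⊗[R.BrauerRing H] N.BrauerQuot H :=
  tensorLift (fun _ θ => sectionPairing M N H θ)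
    -- The mark formula expands `[s^* f_* m]` over the lifts `t` of `s` through `f`, and `t^* f^* n
    -- = s^* n` for each of them. The second relation is symmetric.
    (fun Y Y' θ f m n => by
      rw [sectionPairing_apply, sectionPairing_apply, ← sum_sections_comp]
      refine Finset.sum_congr rfl fun s _ => ?_
      rw [br_res_ind, TensorProduct.sum_tmul]
      refine Finset.sum_congr rfl fun t ht => ?_
      rw [← N.res_comp, (Finset.mem_filter.1 ht).2])
    (fun Y Y' θ f m n => by
      rw [sectionPairing_apply, sectionPairing_apply, ← sum_sections_comp]
      refine Finset.sum_congr rfl fun s _ => ?_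
      rw [br_res_ind, TensorProduct.tmul_sum]
      refine Finset.sum_congr rfl fun t ht => ?_
      rw [← M.res_comp, (Finset.mem_filter.1 ht).2])
    (fun Y θ r m n => by
      rw [sectionPairing_apply, sectionPairing_apply]
      refine Finset.sum_congr rfl fun s _ => ?_
      rw [M.res_smul, N.res_smul, ← brRing_smul_br, ← brRing_smul_br, TensorProduct.smul_tmul])

theorem splitTensor_ind_pure {Y : FinGSet G} (θ : Y →[G] orbit H) (m : M.obj Y) (n : N.obj Y) :
    splitTensor M N H ((tensor M N).ind θ (pure m n)) =
      ∑ s : orbit H →[G] Y with θ.comp s = MulActionHom.id G,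
        (br (M.res s m) : M.BrauerQuot H) ⊗ₜ[R.BrauerRing H] (br (N.res s n) : N.BrauerQuot H) := by
  rw [ind_pure, ← sectionPairing_apply]
  exact tensorLift_gen _ _ _ _ θ m n

/-- After induction from `K < H` every index `θ` factors through the projection `G/K → G/H`. Such a
map has no section, so the defining sum is empty. -/
theorem splitTensor_of_mem {t : (tensor M N).obj (orbit H)}
    (ht : t ∈ (tensor M N).brauerSub H) : splitTensor M N H t = 0 := by
  refine brauerSub_induction (p := fun t => splitTensor M N H t = 0) ht (map_zero _)
    (fun x y hx hy => by rw [map_add, hx, hy, add_zero]) fun K hK t => ?_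
  induction t using tensor_induction with
  | zero => rw [map_zero, map_zero]
  | add a b ha hb => rw [map_add, map_add, ha, hb, add_zero]
  | ind Y θ m n =>
    rw [← (tensor M N).ind_comp, splitTensor_ind_pure]
    exact Finset.sum_eq_zero fun s hs =>
      (orbitProj_comp_ne_id hK (θ.comp s) (Finset.mem_filter.1 hs).2).elim

variable (M N H)

/-- The bilinear map `(m, n) ↦ [m ⊗ n]`. -/
def brPure : M.obj (orbit H) →ₗ[R.obj (orbit H)] N.obj (orbit H) →ₗ[R.obj (orbit H)]
    (tensor M N).BrauerQuot H :=
  LinearMap.mk₂ _ (fun m n => br (pure m n))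
    (fun m m' n => congrArg br (pure_add_left m m' n))
    (fun r m n => congrArg br (smul_pure r m n).symm)
    (fun m n n' => congrArg br (pure_add_right m n n'))
    (fun r m n => congrArg br (pure_smul r m n))

/-- The relation `p_* z ⊗ n = p_* (z ⊗ p^* n)` shows that a tensor with a properly induced factor is
itself properly induced. -/
theorem brPure_left {m : M.obj (orbit H)} (hm : m ∈ M.brauerSub H) : brPure M N H m = 0 := by
  have : M.brauerSub H ≤ LinearMap.ker (brPure M N H) := by
    refine iSup₂_le fun K hK => ?_
    rintro _ ⟨z, rfl⟩
    refine LinearMap.ext fun n => br_eq_zero.2 ?_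
    rw [pure_ind_left]
    exact ind_mem_brauerSub _ _ (not_bijective_orbitProj hK) _
  exact this hm

theorem brPure_right {n : N.obj (orbit H)} (hn : n ∈ N.brauerSub H) :
    (brPure M N H).flip n = 0 := by
  have : N.brauerSub H ≤ LinearMap.ker (brPure M N H).flip := by
    refine iSup₂_le fun K hK => ?_
    rintro _ ⟨z, rfl⟩
    refine LinearMap.ext fun m => br_eq_zero.2 ?_
    rw [pure_ind_right]
    exact ind_mem_brauerSub _ _ (not_bijective_orbitProj hK) _
  exact this hn

/-- The bilinear map `([m], [n]) ↦ [m ⊗ n]`, over `R(H)`. -/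
def brPairing : M.BrauerQuot H →ₗ[R.obj (orbit H)] N.BrauerQuot H →ₗ[R.obj (orbit H)]
    (tensor M N).BrauerQuot H :=
  LinearMap.flip ((N.brauerSub H).liftQ
    (LinearMap.flip ((M.brauerSub H).liftQ (brPure M N H) fun _ hm => brPure_left M N H hm))
    fun n hn => LinearMap.ext fun x => by
      obtain ⟨m, rfl⟩ := Submodule.Quotient.mk_surjective _ x
      exact LinearMap.congr_fun (brPure_right M N H hn) m)

/-- The linear map `[m] ⊗ [n] ↦ [m ⊗ n]`. -/
def brauerMu : M.BrauerQuot H ⊗[R.BrauerRing H] N.BrauerQuot H →ₗ[R.BrauerRing H]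
    (tensor M N).BrauerQuot H :=
  TensorProduct.lift (LinearMap.mk₂ _ (fun x y => brPairing M N H x y)
    (fun x x' y => by rw [map_add]; rfl)
    (fun s x y => by
      obtain ⟨r, rfl⟩ := Ideal.Quotient.mk_surjective s
      exact LinearMap.congr_fun (map_smul (brPairing M N H) r x) y)
    (fun x y y' => map_add _ y y')
    (fun s x y => by
      obtain ⟨r, rfl⟩ := Ideal.Quotient.mk_surjective s
      exact map_smul (brPairing M N H x) r y))

theorem brauerMu_br (m : M.obj (orbit H)) (n : N.obj (orbit H)) :
    brauerMu M N H ((br m : M.BrauerQuot H) ⊗ₜ[R.BrauerRing H] (br n : N.BrauerQuot H)) =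
      br (pure m n) := rfl

/-- The inverse of `brauerMu`. -/
def brauerSplit : (tensor M N).BrauerQuot H →+
    M.BrauerQuot H ⊗[R.BrauerRing H] N.BrauerQuot H :=
  QuotientAddGroup.lift ((tensor M N).brauerSub H).toAddSubgroup (splitTensor M N H)
    fun _ ht => splitTensor_of_mem ht

theorem brauerSplit_br (t : (tensor M N).obj (orbit H)) :
    brauerSplit M N H (br t) = splitTensor M N H t := rfl

theorem brauerSplit_mu (t : M.BrauerQuot H ⊗[R.BrauerRing H] N.BrauerQuot H) :
    brauerSplit M N H (brauerMu M N H t) = t := by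
  induction t using TensorProduct.induction_on with
  | zero => simp only [map_zero]
  | add a b ha hb => simp only [map_add, ha, hb]
  | tmul x y =>
    obtain ⟨m, rfl⟩ := CommGreenFunctor.br_surjective R H x
    obtain ⟨n, rfl⟩ := CommGreenFunctor.br_surjective R H y
    -- The pure tensor is indexed by the identity of `G/H`, whose only section is the identity.
    rw [brauerMu_br, brauerSplit_br, ← (tensor M N).ind_id (pure m n), splitTensor_ind_pure]
    have h : MulActionHom.id G ∈ Finset.univ.filter fun s : orbit H →[G] orbit H =>
        (MulActionHom.id G).comp s = MulActionHom.id G :=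
      Finset.mem_filter.2 ⟨Finset.mem_univ _, rfl⟩
    refine (Finset.sum_eq_single_of_mem _ h
      fun s hs hne => (hne (Finset.mem_filter.1 hs).2).elim).trans ?_
    rw [M.res_id, N.res_id]

/-- By `br_ind`, the class of `θ_* (m ⊗ n)` is already the sum of the classes of `s^* m ⊗ s^* n`
over the sections `s` of `θ`. -/
theorem brauerMu_split (x : (tensor M N).BrauerQuot H) :
    brauerMu M N H (brauerSplit M N H x) = x := by
  obtain ⟨t, rfl⟩ := CommGreenFunctor.br_surjective R H x
  rw [brauerSplit_br]
  induction t using tensor_induction with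
  | zero => simp only [map_zero]; rfl
  | add a b ha hb => simp only [map_add, ha, hb, br_add]
  | ind Y θ m n =>
    rw [splitTensor_ind_pure, map_sum, br_ind]
    exact Finset.sum_congr rfl fun s _ => by rw [brauerMu_br, res_pure]

/-- The isomorphism `[m] ⊗ [n] ↦ [m ⊗ n]` of the Brauer quotients. -/
def brauerMuEquiv : M.BrauerQuot H ⊗[R.BrauerRing H] N.BrauerQuot H ≃ₗ[R.BrauerRing H]
    (tensor M N).BrauerQuot H :=
  { brauerMu M N H with
    invFun := brauerSplit M N H
    left_inv := brauerSplit_mu M N H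
    right_inv := brauerMu_split M N H }

end MackeyModule

/-! ### Coherence of the tensor isomorphisms -/

namespace CommGreenFunctor

variable (R)

/-- The unit isomorphism of `Br_H`: the identity of the Brauer quotient ring. -/
def brauerUnitIso : 𝟙_ (SkewMod (R.BrauerRing H) (Weyl H)) ≅
    (R.brauer H).obj (𝟙_ (MackeyModule R)) :=
  SkewMod.isoMk (V := SkewMod.unit) (V' := (R.brauer H).obj R.self)
    -- The Brauer quotient ring and the Brauer quotient of `R` as a module over itself are the same
    -- quotient, by the same ideal, so the identity serves in both directions.
    { toFun := fun x => (x : R.obj (orbit H) ⧸ R.brauerIdeal H)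
      invFun := fun x => (x : R.obj (orbit H) ⧸ R.self.brauerSub H)
      map_add' := fun _ _ => rfl
      map_smul' := fun s x => by
        obtain ⟨r, rfl⟩ := Ideal.Quotient.mk_surjective s
        obtain ⟨m, rfl⟩ := Ideal.Quotient.mk_surjective x
        rfl
      left_inv := fun _ => rfl
      right_inv := fun _ => rfl }
    (fun w x => by
      induction w using QuotientGroup.induction_on with
      | H g =>
        obtain ⟨m, rfl⟩ := Ideal.Quotient.mk_surjective x
        rfl)

/-- The tensor isomorphism of `Br_H`. -/
def brauerTensorIso : (R.brauer H).obj M ⊗ (R.brauer H).obj N ≅ (R.brauer H).obj (M ⊗ N) :=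
  SkewMod.isoMk (V := ((R.brauer H).obj M).tensor ((R.brauer H).obj N))
    (V' := (R.brauer H).obj (tensor M N)) (brauerMuEquiv M N H)
    (SkewMod.equivariant_of_tmul (U := (R.brauer H).obj (tensor M N))
      (V := (R.brauer H).obj M) (V' := (R.brauer H).obj N) (brauerMuEquiv M N H).toLinearMap
      fun w x y => by
        induction w using QuotientGroup.induction_on with
        | H g =>
          obtain ⟨m, rfl⟩ := br_surjective R H x
          obtain ⟨n, rfl⟩ := br_surjective R H y
          exact congrArg br (res_pure (orbitConj H g) m n).symm)

variable {M N}

/-- The monoidal structure of `Br_H`. -/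
def brauerCore : (R.brauer H).CoreMonoidal where
  εIso := R.brauerUnitIso H
  μIso M N := R.brauerTensorIso M N H
  -- Each coherence condition is tested on tensors of classes, where it is the image under `br` of
  -- the formula for the corresponding structure map of Mackey modules on pure tensors.
  μIso_hom_natural_left f N := SkewMod.tensor_hom_ext fun x y => by
    obtain ⟨m, rfl⟩ := br_surjective R H x
    obtain ⟨n, rfl⟩ := br_surjective R H y
    exact congrArg br (tensorMap_pure f (𝟙 N) m n).symm
  μIso_hom_natural_right M f := SkewMod.tensor_hom_ext fun x y => by
    obtain ⟨m, rfl⟩ := br_surjective R H x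
    obtain ⟨n, rfl⟩ := br_surjective R H y
    exact congrArg br (tensorMap_pure (𝟙 M) f m n).symm
  associativity M N P := SkewMod.tensor_hom_ext₃ fun x y z => by
    obtain ⟨m, rfl⟩ := br_surjective R H x
    obtain ⟨n, rfl⟩ := br_surjective R H y
    obtain ⟨p, rfl⟩ := br_surjective R H z
    exact congrArg br (assocHom_pure m n p)
  left_unitality M := SkewMod.tensor_hom_ext fun x y => by
    obtain ⟨r, rfl⟩ := Ideal.Quotient.mk_surjective x
    obtain ⟨m, rfl⟩ := br_surjective R H y
    exact congrArg br (lunit_pure r m).symm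
  right_unitality M := SkewMod.tensor_hom_ext fun x y => by
    obtain ⟨r, rfl⟩ := Ideal.Quotient.mk_surjective y
    obtain ⟨m, rfl⟩ := br_surjective R H x
    exact congrArg br (runit_pure r m).symm

/-- The braided monoidal structure of `Br_H`. -/
instance brauerBraided : (R.brauer H).Braided where
  toMonoidal := (R.brauerCore H).toMonoidal
  braided M N := SkewMod.tensor_hom_ext fun x y => by
    obtain ⟨m, rfl⟩ := br_surjective R H x
    obtain ⟨n, rfl⟩ := br_surjective R H y
    exact congrArg br (swap_pure m n)

end CommGreenFunctor

end BrauerMonoidal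

/-! ### Functors to a product of monoidal categories -/

section Pi

universe v₁ v₂ u₁ u₂ w₁

variable {I : Type w₁} {C : Type u₁} [Category.{v₁} C] [MonoidalCategory C]
  {D : I → Type u₂} [∀ i, Category.{v₂} (D i)] [∀ i, MonoidalCategory (D i)]

open Functor.LaxMonoidal in
/-- A functor to a product with monoidal components is monoidal. -/
@[reducible]
def monoidalPi (F : ∀ i, C ⥤ D i) [∀ i, (F i).Monoidal] : (Functor.pi' F).Monoidal :=
  Functor.CoreMonoidal.toMonoidal
    { εIso := Pi.isoMk fun i => Functor.Monoidal.εIso (F i)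
      μIso := fun X Y => Pi.isoMk fun i => Functor.Monoidal.μIso (F i) X Y
      μIso_hom_natural_left := fun f X' => funext fun i => μ_natural_left (F i) f X'
      μIso_hom_natural_right := fun X' f => funext fun i => μ_natural_right (F i) X' f
      associativity := fun X Y Z => funext fun i => associativity (F i) X Y Z
      left_unitality := fun X => funext fun i => left_unitality (F i) X
      right_unitality := fun X => funext fun i => right_unitality (F i) X }

/-- A functor to a product with braided components is braided. -/
@[reducible]
def braidedPi {C : Type u₁} [Category.{v₁} C] [MonoidalCategory C] [SymmetricCategory C]
    {D : I → Type u₂} [∀ i, Category.{v₂} (D i)] [∀ i, MonoidalCategory (D i)]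
    [∀ i, SymmetricCategory (D i)] (F : ∀ i, C ⥤ D i) [∀ i, (F i).Braided] :
    (Functor.pi' F).Braided where
  toMonoidal := monoidalPi F
  braided X Y := funext fun i => Functor.LaxBraided.braided (F := F i) X Y

end Pi

/-! ### Marks, when the order of `G` is invertible -/

namespace FinGSet

variable {G : Type u} [Group G] [Finite G]

theorem eq_map_conj_of_bijective {H K : Subgroup G} (t : orbit H →[G] orbit K)
    (ht : Function.Bijective t) : ∃ g : G, H = K.map (MulAut.conj g).toMonoidHom := by
  obtain ⟨a, ha⟩ := exists_smul_base (t (base H))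
  obtain ⟨v, -, hv, -⟩ := exists_inverse t ht
  have h1 := conj_mem_of_hom t ha
  have h2 := conj_mem_of_hom v (a := a⁻¹) (by
    have h3 : v (t (base H)) = base H := DFunLike.congr_fun hv (base H)
    rw [← ha, map_smul] at h3
    rw [inv_smul_eq_iff, h3])
  refine ⟨a, le_antisymm (fun k hk => ⟨a⁻¹ * k * a, h1 k hk, by simp [mul_assoc]⟩) ?_⟩
  rintro _ ⟨k, hk, rfl⟩
  simpa using h2 k hk

theorem exists_bijective_of_conj {H K : Subgroup G} {g : G}
    (h : H = K.map (MulAut.conj g).toMonoidHom) :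
    ∃ t : orbit H →[G] orbit K, Function.Bijective t := by
  subst h
  refine ⟨orbitMap _ K g ?_, ?_⟩
  · rintro _ ⟨k, hk, rfl⟩
    simpa [mul_assoc] using hk
  · refine ⟨fun x y hxy => ?_, surjective_of_orbit _⟩
    obtain ⟨b, rfl⟩ := exists_smul_base x
    obtain ⟨c, rfl⟩ := exists_smul_base y
    erw [map_smul, map_smul, orbitMap_base] at hxy
    rw [smul_smul, smul_smul, smul_base_eq] at hxy
    exact smul_base_eq.2 ⟨_, hxy, by simp [mul_assoc]⟩

theorem _root_.IsConjReps.eq_of_bijective {T : Set (Subgroup G)} (hT : IsConjReps T)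
    {H K : Subgroup G} (hH : H ∈ T) (hK : K ∈ T) (t : orbit H →[G] orbit K)
    (ht : Function.Bijective t) : H = K :=
  (hT K).unique ⟨hH, eq_map_conj_of_bijective t ht⟩
    ⟨hK, 1, by rw [map_one]; exact (Subgroup.map_id K).symm⟩

theorem _root_.IsConjReps.exists_bijective {T : Set (Subgroup G)} (hT : IsConjReps T)
    (K : Subgroup G) : ∃ H ∈ T, ∃ t : orbit H →[G] orbit K, Function.Bijective t := by
  obtain ⟨H, ⟨hH, g, hg⟩, -⟩ := hT K
  exact ⟨H, hH, exists_bijective_of_conj hg⟩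

end FinGSet

/-! ### The operators `p_* p^*` and their corrections `1 - n⁻¹ p_* p^*` -/

namespace MackeyModule

variable {G : Type u} [Group G] {A : CommGreenFunctor G}

section

variable (M : MackeyModule A)

/-- The endomorphism `M_*(p) M^*(p)`. -/
def indRes {X Y : FinGSet G} (p : X →[G] Y) : M.obj Y →ₗ[A.obj Y] M.obj Y where
  toFun m := M.ind p (M.res p m)
  map_add' a b := by rw [map_add, map_add]
  map_smul' r a := by rw [M.res_smul, M.ind_res_smul]; rfl

theorem indRes_apply {X Y : FinGSet G} (p : X →[G] Y) (m : M.obj Y) :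
    M.indRes p m = M.ind p (M.res p m) := rfl

/-- Base change moves the operator to the source of `f`. Hence it preserves the image of every
induction; dually, `res_indRes` says that it preserves the kernel of every restriction. -/
theorem indRes_ind {X X' Y : FinGSet G} (p : X →[G] Y) (f : X' →[G] Y) (z : M.obj X') :
    M.indRes p (M.ind f z) = M.ind f (M.indRes (pbFst f p) z) := by
  have h := pullback_isPullbackSq f p
  rw [indRes_apply, indRes_apply, M.base_change h, ← M.ind_comp, ← M.ind_comp, h.comm]

theorem res_indRes {X X' Y : FinGSet G} (p : X →[G] Y) (f : X' →[G] Y) {m : M.obj Y}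
    (h : M.res f m = 0) : M.res f (M.indRes p m) = 0 := by
  have hp := pullback_isPullbackSq p f
  rw [indRes_apply, M.base_change hp, ← M.res_comp, hp.comm, M.res_comp, h, map_zero, map_zero]

end

variable [Finite G] {M : MackeyModule A} {K L : Subgroup G}

/-- Modulo elements induced from below `L`, `p^* p_* z` is the sum of `t^* z` over the endomorphisms
`t` of `G/L` with `p ∘ t = p`. Applying `p_* = p_* t_*` turns each term into `p_* z`, because `t_*
t^* = 1`. -/
theorem indRes_ind_self (p : orbit L →[G] orbit K) (z : M.obj (orbit L)) :
    ∃ b ∈ M.brauerSub L, M.indRes p (M.ind p z) =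
      ((Finset.univ.filter fun t : orbit L →[G] orbit L => p.comp t = p).card : A.obj (orbit K)) •
        M.ind p z + M.ind p b := by
  refine ⟨_, M.res_ind_sub_sum_lifts_mem p p z (M.brauerSub L).toAddSubgroup
    fun J u v _ hv => M.ind_mem_brauerSub v hv _, ?_⟩
  rw [map_sub, indRes_apply, Nat.cast_smul_eq_nsmul, map_sum, ← Finset.sum_const,
    ← sub_eq_iff_eq_add',
    sub_right_inj]
  refine Finset.sum_congr rfl fun t ht => ?_
  conv_rhs => rw [← (Finset.mem_filter.1 ht).2]
  rw [M.ind_comp, ind_res_of_bijective M t (bijective_endo t)]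

theorem res_indRes_self (p : orbit L →[G] orbit K) (m : M.obj (orbit K))
    (h : ∀ (J : Subgroup G) (v : orbit J →[G] orbit L), ¬ Function.Bijective v →
      M.res (p.comp v) m = 0) :
    M.res p (M.indRes p m) =
      (Finset.univ.filter fun t : orbit L →[G] orbit L => p.comp t = p).card • M.res p m := by
  -- The error group is taken to be zero: the hypothesis kills the contributions of all proper
  -- suborbits, so the formula holds exactly and not only in the Brauer quotient.
  have := M.res_ind_sub_sum_lifts_mem p p (M.res p m) ⊥ fun J u v huv hv => by
    rw [← M.res_comp, huv, h J v hv, map_zero]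
    exact zero_mem _
  rw [AddSubgroup.mem_bot, sub_eq_zero] at this
  rw [indRes_apply, this, ← Finset.sum_const]
  refine Finset.sum_congr rfl fun t ht => ?_
  rw [← M.res_comp, (Finset.mem_filter.1 ht).2]

variable (M) in
/-- The operator `1 - n⁻¹ M_*(p) M^*(p)`, where `n` is the number of endomorphisms of `G/L` over
`G/K`. -/
def corr (p : orbit L →[G] orbit K) : M.obj (orbit K) →ₗ[A.obj (orbit K)] M.obj (orbit K) :=
  -- `Ring.inverse` is zero on non-units, so the operator is defined without assumptions; it is a
  -- genuine inverse as soon as `|G|` is a unit.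
  LinearMap.id - Ring.inverse
    ((Finset.univ.filter fun t : orbit L →[G] orbit L => p.comp t = p).card : A.obj (orbit K)) •
      M.indRes p

theorem corr_apply (p : orbit L →[G] orbit K) (m : M.obj (orbit K)) :
    M.corr p m = m - Ring.inverse
    ((Finset.univ.filter fun t : orbit L →[G] orbit L => p.comp t = p).card : A.obj (orbit K)) •
      M.indRes p m := rfl

theorem corr_ind_mem (p : orbit L →[G] orbit K) {X : FinGSet G} (f : X →[G] orbit K)
    (z : M.obj X) : M.corr p (M.ind f z) ∈ M.indRange f := by
  rw [corr_apply, indRes_ind]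
  exact Submodule.sub_mem _ ⟨_, rfl⟩ (Submodule.smul_mem _ _ ⟨_, rfl⟩)

theorem corr_sub_mem (p : orbit L →[G] orbit K) (m : M.obj (orbit K)) :
    M.corr p m - m ∈ M.indRange p := by
  rw [corr_apply, sub_sub_cancel_left]
  exact Submodule.neg_mem _ (Submodule.smul_mem _ _ ⟨_, rfl⟩)

theorem corr_of_res_eq_zero (p : orbit L →[G] orbit K) {m : M.obj (orbit K)}
    (h : M.res p m = 0) : M.corr p m = m := by
  rw [corr_apply, indRes_apply, h, map_zero, smul_zero, sub_zero]

theorem res_corr (p : orbit L →[G] orbit K) {X : FinGSet G} (f : X →[G] orbit K)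
    {m : M.obj (orbit K)} (h : M.res f m = 0) : M.res f (M.corr p m) = 0 := by
  rw [corr_apply, map_sub, M.res_smul, M.res_indRes p f h, h, smul_zero, sub_zero]

theorem isUnit_card_endo {X : FinGSet G} (hA : IsUnit (Nat.card G : A.obj X))
    (p : orbit L →[G] orbit K) :
    IsUnit ((Finset.univ.filter fun t : orbit L →[G] orbit L => p.comp t = p).card : A.obj X) :=
  isUnit_of_dvd_unit (Nat.cast_dvd_cast (card_endo_over_dvd p)) hA

/-- On `p_* z` the operator `n⁻¹ p_* p^*` is the identity up to a term induced from below `L`. Thus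
`corr p` pushes the contribution of `L` to smaller subgroups. -/
theorem corr_ind_self (hA : IsUnit (Nat.card G : A.obj (orbit K))) (p : orbit L →[G] orbit K)
    (z : M.obj (orbit L)) : ∃ b ∈ M.brauerSub L, M.corr p (M.ind p z) = M.ind p b := by
  obtain ⟨b, hb, e⟩ := indRes_ind_self p z
  refine ⟨_, (M.brauerSub L).neg_mem ((M.brauerSub L).smul_mem (A.res p (Ring.inverse
    ((Finset.univ.filter fun t : orbit L →[G] orbit L => p.comp t = p).card :
      A.obj (orbit K)))) hb), ?_⟩
  rw [corr_apply, e, smul_add, smul_smul, Ring.inverse_mul_cancel _ (isUnit_card_endo hA p),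
    one_smul, map_neg, M.ind_res_smul]
  abel

/-- Dual to `corr_ind_self`: if `m` vanishes on everything strictly below `L`, then `p^* p_* p^* m =
n p^* m`, and the correction cancels the restriction to `L`. -/
theorem res_corr_self (hA : IsUnit (Nat.card G : A.obj (orbit K))) (p : orbit L →[G] orbit K)
    (m : M.obj (orbit K))
    (h : ∀ (J : Subgroup G) (v : orbit J →[G] orbit L), ¬ Function.Bijective v →
      M.res (p.comp v) m = 0) : M.res p (M.corr p m) = 0 := by
  rw [corr_apply, map_sub, M.res_smul, res_indRes_self p m h,
    ← Nat.cast_smul_eq_nsmul (A.obj (orbit L)),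
    smul_smul, ← map_natCast (A.res p), ← map_mul,
    Ring.inverse_mul_cancel _ (isUnit_card_endo hA p), map_one, one_smul, sub_self]

end MackeyModule

/-! ### Treating the proper subgroups of `K` one at a time -/

section DownSet

variable {G : Type u} [Group G]

/-- A set of proper subgroups of `K` that is closed under passing to smaller subgroups. -/
structure IsProperDownSet (K : Subgroup G) (S : Finset (Subgroup G)) : Prop where
  lt : ∀ L ∈ S, L < K
  mem : ∀ L ∈ S, ∀ J, J < L → J ∈ S

open scoped Classical in
theorem IsProperDownSet.erase {K L : Subgroup G} {S : Finset (Subgroup G)}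
    (hS : IsProperDownSet K S) (hL : Maximal (· ∈ S) L) : IsProperDownSet K (S.erase L) where
  lt J hJ := hS.lt J (Finset.mem_of_mem_erase hJ)
  mem J hJ I hI := Finset.mem_erase.2 ⟨by
    rintro rfl
    exact hL.not_gt (Finset.mem_of_mem_erase hJ) hI, hS.mem J (Finset.mem_of_mem_erase hJ) I hI⟩

end DownSet

namespace MackeyModule

variable {G : Type u} [Group G] [Finite G] {A : CommGreenFunctor G} {M : MackeyModule A}

variable (M) in
/-- The sum of the images of the inductions from the members of `S` to `K`. -/
def indSpan (K : Subgroup G) (S : Finset (Subgroup G)) :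
    Submodule (A.obj (orbit K)) (M.obj (orbit K)) :=
  ⨆ (L : Subgroup G) (h : L < K) (_ : L ∈ S), M.indRange (orbitProj h.le)

theorem indRange_le_indSpan {K L : Subgroup G} {S : Finset (Subgroup G)} (h : L < K) (hL : L ∈ S) :
    M.indRange (orbitProj h.le) ≤ M.indSpan K S :=
  le_iSup_of_le L (le_iSup_of_le h (le_iSup_of_le hL le_rfl))

theorem res_comp_eq_zero {K L : Subgroup G} (h : L < K) {S : Finset (Subgroup G)}
    (hL : ∀ J, J < L → J ∈ S) {m : M.obj (orbit K)}
    (hm : ∀ (J : Subgroup G) (hJ : J < K), J ∈ S → M.res (orbitProj hJ.le) m = 0)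
    (J : Subgroup G) (v : orbit J →[G] orbit L) (hv : ¬ Function.Bijective v) :
    M.res ((orbitProj h.le).comp v) m = 0 := by
  obtain ⟨I, hI, w, -, rfl⟩ := exists_factorization_lt v hv
  rw [← comp_assoc, orbitProj_comp, M.res_comp, hm I (hI.trans h) (hL I hI), map_zero]

/-- For a maximal `L` in `S`, the operator `corr` attached to `L` fixes `m`, because `m` restricts
to zero on `L`. It also replaces contributions from `L` by contributions from smaller subgroups,
which belong to `S`, and keeps those from the other members where they are. So `L` can be removed
from `S`, until nothing is left. -/
theorem eq_zero_of_mem_indSpan {K : Subgroup G} (hA : IsUnit (Nat.card G : A.obj (orbit K)))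
    {S : Finset (Subgroup G)} (hS : IsProperDownSet K S) {m : M.obj (orbit K)}
    (hm : m ∈ M.indSpan K S)
    (h : ∀ (L : Subgroup G) (hL : L < K), M.res (orbitProj hL.le) m = 0) : m = 0 := by
  classical
  induction hn : S.card generalizing S with
  | zero =>
    obtain rfl := Finset.card_eq_zero.1 hn
    simpa [indSpan] using hm
  | succ n ih =>
    obtain ⟨L, hL⟩ := S.exists_maximal (Finset.card_pos.1 (by omega))
    have hLK := hS.lt L hL.prop
    refine ih (hS.erase hL) ?_ (by rw [Finset.card_erase_of_mem hL.prop, hn, Nat.add_sub_cancel])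
    rw [← corr_of_res_eq_zero (orbitProj hLK.le) (h L hLK)]
    have hle : M.indSpan K S ≤ (M.indSpan K (S.erase L)).comap (M.corr (orbitProj hLK.le)) := by
      refine iSup_le fun J => iSup_le fun hJ => iSup_le fun hJS => ?_
      rintro _ ⟨z, rfl⟩
      by_cases e : J = L
      · subst e
        obtain ⟨b, hb, hb'⟩ := corr_ind_self hA (orbitProj hJ.le) z
        rw [Submodule.mem_comap, hb']
        refine brauerSub_induction
          (p := fun b => M.ind (orbitProj hJ.le) b ∈ M.indSpan K (S.erase J)) hb
          (by rw [map_zero]; exact zero_mem _)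
          (fun x y hx hy => by rw [map_add]; exact add_mem hx hy) fun I hI z => ?_
        rw [← M.ind_comp, orbitProj_comp]
        exact indRange_le_indSpan (hI.trans hJ)
          (Finset.mem_erase.2 ⟨hI.ne, hS.mem J hJS I hI⟩) ⟨z, rfl⟩
      · exact indRange_le_indSpan hJ (Finset.mem_erase.2 ⟨e, hJS⟩) (corr_ind_mem _ _ z)
    exact hle hm

/-- Once the restrictions to `S` without a maximal member `L` are zero, the operator `corr` attached
to `L` also kills the restriction to `L`. It keeps the earlier restrictions zero and changes the
element only by something induced from `L`. -/
theorem exists_res_eq_zero {K : Subgroup G} (hA : IsUnit (Nat.card G : A.obj (orbit K)))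
    {S : Finset (Subgroup G)} (hS : IsProperDownSet K S) (m : M.obj (orbit K)) :
    ∃ m', m' - m ∈ M.brauerSub K ∧
      ∀ (L : Subgroup G) (hL : L < K), L ∈ S → M.res (orbitProj hL.le) m' = 0 := by
  classical
  induction hn : S.card generalizing S with
  | zero =>
    obtain rfl := Finset.card_eq_zero.1 hn
    exact ⟨m, by rw [sub_self]; exact zero_mem _, fun L _ hL => (Finset.notMem_empty L hL).elim⟩
  | succ n ih =>
    obtain ⟨L, hL⟩ := S.exists_maximal (Finset.card_pos.1 (by omega))
    have hLK := hS.lt L hL.prop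
    obtain ⟨m', hm', h⟩ := ih (hS.erase hL)
      (by rw [Finset.card_erase_of_mem hL.prop, hn, Nat.add_sub_cancel])
    refine ⟨M.corr (orbitProj hLK.le) m', ?_, fun J hJ hJS => ?_⟩
    · rw [← sub_add_sub_cancel _ m']
      exact add_mem ((le_iSup₂ (f := fun K' (h : K' < K) => M.indRange (orbitProj h.le)) L hLK)
        (corr_sub_mem _ _)) hm'
    · by_cases e : J = L
      · subst e
        exact res_corr_self hA _ m' (res_comp_eq_zero hJ
          (fun I hI => Finset.mem_erase.2 ⟨hI.ne, hS.mem J hJS I hI⟩) h)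
      · exact res_corr _ _ (h J hJ (Finset.mem_erase.2 ⟨e, hJS⟩))

open scoped Classical in
/-- The finite set of proper subgroups of `K`. -/
def properSubgroups (K : Subgroup G) : Finset (Subgroup G) :=
  (Set.toFinite {L : Subgroup G | L < K}).toFinset

theorem mem_properSubgroups {K L : Subgroup G} : L ∈ properSubgroups K ↔ L < K := by
  simp [properSubgroups]

theorem isProperDownSet_properSubgroups (K : Subgroup G) :
    IsProperDownSet K (properSubgroups K) where
  lt _ h := mem_properSubgroups.1 h
  mem _ h _ hJ := mem_properSubgroups.2 (hJ.trans (mem_properSubgroups.1 h))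

theorem eq_zero_of_mem_brauerSub {K : Subgroup G} (hA : IsUnit (Nat.card G : A.obj (orbit K)))
    {m : M.obj (orbit K)} (hm : m ∈ M.brauerSub K)
    (h : ∀ (L : Subgroup G) (hL : L < K), M.res (orbitProj hL.le) m = 0) : m = 0 := by
  refine eq_zero_of_mem_indSpan hA (isProperDownSet_properSubgroups K) ?_ h
  have hle : M.brauerSub K ≤ M.indSpan K (properSubgroups K) :=
    iSup₂_le fun L hL => indRange_le_indSpan hL (mem_properSubgroups.2 hL)
  exact hle hm

/-- When the order of `G` is invertible, every class in the Brauer quotient has a representative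
that restricts to zero along all maps which are not bijective. -/
theorem exists_primitive_lift {K : Subgroup G} (hA : IsUnit (Nat.card G : A.obj (orbit K)))
    (m : M.obj (orbit K)) : ∃ m', m' - m ∈ M.brauerSub K ∧
      ∀ (L : Subgroup G) (v : orbit L →[G] orbit K), ¬ Function.Bijective v → M.res v m' = 0 := by
  obtain ⟨m', h, h'⟩ := exists_res_eq_zero hA (isProperDownSet_properSubgroups K) m
  refine ⟨m', h, fun L v hv => ?_⟩
  obtain ⟨J, hJ, w, -, rfl⟩ := exists_factorization_lt v hv
  rw [M.res_comp, h' J hJ (mem_properSubgroups.2 hJ), map_zero]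

/-- Here `m = v_* v^* m`, and a proper projection followed by the bijection `v` is still not
bijective. It transports vanishing of a Brauer class from a chosen representative to any conjugate
subgroup. -/
theorem mem_brauerSub_of_res {H K : Subgroup G} (v : orbit H →[G] orbit K)
    (hv : Function.Bijective v) {m : M.obj (orbit K)} (h : M.res v m ∈ M.brauerSub H) :
    m ∈ M.brauerSub K := by
  rw [← ind_res_of_bijective M v hv m]
  refine brauerSub_induction (p := fun b => M.ind v b ∈ M.brauerSub K) h
    (by rw [map_zero]; exact zero_mem _)
    (fun x y hx hy => by rw [map_add]; exact add_mem hx hy) fun J hJ z => ?_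
  rw [← M.ind_comp]
  refine M.ind_mem_brauerSub _ (fun hb => not_bijective_orbitProj hJ ?_) z
  exact (Function.Bijective.of_comp_iff' hv _).1 hb

/-! ### Marks determine elements, and every equivariant family is a family of marks -/

variable {T : Set (Subgroup G)}

/-- When the order of `G` is invertible, an element with vanishing marks is zero. -/
theorem eq_zero_of_br_eq_zero (hT : IsConjReps T)
    (hA : ∀ X : FinGSet G, IsUnit (Nat.card G : A.obj X)) {X : FinGSet G} (m : M.obj X)
    (h : ∀ H ∈ T, ∀ x : orbit H →[G] X, (br (M.res x m) : M.BrauerQuot H) = 0) : m = 0 := by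
  refine M.eq_zero_of_res_orbit m fun K => ?_
  -- Induction on `K`: the restriction to `G/K` vanishes on smaller subgroups by the inductive
  -- hypothesis, and its Brauer class vanishes by the hypothesis on marks, so
  -- `eq_zero_of_mem_brauerSub` applies.
  induction K using WellFoundedLT.induction with
  | ind K ih =>
    intro u
    refine eq_zero_of_mem_brauerSub (hA _) ?_ fun L hL => ?_
    · obtain ⟨H, hH, t, ht⟩ := hT.exists_bijective K
      refine mem_brauerSub_of_res t ht ?_
      rw [← M.res_comp]
      exact br_eq_zero.1 (h H hH _)
    · rw [← M.res_comp]
      exact ih L hL _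

theorem br_res_primitive (hT : IsConjReps T) {H K : Subgroup G} (hH : H ∈ T) (hK : K ∈ T)
    (hne : H ≠ K) {m : M.obj (orbit K)} (h : ∀ (L : Subgroup G) (v : orbit L →[G] orbit K),
      ¬ Function.Bijective v → M.res v m = 0) (t : orbit H →[G] orbit K) : M.res t m = 0 :=
  h H t fun ht => hne (hT.eq_of_bijective hH hK t ht)

/-- When the order of `G` is invertible, every equivariant family is the family of marks of some
element. -/
theorem exists_br_res_eq (hT : IsConjReps T)
    (hA : ∀ X : FinGSet G, IsUnit (Nat.card G : A.obj X)) {X : FinGSet G}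
    (φ : ∀ H : T, (orbit H.1 →[G] X) → M.BrauerQuot H.1)
    (hφ : ∀ (H : T) (x : orbit H.1 →[G] X) (g : Subgroup.normalizer (H.1 : Set G)),
      φ H (x.comp (orbitConj H.1 g)) = (QuotientGroup.mk g : Weyl H.1) • φ H x) :
    ∃ m : M.obj X, ∀ (H : T) (x : orbit H.1 →[G] X), br (M.res x m) = φ H x := by
  classical
  have : Fintype T := Fintype.ofFinite _
  have hl (H : T) (x : orbit H.1 →[G] X) : ∃ m : M.obj (orbit H.1), br m = φ H x ∧
      ∀ (L : Subgroup G) (v : orbit L →[G] orbit H.1), ¬ Function.Bijective v → M.res v m = 0 := by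
    obtain ⟨m, hm⟩ := CommGreenFunctor.br_surjective A H.1 (φ H x)
    obtain ⟨m', h, h'⟩ := exists_primitive_lift (hA _) m
    exact ⟨m', by rw [← hm, br_eq]; exact h, h'⟩
  choose l hl hl' using hl
  let N (H : T) : ℕ := (Finset.univ : Finset (orbit H.1 →[G] orbit H.1)).card
  have hN (H : T) (Y : FinGSet G) : IsUnit (N H : A.obj Y) :=
    isUnit_of_dvd_unit (Nat.cast_dvd_cast (card_endo_dvd H.1)) (hA Y)
  -- Induce the primitive lifts along all points. The mark at `y : G/H → X` receives one copy of `φ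
  -- H y` from each endomorphism of `G/H`, hence the division by their number `N H`.
  refine ⟨∑ H : T, Ring.inverse (N H : A.obj X) • ∑ x : orbit H.1 →[G] X, M.ind x (l H x),
    fun H y => ?_⟩
  rw [map_sum, br_sum, Finset.sum_eq_single H]
  · have h1 : (br (M.res y (∑ x : orbit H.1 →[G] X, M.ind x (l H x))) : M.BrauerQuot H.1) =
        (N H : A.obj (orbit H.1)) • φ H y := by
      rw [map_sum, br_sum]
      simp only [br_res_ind, Finset.sum_filter]
      rw [Finset.sum_comm, Nat.cast_smul_eq_nsmul, ← Finset.sum_const]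
      refine Finset.sum_congr rfl fun t _ => ?_
      obtain ⟨v, hv, hv', -⟩ := exists_inverse t (bijective_endo t)
      -- For a fixed endomorphism `t` with inverse `v`, the only point `x` with `x ∘ t = y` is `y ∘
      -- v`; equivariance turns its contribution into `φ H y`.
      rw [Finset.sum_eq_single (y.comp v)]
      · rw [if_pos (by rw [comp_assoc, hv']; rfl)]
        obtain ⟨g, rfl⟩ := exists_orbitConj t
        rw [← weyl_smul_br, hl, ← hφ, comp_assoc, hv']
        rfl
      · intro x _ hx
        refine if_neg ?_
        rintro rfl
        exact hx (by rw [comp_assoc, hv]; rfl)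
      · simp
    rw [M.res_smul]
    change A.res y _ • (br (M.res y _) : M.BrauerQuot H.1) = _
    rw [h1, smul_smul, ← map_natCast (A.res y), ← map_mul, Ring.inverse_mul_cancel _ (hN H X),
      map_one, one_smul]
  -- For another representative `K` no map `G/H → G/K` is bijective, so the primitive lifts at `K`
  -- contribute nothing to the marks at `H`.
  · intro K _ hK
    rw [M.res_smul]
    change A.res y _ • (br (M.res y _) : M.BrauerQuot H.1) = _
    rw [map_sum, br_sum, Finset.sum_eq_zero, smul_zero]
    intro x _
    rw [br_res_ind]
    refine Finset.sum_eq_zero fun t _ => ?_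
    rw [br_res_primitive hT H.2 K.2 (fun e => hK (Subtype.ext e.symm)) (hl' K x) t, br_zero]
  · simp

end MackeyModule

/-! ### Mackey modules of equivariant families -/

section Families

variable {G : Type u} [Group G] [Finite G] {A : CommGreenFunctor G} {T : Set (Subgroup G)}

theorem CommGreenFunctor.brRing_res_ind {X Y : FinGSet G} {H : Subgroup G} (f : X →[G] Y)
    (y : orbit H →[G] Y) (r : A.obj X) : A.brRing (A.res y (A.ind f r)) =
      ∑ t : orbit H →[G] X with f.comp t = y, A.brRing (A.res t r) :=
  br_res_ind (M := A.self) f y r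

variable (V : ∀ H : T, SkewMod (A.BrauerRing H.1) (Weyl H.1))

/-- The families of elements `φ(x)`, for `x : G/H → X`, that are equivariant under the Weyl
groups. -/
def markFamilies (X : FinGSet G) : AddSubgroup (∀ H : T, (orbit H.1 →[G] X) → V H) where
  carrier := {φ | ∀ (H : T) (x : orbit H.1 →[G] X) (g : Subgroup.normalizer (H.1 : Set G)),
    φ H (x.comp (orbitConj H.1 g)) = (QuotientGroup.mk g : Weyl H.1) • φ H x}
  add_mem' {φ ψ} hφ hψ H x g := by
    simp only [Pi.add_apply, hφ H x g, hψ H x g, smul_add]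
  zero_mem' H x g := (smul_zero _).symm
  neg_mem' {φ} hφ H x g := by
    simp only [Pi.neg_apply, hφ H x g, smul_neg]

variable {V}

theorem markFamilies_apply {X : FinGSet G} (φ : markFamilies V X) (H : T) (x : orbit H.1 →[G] X)
    (g : Subgroup.normalizer (H.1 : Set G)) :
    φ.1 H (x.comp (orbitConj H.1 g)) = (QuotientGroup.mk g : Weyl H.1) • φ.1 H x := φ.2 H x g

theorem markFamilies_ext {X : FinGSet G} {φ ψ : markFamilies V X}
    (h : ∀ H x, φ.1 H x = ψ.1 H x) : φ = ψ :=
  Subtype.ext (funext fun H => funext fun x => h H x)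

instance (X : FinGSet G) : Module (A.obj X) (markFamilies V X) where
  smul r φ := ⟨fun H x => A.brRing (A.res x r) • φ.1 H x, fun H x g => by
    change A.brRing (A.res (x.comp (orbitConj H.1 g)) r) • φ.1 H (x.comp (orbitConj H.1 g)) =
      (QuotientGroup.mk g : Weyl H.1) • A.brRing (A.res x r) • φ.1 H x
    rw [markFamilies_apply, A.res_comp, (V H).act_smul, A.weyl_smul_brRing]⟩
  one_smul φ := markFamilies_ext fun H x => by
    change A.brRing (A.res x 1) • φ.1 H x = _
    rw [map_one, map_one, one_smul]
  mul_smul r s φ := markFamilies_ext fun H x => by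
    change A.brRing (A.res x (r * s)) • φ.1 H x =
      A.brRing (A.res x r) • A.brRing (A.res x s) • φ.1 H x
    rw [map_mul, map_mul, mul_smul]
  smul_zero r := markFamilies_ext fun H x => smul_zero (A.brRing (A.res x r))
  smul_add r φ ψ := markFamilies_ext fun H x => smul_add (A.brRing (A.res x r)) _ _
  add_smul r s φ := markFamilies_ext fun H x => by
    change A.brRing (A.res x (r + s)) • φ.1 H x =
      A.brRing (A.res x r) • φ.1 H x + A.brRing (A.res x s) • φ.1 H x
    rw [map_add, map_add, add_smul]
  zero_smul φ := markFamilies_ext fun H x => by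
    change A.brRing (A.res x 0) • φ.1 H x = 0
    rw [map_zero, map_zero, zero_smul]

theorem markFamilies_smul {X : FinGSet G} (r : A.obj X) (φ : markFamilies V X) (H : T)
    (x : orbit H.1 →[G] X) : (r • φ).1 H x = A.brRing (A.res x r) • φ.1 H x := rfl

variable (V)

/-- Restriction of families: composition with `f`. -/
def markRes {X Y : FinGSet G} (f : X →[G] Y) : markFamilies V Y →+ markFamilies V X where
  toFun φ := ⟨fun H x => φ.1 H (f.comp x), fun H x g => markFamilies_apply φ H (f.comp x) g⟩
  map_zero' := rfl
  map_add' _ _ := rfl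

/-- Induction of families: summation over the fibres of `f`. -/
def markInd {X Y : FinGSet G} (f : X →[G] Y) : markFamilies V X →+ markFamilies V Y where
  toFun φ := ⟨fun H y => ∑ x : orbit H.1 →[G] X with f.comp x = y, φ.1 H x, fun H y g => by
    rw [Finset.smul_sum]
    -- Composition with the automorphism of `G/H` given by `g` is a bijection from the lifts of `y`
    -- to the lifts of its translate, which gives equivariance of the sum.
    obtain ⟨v, hv, hv', -⟩ := exists_inverse _ (bijective_endo (orbitConj H.1 g))
    refine (Finset.sum_bij (fun x _ => x.comp (orbitConj H.1 g)) ?_ ?_ ?_ ?_).symm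
    · intro x hx
      rw [Finset.mem_filter] at hx ⊢
      exact ⟨Finset.mem_univ _, by rw [← comp_assoc, hx.2]⟩
    · intro x _ x' _ h
      exact comp_right_cancel (bijective_endo (orbitConj H.1 g)).2 h
    · intro x hx
      rw [Finset.mem_filter] at hx
      refine ⟨x.comp v, Finset.mem_filter.2 ⟨Finset.mem_univ _, ?_⟩, ?_⟩
      · rw [← comp_assoc, hx.2, comp_assoc, hv]; rfl
      · rw [comp_assoc, hv']; rfl
    · intro x _
      exact (markFamilies_apply φ H x g).symm⟩
  map_zero' := markFamilies_ext fun H y => Finset.sum_const_zero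
  map_add' φ ψ := markFamilies_ext fun H y => Finset.sum_add_distrib

variable {V}

theorem markRes_apply {X Y : FinGSet G} (f : X →[G] Y) (φ : markFamilies V Y) (H : T)
    (x : orbit H.1 →[G] X) : (markRes V f φ).1 H x = φ.1 H (f.comp x) := rfl

theorem markInd_apply {X Y : FinGSet G} (f : X →[G] Y) (φ : markFamilies V X) (H : T)
    (y : orbit H.1 →[G] Y) :
    (markInd V f φ).1 H y = ∑ x : orbit H.1 →[G] X with f.comp x = y, φ.1 H x := rfl

theorem markInd_comp {X Y : FinGSet G} (f : X →[G] Y) (hf : Function.Injective f)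
    (φ : markFamilies V X) (H : T) (x : orbit H.1 →[G] X) :
    (markInd V f φ).1 H (f.comp x) = φ.1 H x := by
  have h : x ∈ Finset.univ.filter fun x' : orbit H.1 →[G] X => f.comp x' = f.comp x :=
    Finset.mem_filter.2 ⟨Finset.mem_univ _, rfl⟩
  rw [markInd_apply, Finset.sum_eq_single_of_mem x h]
  exact fun x' hx' hne => (hne (comp_left_cancel hf (Finset.mem_filter.1 hx').2)).elim

theorem markInd_eq_zero {X Y : FinGSet G} (f : X →[G] Y) (φ : markFamilies V X) (H : T)
    (y : orbit H.1 →[G] Y) (h : ∀ x, f x ≠ y (base H.1)) : (markInd V f φ).1 H y = 0 := by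
  rw [markInd_apply]
  refine Finset.sum_eq_zero fun x hx => (h (x (base H.1)) ?_).elim
  exact DFunLike.congr_fun (Finset.mem_filter.1 hx).2 (base H.1)

/-- The axioms are those for functions on the finite sets of maps `G/H → X`, with pullback and
fibrewise summation. The functor of maps out of `G/H` preserves pullbacks, and it preserves disjoint
unions because `G/H` is a single orbit. -/
theorem markFamilies_isMackey : IsMackey (fun X => markFamilies V X) (fun _ _ f => markRes V f)
    (fun _ _ f => markInd V f) := by
  refine isMackey_of_sum_eq ?_ ?_ ?_ ?_ ?_ ?_ ?_
  · exact fun X φ => rfl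
  · exact fun X Y Z g f φ => rfl
  · exact fun X φ => markFamilies_ext fun H x =>
      markInd_comp (MulActionHom.id G) Function.injective_id φ H x
  · intro X Y Z g f φ
    refine markFamilies_ext fun H z => ?_
    simp only [markInd_apply]
    rw [← Finset.sum_fiberwise_of_maps_to (g := fun x => f.comp x)
      (t := Finset.univ.filter fun y : orbit H.1 →[G] Y => g.comp y = z)]
    · refine Finset.sum_congr rfl fun y hy => Finset.sum_congr ?_ fun _ _ => rfl
      ext x
      simp only [Finset.mem_filter, Finset.mem_univ, true_and]
      refine ⟨fun h => h.2, fun h => ⟨?_, h⟩⟩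
      rw [comp_assoc, h]
      exact (Finset.mem_filter.1 hy).2
    · exact fun x hx => Finset.mem_filter.2 ⟨Finset.mem_univ _, (Finset.mem_filter.1 hx).2⟩
  · intro P X Y Z p q f g h φ
    refine markFamilies_ext fun H y => ?_
    rw [markRes_apply, markInd_apply, markInd_apply]
    refine (Finset.sum_bij (fun z _ => p.comp z) ?_ ?_ ?_ ?_).symm
    · intro z hz
      rw [Finset.mem_filter] at hz ⊢
      exact ⟨Finset.mem_univ _, by rw [← comp_assoc, h.comm, comp_assoc, hz.2]⟩
    · intro z hz z' hz' e
      exact (h.existsUnique_lift (p.comp z) (q.comp z)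
        (by rw [← comp_assoc, ← comp_assoc, h.comm])).unique ⟨rfl, rfl⟩
        ⟨e.symm, (Finset.mem_filter.1 hz').2.trans (Finset.mem_filter.1 hz).2.symm⟩
    · intro x hx
      obtain ⟨z, ⟨hz, hz'⟩, -⟩ := h.existsUnique_lift x y (Finset.mem_filter.1 hx).2
      exact ⟨z, Finset.mem_filter.2 ⟨Finset.mem_univ _, hz'⟩, hz⟩
    · exact fun z _ => rfl
  · intro X hX
    exact ⟨fun φ ψ => markFamilies_ext fun H x => isEmptyElim (x (base H.1))⟩
  · intro X Y φ
    refine markFamilies_ext fun H x => ?_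
    change (markInd V (inl X Y) _).1 H x + (markInd V (inr X Y) _).1 H x = _
    rcases hx : x (base H.1) with a | b
    · obtain ⟨x, rfl⟩ := exists_lift (inl X Y) Sum.inl_injective x fun z => by
        obtain ⟨γ, rfl⟩ := exists_smul_base z
        exact ⟨γ • a, by rw [map_smul, map_smul, hx]; rfl⟩
      rw [markInd_comp _ Sum.inl_injective, markInd_eq_zero, add_zero, markRes_apply]
      exact fun y e => Sum.inr_ne_inl (e.trans hx)
    · obtain ⟨x, rfl⟩ := exists_lift (inr X Y) Sum.inr_injective x fun z => by
        obtain ⟨γ, rfl⟩ := exists_smul_base z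
        exact ⟨γ • b, by rw [map_smul, map_smul, hx]; rfl⟩
      rw [markInd_comp _ Sum.inr_injective, markInd_eq_zero, zero_add, markRes_apply]
      exact fun y e => Sum.inl_ne_inr (e.trans hx)

variable (V)

/-- The Mackey module of equivariant families. -/
def markModule : MackeyModule A where
  obj X := markFamilies V X
  res _ _ f := markRes V f
  ind _ _ f := markInd V f
  isMackey := markFamilies_isMackey
  res_smul X Y f r φ := markFamilies_ext fun H x => by
    rw [markRes_apply, markFamilies_smul, markFamilies_smul, markRes_apply, A.res_comp]
  ind_res_smul X Y f r φ := markFamilies_ext fun H y => by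
    rw [markFamilies_smul, markInd_apply, markInd_apply, Finset.smul_sum]
    refine Finset.sum_congr rfl fun x hx => ?_
    rw [markFamilies_smul, ← A.res_comp, (Finset.mem_filter.1 hx).2]
  -- Scalars act through their marks, so this relation is the mark formula for the Green functor
  -- itself.
  ind_smul_res X Y f r φ := markFamilies_ext fun H y => by
    rw [markFamilies_smul, markInd_apply, A.brRing_res_ind, Finset.sum_smul]
    refine Finset.sum_congr rfl fun x hx => ?_
    rw [markFamilies_smul, markRes_apply, (Finset.mem_filter.1 hx).2]

/-- Evaluation of a family at the identity of `G/H`. -/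
def markEval (H : T) : (markModule V).obj (orbit H.1) →+ V H :=
  AddMonoidHom.mk' (fun φ : markFamilies V (orbit H.1) => φ.1 H (MulActionHom.id G))
    fun _ _ => rfl

/-- A family induced from `K < H` takes at the identity a sum over sections of the projection from
`G/K`, and there are none. -/
theorem markEval_of_mem (H : T) {φ : (markModule V).obj (orbit H.1)}
    (hφ : φ ∈ (markModule V).brauerSub H.1) : markEval V H φ = 0 := by
  refine brauerSub_induction (p := fun φ => markEval V H φ = 0) hφ (map_zero _)
    (fun x y hx hy => by rw [map_add, hx, hy, add_zero]) fun K hK z => ?_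
  exact Finset.sum_eq_zero fun s hs =>
    (orbitProj_comp_ne_id hK s (Finset.mem_filter.1 hs).2).elim

/-- The map induced by `markEval` on the Brauer quotient. -/
def brauerEval (H : T) : (markModule V).BrauerQuot H.1 →+ V H :=
  QuotientAddGroup.lift ((markModule V).brauerSub H.1).toAddSubgroup (markEval V H)
    fun _ hφ => markEval_of_mem V H hφ

theorem brauerEval_smul (H : T) (s : A.BrauerRing H.1) (x : (markModule V).BrauerQuot H.1) :
    brauerEval V H (s • x) = s • brauerEval V H x := by
  obtain ⟨r, rfl⟩ := Ideal.Quotient.mk_surjective s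
  obtain ⟨φ, rfl⟩ := CommGreenFunctor.br_surjective A H.1 x
  refine (markFamilies_smul r φ H (MulActionHom.id G)).trans ?_
  rw [A.res_id]
  rfl

theorem brauerEval_act (H : T) (w : Weyl H.1) (x : (markModule V).BrauerQuot H.1) :
    brauerEval V H (w • x) = w • brauerEval V H x := by
  induction w using QuotientGroup.induction_on with
  | H g =>
    obtain ⟨φ, rfl⟩ := CommGreenFunctor.br_surjective A H.1 x
    exact markFamilies_apply φ H (MulActionHom.id G) g

/-- The endomorphisms of `G/H` correspond bijectively to the Weyl group. Hence a prescribed value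
`v` at the identity extends to an equivariant family, which is set to zero at the other
representatives. -/
theorem brauerEval_surjective (H : T) : Function.Surjective (brauerEval V H) := fun v => by
  classical
  let ψ : ∀ K : T, (orbit K.1 →[G] orbit H.1) → V K :=
    Pi.single H fun x : orbit H.1 →[G] orbit H.1 => (weylEquiv H.1).symm x • v
  have hψ : ψ H = fun x => (weylEquiv H.1).symm x • v := Pi.single_eq_same _ _
  have hmem : ψ ∈ markFamilies V (orbit H.1) := fun K x g => by
    by_cases e : K = H
    · subst e
      rw [hψ]
      have h : (weylEquiv K.1).symm (x.comp (orbitConj K.1 g)) =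
          QuotientGroup.mk g * (weylEquiv K.1).symm x := by
        rw [Equiv.symm_apply_eq, weylEquiv_mul, Equiv.apply_symm_apply, weylEquiv_mk]
      change (weylEquiv K.1).symm (x.comp (orbitConj K.1 g)) • v =
        (QuotientGroup.mk g : Weyl K.1) • (weylEquiv K.1).symm x • v
      rw [h, mul_smul]
    · have h : ψ K = 0 := Pi.single_eq_of_ne e _
      rw [h]
      exact (smul_zero _).symm
  refine ⟨br (M := markModule V) (⟨ψ, hmem⟩ : markFamilies V (orbit H.1)), ?_⟩
  change ψ H (MulActionHom.id G) = v
  rw [hψ]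
  change (weylEquiv H.1).symm (MulActionHom.id G) • v = v
  rw [(Equiv.symm_apply_eq _).2 (weylEquiv_one H.1).symm, one_smul]

variable {V}

/-- A class in the kernel is represented by a primitive family. Its values at bijective points are
translates of the value at the identity, which is zero; its values at non-bijective points are
values of restrictions that vanish by primitivity. So the representative is zero. -/
theorem brauerEval_injective (hT : IsConjReps T)
    (hA : ∀ X : FinGSet G, IsUnit (Nat.card G : A.obj X)) (H : T) :
    Function.Injective (brauerEval V H) := by
  refine (injective_iff_map_eq_zero _).2 fun x hx => ?_
  obtain ⟨φ, rfl⟩ := CommGreenFunctor.br_surjective A H.1 x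
  obtain ⟨φ', h, hres⟩ := exists_primitive_lift (hA _) φ
  rw [← br_eq] at h
  rw [← h] at hx ⊢
  suffices e : φ' = 0 by rw [e, br_zero]
  refine markFamilies_ext fun K x => ?_
  change φ'.1 K x = 0
  by_cases hb : Function.Bijective x
  · obtain rfl : K = H := Subtype.ext (hT.eq_of_bijective K.2 H.2 x hb)
    obtain ⟨g, rfl⟩ := exists_orbitConj x
    refine (markFamilies_apply φ' K (MulActionHom.id G) g).trans ?_
    rw [show φ'.1 K (MulActionHom.id G) = 0 from hx, smul_zero]
  · exact congrArg (fun ψ : markFamilies V (orbit K.1) => ψ.1 K (MulActionHom.id G))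
      (hres K.1 x hb)

/-- When the order of `G` is invertible, the Brauer quotients of `markModule V` recover `V`. -/
def brauerMarkIso (hT : IsConjReps T) (hA : ∀ X : FinGSet G, IsUnit (Nat.card G : A.obj X))
    (H : T) : (A.brauer H.1).obj (markModule V) ≅ V H :=
  SkewMod.isoMk (V := (A.brauer H.1).obj (markModule V)) (V' := V H)
    (LinearEquiv.ofBijective
      { brauerEval V H with map_smul' := brauerEval_smul V H }
      ⟨brauerEval_injective hT hA H, brauerEval_surjective V H⟩)
    (brauerEval_act V H)

/-! ### Morphisms of Mackey modules and of their Brauer quotients -/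

namespace MackeyModule

variable {M N : MackeyModule A}

theorem eq_of_br_eq (hT : IsConjReps T) (hA : ∀ X : FinGSet G, IsUnit (Nat.card G : A.obj X))
    {X : FinGSet G} {m m' : M.obj X}
    (h : ∀ (H : T) (x : orbit H.1 →[G] X), (br (M.res x m) : M.BrauerQuot H.1) = br (M.res x m')) :
    m = m' :=
  sub_eq_zero.1 (eq_zero_of_br_eq_zero hT hA _ fun H hH x => by
    rw [map_sub, br_eq_zero, ← br_eq]
    exact h ⟨H, hH⟩ x)

/-- When the order of `G` is invertible, a family of morphisms of Brauer quotients comes from a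
morphism of Mackey modules. -/
theorem exists_brauer_map_eq (hT : IsConjReps T)
    (hA : ∀ X : FinGSet G, IsUnit (Nat.card G : A.obj X))
    (h : ∀ H : T, (A.brauer H.1).obj M ⟶ (A.brauer H.1).obj N) :
    ∃ f : M ⟶ N, ∀ H : T, (A.brauer H.1).map f = h H := by
  let k (H : T) : M.BrauerQuot H.1 →ₗ[A.BrauerRing H.1] N.BrauerQuot H.1 := (h H).lin
  have hk (H : T) (w : Weyl H.1) (x : M.BrauerQuot H.1) : k H (w • x) = w • k H x :=
    (h H).map_act w x
  -- Applying the given equivariant maps to the marks of `m` gives an equivariant family in the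
  -- Brauer quotients of `N`, which is realized by an element.
  have key (X : FinGSet G) (m : M.obj X) : ∃ n : N.obj X, ∀ (H : T) (x : orbit H.1 →[G] X),
      br (N.res x n) = k H (br (M.res x m)) :=
    exists_br_res_eq hT hA (fun H x => k H (br (M.res x m))) fun H x g => by
      rw [M.res_comp, ← weyl_smul_br, hk]
  choose F hF using key
  -- That element is unique, so linearity and compatibility with restriction and induction can all
  -- be verified on marks.
  have hext {X : FinGSet G} {n n' : N.obj X} := eq_of_br_eq (m := n) (m' := n') hT hA
  refine ⟨⟨fun X => ⟨⟨F X, fun a b => hext fun H x => ?_⟩, fun r a => hext fun H x => ?_⟩,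
    fun X Y f m => hext fun H x => ?_, fun X Y f m => hext fun H y => ?_⟩, fun H => ?_⟩
  · rw [hF, map_add, map_add, br_add, br_add, map_add, hF, hF]
  · change br (N.res x (F X (r • a))) = br (N.res x (r • F X a))
    rw [hF, M.res_smul, N.res_smul, ← brRing_smul_br, ← brRing_smul_br, map_smul, hF]
  · change br (N.res x (F X (M.res f m))) = br (N.res x (N.res f (F Y m)))
    rw [hF, ← M.res_comp, ← N.res_comp, hF]
  · change br (N.res y (F Y (M.ind f m))) = br (N.res y (N.ind f (F X m)))
    rw [hF, br_res_ind, br_res_ind, map_sum]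
    exact Finset.sum_congr rfl fun t _ => (hF X m H t).symm
  · refine SkewMod.hom_ext fun x => ?_
    obtain ⟨m, rfl⟩ := CommGreenFunctor.br_surjective A H.1 x
    have := hF (orbit H.1) m H (MulActionHom.id G)
    rw [N.res_id, M.res_id] at this
    exact this

theorem hom_eq_of_brauer_map_eq (hT : IsConjReps T)
    (hA : ∀ X : FinGSet G, IsUnit (Nat.card G : A.obj X)) {f g : M ⟶ N}
    (h : ∀ (H : T) (x : M.BrauerQuot H.1),
      CommGreenFunctor.brauerMap H.1 f x = CommGreenFunctor.brauerMap H.1 g x) : f = g :=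
  hom_ext fun X m => eq_of_br_eq hT hA fun H x => by
    rw [← f.app_res, ← g.app_res]
    exact h H (br (M.res x m))

end MackeyModule

end Families

/-! ### Restriction of scalars along an isomorphism -/

namespace SkewMod

universe v w

variable {S S' : Type v} [CommRing S] [CommRing S'] {W : Type w} [Group W] [MulSemiringAction W S]
  [MulSemiringAction W S'] (φ : S' →+* S) (h : ∀ (w : W) (s : S'), φ (w • s) = w • φ s)

/-- The unit isomorphism of `restrictScalars φ`. -/
def restrictUnitIso (hφ : Function.Bijective φ) :
    𝟙_ (SkewMod S' W) ≅ (restrictScalars φ h).obj (𝟙_ (SkewMod S W)) :=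
  isoMk (V := unit) (V' := (restrictScalars φ h).obj unit)
    (LinearEquiv.ofBijective
      ({ toFun := φ
         map_add' := map_add φ
         map_smul' := map_mul φ } :
        (unit : SkewMod S' W).carrier →ₗ[S'] ((restrictScalars φ h).obj unit).carrier) hφ)
    h

section

variable (V V' : SkewMod S W)

/-- The map `x ⊗ y ↦ x ⊗ y` from the tensor product over `S'` to the tensor product over `S`. -/
def restrictTensor :
    ((restrictScalars φ h).obj V).carrier ⊗[S'] ((restrictScalars φ h).obj V').carrier →ₗ[S']
      ((restrictScalars φ h).obj (V.tensor V')).carrier :=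
  TensorProduct.lift (LinearMap.mk₂ S'
    (M := ((restrictScalars φ h).obj V).carrier) (Nₗ := ((restrictScalars φ h).obj V').carrier)
    (Pₗ := ((restrictScalars φ h).obj (V.tensor V')).carrier)
    (fun (x : V) (y : V') => (x ⊗ₜ[S] y : V ⊗[S] V'))
    (fun (x x' : V) (y : V') => TensorProduct.add_tmul x x' y)
    (fun s (x : V) (y : V') => TensorProduct.smul_tmul' (φ s) x y)
    (fun (x : V) (y y' : V') => TensorProduct.tmul_add x y y')
    (fun s (x : V) (y : V') => TensorProduct.tmul_smul (φ s) x y))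

/-- When `φ` is surjective, being balanced over `S'` and being balanced over `S` are the same
condition, so `x ⊗ y ↦ x ⊗ y` is well defined in both directions. -/
theorem restrictTensor_bijective (hφ : Function.Surjective φ) :
    Function.Bijective (restrictTensor φ h V V') := by
  let g : V ⊗[S] V' →+
      ((restrictScalars φ h).obj V).carrier ⊗[S'] ((restrictScalars φ h).obj V').carrier :=
    TensorProduct.liftAddHom
      (AddMonoidHom.mk' (fun x : V => AddMonoidHom.mk' (fun y : V' =>
          (show ((restrictScalars φ h).obj V).carrier from x) ⊗ₜ[S']
            (show ((restrictScalars φ h).obj V').carrier from y))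
          (fun y y' => TensorProduct.tmul_add _ _ _))
        (fun x x' => AddMonoidHom.ext fun y => TensorProduct.add_tmul _ _ _))
      (fun s x y => by
        obtain ⟨s, rfl⟩ := hφ s
        exact TensorProduct.smul_tmul (R := S') s
          (show ((restrictScalars φ h).obj V).carrier from x)
          (show ((restrictScalars φ h).obj V').carrier from y))
  refine ⟨Function.LeftInverse.injective (g := g) fun t => ?_,
    Function.RightInverse.surjective (g := g) fun t => ?_⟩
  · induction t using TensorProduct.induction_on with
    | zero => exact map_zero g
    | tmul x y => rfl
    | add a b ha hb =>
      rw [map_add]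
      refine (map_add g _ _).trans ?_
      rw [ha, hb]
  · induction t using TensorProduct.induction_on with
    | zero => rw [map_zero]; exact map_zero (restrictTensor φ h V V')
    | tmul x y => rfl
    | add a b ha hb =>
      rw [map_add]
      refine (map_add (restrictTensor φ h V V') _ _).trans ?_
      rw [ha, hb]
      rfl

/-- The tensor isomorphism of `restrictScalars φ`. -/
def restrictTensorIso (hφ : Function.Surjective φ) :
    (restrictScalars φ h).obj V ⊗ (restrictScalars φ h).obj V' ≅
      (restrictScalars φ h).obj (V ⊗ V') :=
  isoMk (V := ((restrictScalars φ h).obj V).tensor ((restrictScalars φ h).obj V'))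
    (V' := (restrictScalars φ h).obj (V.tensor V'))
    (LinearEquiv.ofBijective (restrictTensor φ h V V') (restrictTensor_bijective φ h V V' hφ))
    (equivariant_of_tmul (V := (restrictScalars φ h).obj V) (V' := (restrictScalars φ h).obj V')
      (U := (restrictScalars φ h).obj (V.tensor V')) (restrictTensor φ h V V') fun _ _ _ => rfl)

end

/-- The monoidal structure of `restrictScalars φ`, for bijective `φ`. -/
def restrictCore (hφ : Function.Bijective φ) : (restrictScalars φ h).CoreMonoidal where
  εIso := restrictUnitIso φ h hφ
  μIso V V' := restrictTensorIso φ h V V' hφ.2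
  μIso_hom_natural_left _ _ := tensor_hom_ext fun _ _ => rfl
  μIso_hom_natural_right _ _ := tensor_hom_ext fun _ _ => rfl
  associativity _ _ _ := tensor_hom_ext₃ fun _ _ _ => rfl
  left_unitality _ := tensor_hom_ext fun _ _ => rfl
  right_unitality _ := tensor_hom_ext fun _ _ => rfl

/-- The braided monoidal structure of `restrictScalars φ`, for bijective `φ`. -/
@[reducible]
def restrictBraided (hφ : Function.Bijective φ) : (restrictScalars φ h).Braided where
  toMonoidal := (restrictCore φ h hφ).toMonoidal
  braided _ _ := tensor_hom_ext fun _ _ => rfl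

/-- Restriction of scalars along a bijection is full. -/
theorem exists_restrictScalars_map_eq (hφ : Function.Surjective φ) {V V' : SkewMod S W}
    (f : (restrictScalars φ h).obj V ⟶ (restrictScalars φ h).obj V') :
    ∃ g : V ⟶ V', (restrictScalars φ h).map g = f := by
  refine ⟨⟨⟨⟨f.lin, map_add f.lin⟩, fun s x => ?_⟩, f.map_act⟩, rfl⟩
  obtain ⟨s, rfl⟩ := hφ s
  exact map_smul f.lin s (show ((restrictScalars φ h).obj V).carrier from x)

/-- A preimage of `V` is its restriction of scalars along the inverse of `φ`, with the same
underlying group and the same action of `W`. -/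
theorem exists_restrictScalars_iso (hφ : Function.Bijective φ) (V : SkewMod S' W) :
    ∃ V' : SkewMod S W, Nonempty ((restrictScalars φ h).obj V' ≅ V) := by
  let e := RingEquiv.ofBijective φ hφ
  let V' := (restrictScalars (e.symm : S →+* S') fun w s => by
    obtain ⟨s, rfl⟩ := e.surjective s
    change e.symm (w • φ s) = w • e.symm (e s)
    rw [← h, e.symm_apply_apply]
    exact e.symm_apply_apply (w • s)).obj V
  refine ⟨V', ⟨isoMk (V := (restrictScalars φ h).obj V') (V' := V)
    { toFun := fun x => x
      invFun := fun x => x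
      map_add' := fun _ _ => rfl
      map_smul' := fun s x => ?_
      left_inv := fun _ => rfl
      right_inv := fun _ => rfl } fun _ _ => rfl⟩⟩
  exact congrArg (fun s' : S' => s' • (show V from x)) (e.symm_apply_apply s)

end SkewMod

/-! ### The linearized case -/

namespace CommGreenFunctor

variable {G : Type u} [Group G] (R : CommGreenFunctor G) (Q : Subring ℚ)

theorem isUnit_card_linearization [Finite G] (hQ : (Nat.card G : ℚ)⁻¹ ∈ Q) (X : FinGSet G) :
    IsUnit (Nat.card G : (R.linearization Q).obj X) := by
  have h : IsUnit (Nat.card G : Q) := by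
    refine IsUnit.of_mul_eq_one ⟨_, hQ⟩ (Subtype.ext ?_)
    exact mul_inv_cancel₀ (Nat.cast_ne_zero.2 Nat.card_pos.ne')
  have := h.map (ScalarExt.inclLeft Q (R.obj X))
  rwa [map_natCast] at this

variable [Finite G] (H : Subgroup G)

theorem compareRing_surjective : Function.Surjective (R.compareRing Q H) := fun x => by
  obtain ⟨t, rfl⟩ := Ideal.Quotient.mk_surjective x
  change ∃ a, R.compareRing Q H a = (R.linearization Q).brRing t
  change ScalarExt Q (R.obj (orbit H)) at t
  induction t using ScalarExt.induction with
  | zero => exact ⟨0, by rw [map_zero]; exact (map_zero _).symm⟩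
  | add a b ha hb =>
    obtain ⟨a', ha⟩ := ha
    obtain ⟨b', hb⟩ := hb
    exact ⟨a' + b', by rw [map_add, ha, hb]; exact (map_add _ a b).symm⟩
  | tmul q r => exact ⟨_, R.compareRing_mk Q H q r⟩

/-- A properly induced element of `R_Q(H)` is a sum of terms `q ⊗ r` with `r` properly induced in
`R(H)`. So the map to `Q ⊗ S`, with `S` the Brauer quotient ring of `R`, descends and provides the
inverse of `compareRing`, for every subring `Q`. -/
theorem mapRing_brRing_of_mem {t : ScalarExt Q (R.obj (orbit H))}
    (ht : t ∈ (R.linearization Q).brauerIdeal H) :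
    ScalarExt.mapRing Q (R.brRing (H := H)) t = 0 := by
  refine brauerSub_induction (M := (R.linearization Q).self)
    (p := fun t => ScalarExt.mapRing Q (R.brRing (H := H)) t = 0) ht (map_zero _)
    (fun x y hx hy => (map_add _ x y).trans ((congrArg₂ (· + ·) hx hy).trans (add_zero 0)))
    fun K hK z => ?_
  change ScalarExt Q (R.obj (orbit K)) at z
  change ScalarExt.mapRing Q (R.brRing (H := H))
    (ScalarExt.mapAdd Q (R.ind (orbitProj hK.le)) z) = 0
  induction z using ScalarExt.induction with
  | zero => simp only [map_zero]
  | add a b ha hb => simp only [map_add, ha, hb, add_zero]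
  | tmul q s =>
    rw [ScalarExt.mapAdd_mk, ScalarExt.mapRing_mk]
    have h : R.brRing (R.ind (orbitProj hK.le) s) = 0 :=
      br_eq_zero.2 (ind_mem_brauerSub R.self _ (not_bijective_orbitProj hK) s)
    rw [h]
    exact TensorProduct.tmul_zero _ q

theorem compareRing_injective : Function.Injective (R.compareRing Q H) := by
  let g : (R.linearization Q).BrauerRing H →+* ScalarExt Q (R.BrauerRing H) :=
    Ideal.Quotient.lift ((R.linearization Q).brauerIdeal H)
      (ScalarExt.mapRing Q (R.brRing (H := H))) fun t ht => R.mapRing_brRing_of_mem Q H ht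
  refine Function.LeftInverse.injective (g := g) fun t => ?_
  induction t using ScalarExt.induction with
  | zero => rw [map_zero, map_zero]
  | add a b ha hb => rw [map_add, map_add, ha, hb]
  | tmul q s =>
    obtain ⟨r, rfl⟩ := Ideal.Quotient.mk_surjective s
    exact congrArg g (R.compareRing_mk Q H q r)

theorem compareRing_bijective : Function.Bijective (R.compareRing Q H) :=
  ⟨R.compareRing_injective Q H, R.compareRing_surjective Q H⟩

/-- Bijectivity of `compareRing` is what makes the restriction of scalars strong monoidal: it
identifies the two units and the two tensor products. -/
instance brauerQBraided : (R.brauerQ Q H).Braided :=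
  letI := SkewMod.restrictBraided (R.compareRing Q H) (R.compareRing_smul Q H)
    (R.compareRing_bijective Q H)
  inferInstanceAs ((R.linearization Q).brauer H ⋙ SkewMod.restrictScalars (R.compareRing Q H)
    (R.compareRing_smul Q H)).Braided

variable {Q} {T : Set (Subgroup G)}

/-- Faithfulness is injectivity of marks. For fullness, morphisms are first lifted through the
restriction of scalars and then realized by marks. For essential surjectivity, the given modules are
moved to the Brauer quotient rings of `R_Q` and assembled into a module of equivariant families. -/
theorem brauerProdQ_isEquivalence (hT : IsConjReps T) (hQ : (Nat.card G : ℚ)⁻¹ ∈ Q) :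
    (R.brauerProdQ Q T).IsEquivalence where
  faithful :=
    { map_injective := fun {M N} f g hfg => by
        refine hom_eq_of_brauer_map_eq hT (R.isUnit_card_linearization Q hQ) fun H x => ?_
        have h : (R.brauerQ Q H.1).map f = (R.brauerQ Q H.1).map g := congrFun hfg H
        exact LinearMap.congr_fun (congrArg SkewMod.Hom.lin h) x }
  full :=
    { map_surjective := fun {M N} k => by
        choose h hh using fun H : T => SkewMod.exists_restrictScalars_map_eq
          (R.compareRing Q H.1) (R.compareRing_smul Q H.1) (R.compareRing_surjective Q H.1) (k H)
        obtain ⟨f, hf⟩ := exists_brauer_map_eq hT (R.isUnit_card_linearization Q hQ) h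
        refine ⟨f, funext fun H => ?_⟩
        rw [← hh H, ← hf H]
        rfl }
  essSurj :=
    { mem_essImage := fun V => by
        choose V' e using fun H : T => SkewMod.exists_restrictScalars_iso
          (R.compareRing Q H.1) (R.compareRing_smul Q H.1) (R.compareRing_bijective Q H.1) (V H)
        exact ⟨markModule V', ⟨Pi.isoMk fun H => (SkewMod.restrictScalars (R.compareRing Q H.1)
          (R.compareRing_smul Q H.1)).mapIso (brauerMarkIso hT
            (R.isUnit_card_linearization Q hQ) H) ≪≫ (e H).some⟩⟩ }

end CommGreenFunctor

end

theorem theorem5p1 {G : Type u} [Group G] [Finite G] (R : CommGreenFunctor G) :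
    (∀ H : Subgroup G, ∃ _ : (R.brauer H).Braided,
      (∀ r : R.obj (FinGSet.orbit H),
        (Functor.LaxMonoidal.ε (R.brauer H)).lin (R.brRing r) =
          MackeyModule.br (M := R.self) r) ∧
      ∀ (M N : MackeyModule R) (m : M.obj (FinGSet.orbit H)) (n : N.obj (FinGSet.orbit H)),
        (Functor.LaxMonoidal.μ (R.brauer H) M N).lin
            ((MackeyModule.br m : M.BrauerQuot H) ⊗ₜ[R.BrauerRing H]
              (MackeyModule.br n : N.BrauerQuot H)) =
          MackeyModule.br (MackeyModule.pure m n)) ∧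
    ∀ T : Set (Subgroup G), IsConjReps T →
      Nonempty (R.brauerProd T).Braided ∧
      ∀ Q : Subring ℚ, (Nat.card G : ℚ)⁻¹ ∈ Q →
        (R.brauerProdQ Q T).IsEquivalence ∧ Nonempty (R.brauerProdQ Q T).Braided := by
  -- The explicit formulas for the unit and tensor isomorphisms hold by definition, as
  -- `brauerUnitIso` is the identity of the quotient and `brauerMu` is defined by lifting `(m, n) ↦
  -- [m ⊗ n]`.
  refine ⟨fun H => ⟨inferInstance, fun r => rfl, fun M N m n => rfl⟩, fun T hT =>
    ⟨⟨braidedPi _⟩, fun Q hQ => ⟨R.brauerProdQ_isEquivalence hT hQ, ⟨braidedPi _⟩⟩⟩⟩
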